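/- Let $H$ be a real separable Hilbert space and $(W(h))_{h\in H}$ an isonormal Gaussian process on a probability space $(\Omega,\mathcal A,P)$, i.e. a centered Gaussian family with $\mathbf E[W(g)W(h)]=\langle g,h\rangle_H$. For $1<p<\infty$ let $D:\mathbb D^{1,p}\to L^p(\Omega;H)$ be the Malliavin derivative (the closure in $L^p$ of $g(W(\varphi_1),\dots,W(\varphi_n))\mapsto\sum_i\partial_i g(W(\varphi_1),\dots,W(\varphi_n))\,\varphi_i$, $g\in C_c^\infty(\mathbb R^n)$). Let $L$ be the Ornstein–Uhlenbeck operator, $L F=-\sum_n nI_n(f_n)$ for a random variable $F$ with Wiener chaos expansion $F=\sum_n I_n(f_n)$, extended to $\mathbb D^{2,p}$ by closing it in $L^p$ from the polynomial random variables; for $F\in L^p$ let $(-L)^{-1}(F-\mathbf E[F])$ be the $G\in\mathbb D^{2,p}$ with $\mathbf E[G]=0$ and $-LG=F-\mathbf E[F]$. Let $F$ be one of the following random variables: (i) $F=cW(h)$ with $c\in\mathbb R$, $\|h\|_H=1$; (ii) $F=c(W(h)^2-1)$ with $c\in\mathbb R$, $\|h\|_H=1$; (iii) $F=e^{cW(h)}$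 with $c\in\mathbb R$, $\|h\|_H=1$; (iv) $F=e^{c\sum_{k=1}^nW(h_k)^2}$ with $n\in\mathbb N$, $c\in(-\infty,1/2)$ and $h_1,\dots,h_n$ orthonormal in $H$. Then $F\in L^p$ for some $p\in(1,\infty)$, and for every $p\in(1,\infty)$ with $F\in L^p$ the random variable $\langle D(-L)^{-1}(F-\mathbf E[F]),DF\rangle_H$ (operators taken in $L^p$) exists, is uniquely determined up to null sets, and is (after modification on a null set) measurable with respect to the $\sigma$-field generated by $F$. Almost surely it equals, respectively, (i) $c^2$; (ii) $2cF+2c^2$; (iii) $\displaystyle c^2F\int_0^1F^v\,e^{\frac{c^2}{2}(1-v^2)}\,dv$; (iv) $\displaystyle 4cF\log F\int_0^1\frac{v\,F^{\,v^2/(1-2c(1-v^2))}}{(1-2c(1-v^2))^{\frac n2+1}}\,dv$. Moreover, these cases contain the following laws. In (i), $F\sim N(0,c^2)$. In (ii) with $c>0$, $F$ has the centered Gamma law, i.e. the law of $X-c$ where $X$ is Gamma distributed with shape $\frac12$ and rate $\frac1{2c}$ (so $\mathbf E[X]=c$). In (iii), $F$ is log-normal, the law of $e^{N}$ with $N\sim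 N(0,c^2)$. In (iv) with $n=2$: for $c=-\frac12$, $F$ is uniform on $[0,1]$; for $0<c<\frac12$, $F$ has the Pareto law on $[1,\infty)$ with density $\nu x^{-\nu-1}$, $\nu=\frac1{2c}$; for $c<0$, $F$ has the Beta law with parameters $-\frac1{2c}$ and $1$. -/

import Mathlib

open MeasureTheory ProbabilityTheory Filter Topology
open scoped ENNReal

namespace Malliavin

variable {Ω : Type*} [MeasurableSpace Ω]
  {H : Type*} [NormedAddCommGroup H] [InnerProductSpace ℝ H]

/-- `W` is an isonormal Gaussian process over `H`: a centered Gaussian family of random variables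
indexed by `H` with `E[W(g) W(h)] = ⟨g, h⟩`. -/
structure IsIsonormal (W : H → Ω → ℝ) (P : Measure Ω) : Prop where
  measurable : ∀ h, Measurable (W h)
  gaussian : IsGaussianProcess W P
  centered : ∀ h, ∫ ω, W h ω ∂P = 0
  covariance : ∀ g h, ∫ ω, W g ω * W h ω ∂P = inner ℝ g h

/-! ### The Malliavin derivative -/

/-- The data of a smooth functional `g (W φ₁, …, W φₙ)` with `g` smooth and compactly supported. -/
structure SmoothFunctional (H : Type*) where
  n : ℕ
  g : (Fin n → ℝ) → ℝ
  smooth : ContDiff ℝ (⊤ : ℕ∞) g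
  compact : HasCompactSupport g
  φ : Fin n → H

/-- The random variable `g (W φ₁, …, W φₙ)`. -/
def SmoothFunctional.val (S : SmoothFunctional H) (W : H → Ω → ℝ) : Ω → ℝ :=
  fun ω => S.g fun i => W (S.φ i) ω

/-- The `H`-valued random variable `∑ i, ∂ᵢg (W φ₁, …, W φₙ) φᵢ`. -/
noncomputable def SmoothFunctional.deriv (S : SmoothFunctional H) (W : H → Ω → ℝ) : Ω → H :=
  fun ω => ∑ i, fderiv ℝ S.g (fun j => W (S.φ j) ω) (Pi.single i 1) • S.φ i

/-- `F ∈ 𝔻^{1,p}` and `D F = U`: the pair `(F, U)` is in the closure, in `L^p(Ω) × L^p(Ω; H)`, of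
the graph of the Malliavin derivative on smooth functionals. -/
def HasMalliavinDeriv (W : H → Ω → ℝ) (P : Measure Ω) (p : ℝ≥0∞) (F : Ω → ℝ) (U : Ω → H) :
    Prop :=
  MemLp F p P ∧ MemLp U p P ∧ ∃ S : ℕ → SmoothFunctional H,
    Tendsto (fun k => eLpNorm ((S k).val W - F) p P) atTop (𝓝 0) ∧
    Tendsto (fun k => eLpNorm ((S k).deriv W - U) p P) atTop (𝓝 0)

/-! ### Wiener chaos and the Ornstein-Uhlenbeck operator -/

/-- The Hermite polynomial
`Hₙ(x) = (-1)ⁿ / n! * exp (x² / 2) * (d/dx)ⁿ exp (-x² / 2)`. -/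
noncomputable def hermiteFun (n : ℕ) (x : ℝ) : ℝ :=
  Polynomial.aeval x (Polynomial.hermite n) / (n.factorial : ℝ)

/-- The generators of the Wiener chaoses: the constant `1` for order `0`, and the `Hₙ(W h)` with
`‖h‖ = 1` for order `n ≥ 1`. -/
def chaosGenerators (W : H → Ω → ℝ) (P : Measure Ω) : ℕ → Set (Lp ℝ 2 P)
  | 0 => {f | f =ᵐ[P] fun _ => 1}
  | n + 1 => {f | ∃ h : H, ‖h‖ = 1 ∧ f =ᵐ[P] fun ω => hermiteFun (n + 1) (W h ω)}

/-- The Wiener chaos of order `n`. -/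
noncomputable abbrev wienerChaos (W : H → Ω → ℝ) (P : Measure Ω) (n : ℕ) :
    Submodule ℝ (Lp ℝ 2 P) :=
  (Submodule.span ℝ (chaosGenerators W P n)).topologicalClosure

/-- The component `Iₙ(fₙ)` of order `n` in the chaos expansion of `F`. -/
noncomputable def chaosComponent (W : H → Ω → ℝ) (P : Measure Ω) (n : ℕ) (F : Lp ℝ 2 P) :
    Lp ℝ 2 P :=
  (wienerChaos W P n).starProjection F

/-- `F = ∑ Iₙ(fₙ)` is in the `L²` domain of the Ornstein-Uhlenbeck operator and
`L F = - ∑ n Iₙ(fₙ) = K`. -/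
def HasOUL2 (W : H → Ω → ℝ) (P : Measure Ω) (F K : Lp ℝ 2 P) : Prop :=
  HasSum (fun n : ℕ => chaosComponent W P n F) F ∧
  HasSum (fun n : ℕ => -(n : ℝ) • chaosComponent W P n F) K

/-- Polynomial random variables `q (W φ₁, …, W φₙ)`. -/
def IsPolynomial (W : H → Ω → ℝ) (X : Ω → ℝ) : Prop :=
  ∃ (n : ℕ) (φ : Fin n → H) (q : MvPolynomial (Fin n) ℝ),
    X = fun ω => MvPolynomial.eval (fun i => W (φ i) ω) q

/-- `G ∈ 𝔻^{2,p}` and `L G = K`: the pair `(G, K)` is in the closure, in `L^p × L^p`, of the graph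
of the Ornstein-Uhlenbeck operator on polynomial random variables. -/
def HasOU (W : H → Ω → ℝ) (P : Measure Ω) (p : ℝ≥0∞) (G K : Ω → ℝ) : Prop :=
  MemLp G p P ∧ MemLp K p P ∧ ∃ X Y : ℕ → Lp ℝ 2 P,
    (∀ k, ∃ Q : Ω → ℝ, IsPolynomial W Q ∧ X k =ᵐ[P] Q) ∧
    (∀ k, HasOUL2 W P (X k) (Y k)) ∧
    Tendsto (fun k => eLpNorm (⇑(X k) - G) p P) atTop (𝓝 0) ∧
    Tendsto (fun k => eLpNorm (⇑(Y k) - K) p P) atTop (𝓝 0)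

/-- `G = (-L)⁻¹ F` for a centered `F ∈ L^p`: `G` is centered and `-L G = F`. -/
def IsNegOUInv (W : H → Ω → ℝ) (P : Measure Ω) (p : ℝ≥0∞) (F G : Ω → ℝ) : Prop :=
  ∫ ω, G ω ∂P = 0 ∧ HasOU W P p G (-F)

/-- `Γ` is a version of `⟨D (-L)⁻¹ (F - E[F]), D F⟩_H`, with the operators taken in `L^p`. -/
def IsMalliavinBracket (W : H → Ω → ℝ) (P : Measure Ω) (p : ℝ≥0∞) (F Γ : Ω → ℝ) : Prop :=
  ∃ (G : Ω → ℝ) (V U : Ω → H),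
    IsNegOUInv W P p (fun ω => F ω - ∫ ω', F ω' ∂P) G ∧
    HasMalliavinDeriv W P p G V ∧ HasMalliavinDeriv W P p F U ∧
    Γ =ᵐ[P] fun ω => inner ℝ (V ω) (U ω)

/-- The four families of random variables `F`, each with the formula `R` in terms of `F`. -/
inductive Family (W : H → Ω → ℝ) : (Ω → ℝ) → (Ω → ℝ) → Prop
  | linear (c : ℝ) (h : H) (hh : ‖h‖ = 1) (F : Ω → ℝ) (hF : F = fun ω => c * W h ω) :
      Family W F (fun _ => c ^ 2)
  | square (c : ℝ) (h : H) (hh : ‖h‖ = 1) (F : Ω → ℝ) (hF : F = fun ω => c * (W h ω ^ 2 - 1)) :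
      Family W F (fun ω => 2 * c * F ω + 2 * c ^ 2)
  | exp (c : ℝ) (h : H) (hh : ‖h‖ = 1) (F : Ω → ℝ) (hF : F = fun ω => Real.exp (c * W h ω)) :
      Family W F (fun ω =>
        c ^ 2 * F ω * ∫ v in (0 : ℝ)..1, F ω ^ v * Real.exp (c ^ 2 / 2 * (1 - v ^ 2)))
  | expSquares (n : ℕ) (c : ℝ) (hc : c < 1 / 2) (h : Fin n → H) (hh : Orthonormal ℝ h)
      (F : Ω → ℝ) (hF : F = fun ω => Real.exp (c * ∑ k, W (h k) ω ^ 2)) :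
      Family W F (fun ω =>
        4 * c * F ω * Real.log (F ω) * ∫ v in (0 : ℝ)..1,
          v * F ω ^ (v ^ 2 / (1 - 2 * c * (1 - v ^ 2))) /
            (1 - 2 * c * (1 - v ^ 2)) ^ ((n : ℝ) / 2 + 1))

end Malliavin

set_option linter.unusedSectionVars false

namespace Malliavin

/-! Every `F` in the four families is a function `f` of finitely many independent standard Gaussians
`x = (W e₁, …, W eₙ)`, so existence of the bracket is a question about Gaussian measure on `ℝⁿ`.
Parametrise the Mehler semigroup by `v = e^{-t}`, so that `M_v f (x) = E f (v x + √(1 - v²) Z)`.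
Then `M_1 f = f`, `M_0 f = E f`, and `L M_v f = -v ∂_v M_v f`. Hence `u = ∫₀¹ (M_v f - E f) / v dv`
satisfies `-L u = f - E f`, and its gradient is `∫₀¹ v⁻¹ ∇M_v f dv`. For `f = exp ψ` with `ψ` linear
or a multiple of `∑ xᵢ²`, the transform is again of the form `θ(v) exp (α(v) ψ)`. The bracket is
therefore `|∇ψ|² f ∫₀¹ θ(v) v⁻¹ α(v) f^{α(v)} dv`. The families (i) and (ii) lie in the first and
second chaos, where `(-L)⁻¹` multiplies by `1` and `1/2`.

The operators are `L^p` closures, so these computations must be carried by approximations.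
`InJetClosure` records the value, the gradient and the Ornstein-Uhlenbeck image of a function at
once, as an `L^p` limit of the same data for polynomials. It is stable under linear combinations,
dominated limits and integrals in `v`. Exponentials enter it through Taylor polynomials taken in
many small steps (`inJetClosure_expJet_C_mul`), and `exists_inJetClosure_of_mehler` performs the
integral in `v`. `InJetClosure.hasOU` and `InJetClosure.hasMalliavinDeriv` transfer the result to
`Ω`.

Uniqueness rests on a separation principle: a `σ(W)`-measurable variable in `L^p`, `p > 1`, that is
orthogonal to all powers of all `W g` vanishes (`ae_eq_zero_of_forall_integral_mul_pow`). Pairings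
with Hermite polynomials determine `(-L)⁻¹` (`IsNegOUInv.ae_eq`), and Gaussian integration by parts
determines the derivative (`HasMalliavinDeriv.ae_eq`). Measurability with respect to `F` then holds
because the explicit formula is a Borel function of `F`.

The laws are changes of variables. For two Gaussians, polar coordinates reduce the sum of squares to
the Rayleigh density. -/

theorem memLp_exp_of_integrable {α : Type*} [MeasurableSpace α] {μ : Measure α} {g : α → ℝ}
    (hg : AEMeasurable g μ) {p : ℝ≥0∞} (hp0 : p ≠ 0) (hp : p ≠ ∞) :
    MemLp (fun x => Real.exp (g x)) p μ ↔ Integrable (fun x => Real.exp (p.toReal * g x)) μ := by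
  have hm : AEStronglyMeasurable (fun x => Real.exp (g x)) μ := hg.exp.aestronglyMeasurable
  rw [← integrable_norm_rpow_iff hm hp0 hp]
  refine integrable_congr (Eventually.of_forall fun x => ?_)
  simp only [Real.norm_eq_abs, Real.abs_exp, ← Real.exp_mul, mul_comm]

/-! ### Linearity and exponential moments of an isonormal process. -/

section

variable {Ω : Type*} [MeasurableSpace Ω] {P : Measure Ω} [IsProbabilityMeasure P]
  {H : Type*} [NormedAddCommGroup H] [InnerProductSpace ℝ H] {W : H → Ω → ℝ}

namespace IsIsonormal

theorem hasGaussianLaw (hW : IsIsonormal W P) (h : H) : HasGaussianLaw (W h) P :=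
  hW.gaussian.hasGaussianLaw_eval h

theorem memLp (hW : IsIsonormal W P) (h : H) {p : ℝ≥0∞} (hp : p ≠ ∞) : MemLp (W h) p P :=
  (hW.hasGaussianLaw h).memLp hp

theorem cov_eq (hW : IsIsonormal W P) (g h : H) : cov[W g, W h; P] = inner ℝ g h := by
  rw [covariance_eq_sub (hW.memLp g (by simp)) (hW.memLp h (by simp)), hW.centered, hW.centered]
  simpa using hW.covariance g h

theorem map_eq (hW : IsIsonormal W P) (h : H) :
    P.map (W h) = gaussianReal 0 (Real.toNNReal (‖h‖ ^ 2)) := by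
  rw [(hW.hasGaussianLaw h).map_eq_gaussianReal, hW.centered,
    ← covariance_self (hW.measurable h).aemeasurable, hW.cov_eq, real_inner_self_eq_norm_sq]

theorem map_eq_of_norm (hW : IsIsonormal W P) {h : H} (hh : ‖h‖ = 1) :
    P.map (W h) = gaussianReal 0 1 := by
  rw [hW.map_eq, hh]; simp

theorem integrable_mul (hW : IsIsonormal W P) (g h : H) :
    Integrable (fun ω => W g ω * W h ω) P :=
  (hW.memLp g (p := 2) (by simp)).integrable_mul (hW.memLp h (p := 2) (by simp))

/-- Linearity is not part of `IsIsonormal`; it follows from the covariance. The difference `Z` of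
the two sides is orthogonal in `L²` to every `W k`, hence to itself. -/
theorem ae_sum {ι : Type*} [Fintype ι] (hW : IsIsonormal W P) (a : ι → ℝ) (φ : ι → H) :
    W (∑ i, a i • φ i) =ᵐ[P] fun ω => ∑ i, a i * W (φ i) ω := by
  set x := ∑ i, a i • φ i with hx
  set Z : Ω → ℝ := fun ω => W x ω - ∑ i, a i * W (φ i) ω with hZ
  have hint : ∀ k, Integrable (fun ω => Z ω * W k ω) P := by
    intro k
    simp only [hZ, sub_mul, Finset.sum_mul]
    refine (hW.integrable_mul _ _).sub (integrable_finsetSum _ fun i _ => ?_)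
    simpa [mul_assoc] using (hW.integrable_mul (φ i) k).const_mul (a i)
  have h0 : ∀ k, ∫ ω, Z ω * W k ω ∂P = 0 := by
    intro k
    simp only [hZ, sub_mul, Finset.sum_mul]
    rw [integral_sub (hW.integrable_mul _ _), integral_finsetSum]
    · simp only [mul_assoc, integral_const_mul, hW.covariance, hx, sum_inner, inner_smul_left]
      simp
    · intro i _
      simpa [mul_assoc] using (hW.integrable_mul (φ i) k).const_mul (a i)
    · refine integrable_finsetSum _ fun i _ => ?_
      simpa [mul_assoc] using (hW.integrable_mul (φ i) k).const_mul (a i)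
  have hsq : ∫ ω, Z ω * Z ω ∂P = 0 := by
    have : (fun ω => Z ω * Z ω) = fun ω => Z ω * W x ω - ∑ i, a i * (Z ω * W (φ i) ω) := by
      funext ω
      have : Z ω * Z ω = Z ω * (W x ω - ∑ i, a i * W (φ i) ω) := rfl
      rw [this, mul_sub, Finset.mul_sum]
      congr 1
      exact Finset.sum_congr rfl fun i _ => by ring
    rw [this, integral_sub (hint x) (integrable_finsetSum _ fun i _ => (hint _).const_mul _),
      integral_finsetSum _ fun i _ => (hint _).const_mul _]
    simp [integral_const_mul, h0]
  have hZm : MemLp Z 2 P := by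
    refine (hW.memLp x (by simp)).sub (memLp_finsetSum _ fun i _ => ?_)
    exact (hW.memLp (φ i) (by simp)).const_mul (a i)
  have := (integral_eq_zero_iff_of_nonneg (fun ω => mul_self_nonneg (Z ω))
    (hZm.integrable_mul hZm)).1 hsq
  filter_upwards [this] with ω hω
  have : Z ω = 0 := by simpa using hω
  simpa [hZ, sub_eq_zero] using this

theorem ae_smul (hW : IsIsonormal W P) (a : ℝ) (h : H) :
    W (a • h) =ᵐ[P] fun ω => a * W h ω := by
  simpa using hW.ae_sum (fun _ : Unit => a) (fun _ => h)

theorem integrable_exp_mul (hW : IsIsonormal W P) (t : ℝ) (h : H) :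
    Integrable (fun ω => Real.exp (t * W h ω)) P := by
  have := integrable_exp_mul_gaussianReal (μ := 0) (v := Real.toNNReal (‖h‖ ^ 2)) t
  rw [← hW.map_eq] at this
  exact this.comp_measurable (hW.measurable h)

theorem memLp_exp_mul (hW : IsIsonormal W P) (t : ℝ) (h : H) {p : ℝ≥0∞} (hp : p ≠ ∞) :
    MemLp (fun ω => Real.exp (t * W h ω)) p P := by
  rcases eq_or_ne p 0 with rfl | hp0
  · simpa using ((hW.measurable h).const_mul t).exp.aestronglyMeasurable
  rw [memLp_exp_of_integrable ((hW.measurable h).const_mul t).aemeasurable hp0 hp]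
  simpa [mul_assoc] using hW.integrable_exp_mul (p.toReal * t) h

theorem memLp_exp_abs (hW : IsIsonormal W P) (h : H) {p : ℝ≥0∞} (hp : p ≠ ∞) :
    MemLp (fun ω => Real.exp |W h ω|) p P := by
  refine ((hW.memLp_exp_mul 1 h hp).add (hW.memLp_exp_mul (-1) h hp)).mono'
    (hW.measurable h).abs.exp.aestronglyMeasurable (Eventually.of_forall fun ω => ?_)
  rw [Real.norm_eq_abs, Real.abs_exp]
  simpa using Real.exp_abs_le (W h ω)

end IsIsonormal

/-- The `σ`-algebra generated by the process `W`. -/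
@[reducible] def sigmaW (W : H → Ω → ℝ) : MeasurableSpace Ω :=
  MeasurableSpace.comap (fun ω h => W h ω) MeasurableSpace.pi

/-! ### The σ-algebra of the process and separation of its `L^p` functionals by powers. -/

theorem sigmaW_le (hW : IsIsonormal W P) : sigmaW W ≤ ‹MeasurableSpace Ω› :=
  (measurable_pi_lambda _ hW.measurable).comap_le

theorem measurable_sigmaW (W : H → Ω → ℝ) (h : H) : Measurable[sigmaW W] (W h) :=
  (measurable_pi_apply h).comp (comap_measurable fun ω h => W h ω)

/-- Integrate the power series of the exponential term by term. The absolute values sum to `|f| exp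
|W g|`, which is integrable by Hölder because `W g` has exponential moments of all orders. -/
theorem integral_mul_cexp_eq_zero (hW : IsIsonormal W P) {p : ℝ≥0∞} (hp : 1 < p) {f : Ω → ℝ}
    (hf : MemLp f p P) (g : H) (h0 : ∀ n : ℕ, ∫ ω, f ω * W g ω ^ n ∂P = 0) :
    ∫ ω, (f ω : ℂ) * Complex.exp (W g ω * Complex.I) ∂P = 0 := by
  have hconj : ENNReal.HolderConjugate p p.conjExponent := ENNReal.HolderConjugate.conjExponent hp.le
  have hq : p.conjExponent ≠ ∞ := by
    have := ENNReal.HolderConjugate.lt_top_iff_one_lt (p := p.conjExponent) (q := p)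
    exact (this.2 hp).ne
  have hmeas : ∀ n : ℕ, AEStronglyMeasurable
      (fun ω => (f ω : ℂ) * ((W g ω * Complex.I) ^ n / (n.factorial : ℂ))) P := by
    intro n
    refine (Complex.continuous_ofReal.comp_aestronglyMeasurable hf.1).mul ?_
    exact (((Complex.measurable_ofReal.comp (hW.measurable g)).mul_const _).pow_const _
      |>.div_const _).aestronglyMeasurable
  have hE := (hW.memLp_exp_abs g hq).integrable_mul hf
  have key := hasSum_integral_of_dominated_convergence (μ := P)
    (F := fun (n : ℕ) ω => (f ω : ℂ) * ((W g ω * Complex.I) ^ n / (n.factorial : ℂ)))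
    (f := fun ω => (f ω : ℂ) * Complex.exp (W g ω * Complex.I))
    (fun n ω => |f ω| * (|W g ω| ^ n / n.factorial)) hmeas
    (fun n => Eventually.of_forall fun ω => by simp)
    (Eventually.of_forall fun ω => (Real.summable_pow_div_factorial _).mul_left _)
    (by
      refine hE.abs.congr (Eventually.of_forall fun ω => ?_)
      simp only [Pi.mul_apply, abs_mul, Real.abs_exp]
      rw [tsum_mul_left, Real.exp_eq_exp_ℝ, NormedSpace.exp_eq_tsum_div, mul_comm])
    (Eventually.of_forall fun ω => by
      refine HasSum.mul_left _ ?_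
      rw [Complex.exp_eq_exp_ℂ]
      exact NormedSpace.expSeries_div_hasSum_exp _)
  refine key.unique ?_ |>.symm ▸ rfl
  have : ∀ n : ℕ, ∫ ω, (f ω : ℂ) * ((W g ω * Complex.I) ^ n / (n.factorial : ℂ)) ∂P = 0 := by
    intro n
    have : (fun ω => (f ω : ℂ) * ((W g ω * Complex.I) ^ n / (n.factorial : ℂ))) =
        fun ω => (Complex.I ^ n / n.factorial) * ((f ω * W g ω ^ n : ℝ) : ℂ) := by
      funext ω; push_cast; rw [mul_pow]; ring
    rw [this, integral_const_mul, integral_complex_ofReal, h0]; simp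
  simp only [this]
  exact hasSum_zero

/-- Separation: an `L^p` functional of `W` orthogonal to all powers of all `W g` vanishes. -/
theorem ae_eq_zero_of_forall_integral_mul_pow (hW : IsIsonormal W P) {p : ℝ≥0∞} (hp : 1 < p)
    {f : Ω → ℝ} (hf : MemLp f p P) (hfm : AEStronglyMeasurable[sigmaW W] f P)
    (h0 : ∀ (g : H) (n : ℕ), ∫ ω, f ω * W g ω ^ n ∂P = 0) : f =ᵐ[P] 0 := by
  have hint : Integrable f P := hf.integrable hp.le
  set X : Ω → H → ℝ := fun ω h => W h ω with hX
  have hXm : Measurable X := measurable_pi_lambda _ hW.measurable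
  -- The positive and negative parts of `f` are densities of two finite measures. It is enough that
  -- these have the same image under the process, which is checked on finite-dimensional marginals
  -- by characteristic functions.
  set μp := P.withDensity fun ω => ENNReal.ofReal (f ω) with hμp
  set μm := P.withDensity fun ω => ENNReal.ofReal (-f ω) with hμm
  have : IsFiniteMeasure μp := isFiniteMeasure_withDensity_ofReal hint.2
  have : IsFiniteMeasure μm := isFiniteMeasure_withDensity_ofReal hint.neg.2
  have hdiff : ∀ {u : Ω → ℂ}, Measurable u → (∀ ω, ‖u ω‖ ≤ 1) →
      ∫ ω, u ω ∂μp - ∫ ω, u ω ∂μm = ∫ ω, (f ω : ℂ) * u ω ∂P := by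
    intro u hu hb
    have hfu : Integrable (fun ω => (f ω : ℂ) * u ω) P := by
      refine hint.ofReal.mul_bdd (c := 1) hu.aestronglyMeasurable (Eventually.of_forall hb)
    have e1 : ∫ ω, u ω ∂μp = ∫ ω, ((max (f ω) 0 : ℝ) : ℂ) * u ω ∂P := by
      rw [hμp, integral_withDensity_eq_integral_toReal_smul₀ hint.1.aemeasurable.ennreal_ofReal
        (by simp)]
      refine integral_congr_ae (Eventually.of_forall fun ω => ?_)
      simp [ENNReal.toReal_ofReal']
    have e2 : ∫ ω, u ω ∂μm = ∫ ω, ((max (-f ω) 0 : ℝ) : ℂ) * u ω ∂P := by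
      have hm : AEMeasurable (fun ω => ENNReal.ofReal (-f ω)) P :=
        hint.1.aemeasurable.neg.ennreal_ofReal
      rw [hμm, integral_withDensity_eq_integral_toReal_smul₀ hm (by simp)]
      refine integral_congr_ae (Eventually.of_forall fun ω => ?_)
      simp [ENNReal.toReal_ofReal']
    rw [e1, e2, ← integral_sub]
    · refine integral_congr_ae (Eventually.of_forall fun ω => ?_)
      simp only
      rw [← sub_mul, ← Complex.ofReal_sub]
      congr 2
      rcases le_total (f ω) 0 with h | h
      · rw [max_eq_right h, max_eq_left (by linarith)]; ring
      · rw [max_eq_left h, max_eq_right (by linarith)]; ring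
    · exact hint.pos_part.ofReal.mul_bdd (c := 1) hu.aestronglyMeasurable (Eventually.of_forall hb)
    · exact hint.neg_part.ofReal.mul_bdd (c := 1) hu.aestronglyMeasurable (Eventually.of_forall hb)
  have hfin : ∀ I : Finset H, (μp.map X).map I.restrict = (μm.map X).map I.restrict := by
    classical
    intro I
    have hIm : Measurable (I.restrict (π := fun _ : H => ℝ)) := Finset.measurable_restrict I
    refine Measure.ext_of_charFunDual (funext fun L => ?_)
    rw [charFunDual_apply, charFunDual_apply]
    rw [Measure.map_map hIm hXm, Measure.map_map hIm hXm]
    have hm : Measurable (fun v : I → ℝ => Complex.exp (L v * Complex.I)) := by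
      have : Continuous (fun v : I → ℝ => Complex.exp (L v * Complex.I)) := by fun_prop
      exact this.measurable
    rw [integral_map (hIm.comp hXm).aemeasurable hm.aestronglyMeasurable,
      integral_map (hIm.comp hXm).aemeasurable hm.aestronglyMeasurable, ← sub_eq_zero]
    refine (hdiff (hm.comp (hIm.comp hXm)) (fun ω => by
        simp [Complex.norm_exp_ofReal_mul_I])).trans ?_
    -- A linear functional of finitely many coordinates is almost surely a single `W g`, so
    -- one-dimensional exponentials suffice.
    set g : H := ∑ i : I, L (Pi.single i 1) • (i : H) with hg
    rw [← integral_mul_cexp_eq_zero hW hp hf g (h0 g)]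
    refine integral_congr_ae ?_
    filter_upwards [hW.ae_sum (fun i : I => L (Pi.single i 1)) (fun i : I => (i : H))] with ω hω
    have : L (I.restrict (X ω)) = W g ω := by
      rw [hg, hω]
      conv_lhs => rw [← Finset.univ_sum_single (I.restrict (X ω))]
      rw [map_sum]
      refine Finset.sum_congr rfl fun i _ => ?_
      have : (Pi.single i (I.restrict (X ω) i) : I → ℝ) =
          (I.restrict (X ω) i) • (Pi.single i 1 : I → ℝ) := by
        rw [← Pi.single_smul]; simp
      rw [this, map_smul, smul_eq_mul, mul_comm]
      rfl
    simp [this]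
  have hmap : μp.map X = μm.map X := by
    refine IsProjectiveLimit.unique (P := fun I : Finset H => (μp.map X).map I.restrict)
      (fun I => rfl) (fun I => (hfin I).symm)
  obtain ⟨f', hf'm, hff'⟩ := hfm
  have hint' : Integrable f' P := hint.congr hff'
  have hle := sigmaW_le hW
  have hset : ∀ s, MeasurableSet[sigmaW W] s → ∫ ω in s, f ω ∂P = 0 := by
    rintro s ⟨B, hB, rfl⟩
    have hS : MeasurableSet (X ⁻¹' B) := hXm hB
    have h1 : μp (X ⁻¹' B) = μm (X ⁻¹' B) := by
      rw [← Measure.map_apply hXm hB, hmap, Measure.map_apply hXm hB]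
    have h2 := hdiff (u := (X ⁻¹' B).indicator fun _ => 1)
      (measurable_const.indicator hS) (fun ω => by
        by_cases hω : ω ∈ X ⁻¹' B <;> simp [hω])
    rw [integral_indicator hS, integral_indicator hS] at h2
    simp only [integral_const, MeasurableSet.univ, measureReal_def, Measure.restrict_apply,
      Set.univ_inter, h1, sub_self] at h2
    have h3 : (fun ω => (f ω : ℂ) * (X ⁻¹' B).indicator (fun _ => (1 : ℂ)) ω) =
        (X ⁻¹' B).indicator fun ω => (f ω : ℂ) := by
      funext ω; by_cases hω : ω ∈ X ⁻¹' B <;> simp [hω]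
    rw [h3, integral_indicator hS, integral_complex_ofReal] at h2
    exact_mod_cast h2.symm
  have hz : f' =ᵐ[P.trim hle] 0 := by
    refine ae_eq_zero_of_forall_setIntegral_eq_of_sigmaFinite
      (fun s _ _ => (hint'.trim hle hf'm).integrableOn) fun s hs _ => ?_
    rw [← setIntegral_trim hle hf'm hs, ← hset s hs]
    exact setIntegral_congr_ae (hle s hs) (hff'.mono fun ω h _ => h.symm)
  exact hff'.trans (ae_eq_of_ae_eq_trim hz)

end

end Malliavin

namespace Malliavin

/-! ### Calculus of polynomials -/

theorem hasFDerivAt_eval {ι : Type*} [Fintype ι] (q : MvPolynomial ι ℝ) (x : ι → ℝ) :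
    HasFDerivAt (fun y : ι → ℝ => MvPolynomial.eval y q)
      (∑ i, MvPolynomial.eval x (MvPolynomial.pderiv i q) •
        (ContinuousLinearMap.proj i : (ι → ℝ) →L[ℝ] ℝ)) x := by
  classical
  induction q using MvPolynomial.induction_on with
  | C a => simpa using hasFDerivAt_const (𝕜 := ℝ) a x
  | add p q hp hq =>
    simp only [map_add, add_smul, Finset.sum_add_distrib]
    exact hp.add hq
  | mul_X p j hp =>
    have h := hp.mul (ContinuousLinearMap.proj (R := ℝ) (φ := fun _ : ι => ℝ) j).hasFDerivAt
    simp only [map_mul, MvPolynomial.eval_X]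
    refine h.congr_fderiv ?_
    ext v
    simp [Derivation.leibniz, MvPolynomial.pderiv_X, Pi.single_apply, Finset.mul_sum, add_mul,
      Finset.sum_add_distrib, mul_assoc, ite_mul, apply_ite]

theorem contDiff_eval {ι : Type*} [Fintype ι] (q : MvPolynomial ι ℝ) {k : WithTop ℕ∞} :
    ContDiff ℝ k (fun y : ι → ℝ => MvPolynomial.eval y q) := by
  induction q using MvPolynomial.induction_on with
  | C a => simpa using contDiff_const
  | add p q hp hq => simpa using hp.add hq
  | mul_X p j hp => simpa using hp.mul (contDiff_apply ℝ ℝ j)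

theorem continuous_eval {ι : Type*} (q : MvPolynomial ι ℝ) :
    Continuous (fun y : ι → ℝ => MvPolynomial.eval y q) := by
  induction q using MvPolynomial.induction_on with
  | C a => simpa using continuous_const
  | add p q hp hq => simp only [map_add]; exact hp.add hq
  | mul_X p j hp =>
    simp only [map_mul, MvPolynomial.eval_X]
    exact hp.mul (continuous_apply j)

/-- All finite exponents are treated together so that the induction closes: a product in `L^r` needs
both factors in `L^{2r}`. -/
theorem memLp_eval {α ι : Type*} [MeasurableSpace α] {μ : Measure α} [IsFiniteMeasure μ]
    {X : ι → α → ℝ} (hX : ∀ i (p : ℝ≥0∞), p ≠ ∞ → MemLp (X i) p μ) (q : MvPolynomial ι ℝ) :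
    ∀ p : ℝ≥0∞, p ≠ ∞ → MemLp (fun a => MvPolynomial.eval (fun i => X i a) q) p μ := by
  induction q using MvPolynomial.induction_on with
  | C a => intro p hp; simpa using memLp_const a
  | add p q hp hq => intro r hr; simp only [map_add]; exact (hp r hr).add (hq r hr)
  | mul_X q j hq =>
    intro r hr
    have h2 : (r * 2) ≠ ∞ := ENNReal.mul_ne_top hr (by simp)
    have : ENNReal.HolderTriple (r * 2) (r * 2) r := ⟨by
      rcases eq_or_ne r 0 with rfl | h0
      · simp
      rw [ENNReal.mul_inv (by simp) (by simp), ← mul_add, ENNReal.inv_two_add_inv_two, mul_one]⟩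
    simpa using (hX j _ h2).mul' (hq _ h2) (r := r)

/-! ### Gaussian integration by parts -/

/-- Stein's identity: the derivative of the Gaussian density times `f` is the density times `f' - x
f`, and an integrable derivative of an integrable function has integral zero. -/
theorem integral_deriv_gaussianReal {f f' : ℝ → ℝ} (hf : ∀ x, HasDerivAt f (f' x) x)
    (h1 : Integrable f (gaussianReal 0 1)) (h2 : Integrable (fun x => f x * x) (gaussianReal 0 1))
    (h3 : Integrable f' (gaussianReal 0 1)) :
    ∫ x, f' x ∂gaussianReal 0 1 = ∫ x, f x * x ∂gaussianReal 0 1 := by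
  have hiff : ∀ u : ℝ → ℝ, Integrable u (gaussianReal 0 1) →
      Integrable (fun x => gaussianPDFReal 0 1 x * u x) := by
    intro u hu
    rw [gaussianReal_of_var_ne_zero 0 one_ne_zero, integrable_withDensity_iff_integrable_smul'
      (measurable_gaussianPDF 0 1) (Eventually.of_forall fun _ => gaussianPDF_lt_top)] at hu
    simpa using hu
  have hpdf : ∀ x, HasDerivAt (gaussianPDFReal 0 1) (-x * gaussianPDFReal 0 1 x) x := by
    intro x
    have : HasDerivAt (fun x : ℝ => -(x - 0) ^ 2 / (2 * ((1 : NNReal) : ℝ))) (-x) x := by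
      have := ((((hasDerivAt_id x).sub_const 0).pow 2).neg).div_const (2 * ((1 : NNReal) : ℝ))
      refine this.congr_deriv ?_
      simp
      ring
    have := (this.exp).const_mul ((√(2 * Real.pi * ((1 : NNReal) : ℝ)))⁻¹)
    rw [gaussianPDFReal_def]
    refine this.congr_deriv ?_
    ring
  have key := integral_eq_zero_of_hasDerivAt_of_integrable
    (f := fun x => gaussianPDFReal 0 1 x * f x)
    (f' := fun x => gaussianPDFReal 0 1 x * f' x - gaussianPDFReal 0 1 x * (f x * x))
    (fun x => ((hpdf x).mul (hf x)).congr_deriv (by ring))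
    ((hiff _ h3).sub (hiff _ h2)) (hiff _ h1)
  rw [integral_sub (hiff _ h3) (hiff _ h2), sub_eq_zero] at key
  rw [integral_gaussianReal_eq_integral_smul one_ne_zero,
    integral_gaussianReal_eq_integral_smul one_ne_zero]
  simpa using key

variable {Ω : Type*} [MeasurableSpace Ω] {P : Measure Ω} [IsProbabilityMeasure P]
  {H : Type*} [NormedAddCommGroup H] [InnerProductSpace ℝ H] {W : H → Ω → ℝ}

theorem map_pair_eq_prod (hW : IsIsonormal W P) {ι : Type*} [Fintype ι] {h : H} (hh : ‖h‖ = 1)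
    (ψ : ι → H) (hψ : ∀ i, inner ℝ h (ψ i) = 0) :
    P.map (fun ω => (W h ω, fun i => W (ψ i) ω)) =
      (gaussianReal 0 1).prod (P.map fun ω i => W (ψ i) ω) := by
  have hG : IsGaussianProcess (Sum.elim (fun _ : Unit => W h) fun i => W (ψ i)) P := by
    have := hW.gaussian.comp_right (Sum.elim (fun _ : Unit => h) ψ)
    have e : (Sum.elim (fun _ : Unit => W h) fun i => W (ψ i)) =
        W ∘ Sum.elim (fun _ : Unit => h) ψ := by
      funext s; cases s <;> rfl
    rwa [e]
  have hind := hG.indepFun_of_covariance_eq_zero (fun _ => (hW.measurable _).aemeasurable)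
    (fun _ => (hW.measurable _).aemeasurable) (fun _ i => by rw [hW.cov_eq, hψ])
  have hind' : IndepFun (W h) (fun ω i => W (ψ i) ω) P :=
    hind.comp (φ := fun u : Unit → ℝ => u ()) (ψ := id) (measurable_pi_apply _) measurable_id
  rw [← hW.map_eq_of_norm hh]
  exact (indepFun_iff_map_prod_eq_prod_map_map (hW.measurable h).aemeasurable
    (measurable_pi_lambda _ fun i => hW.measurable _).aemeasurable).1 hind'

/-- Split `φ i = ⟨φ i, h⟩ h + ψ i` with `ψ i` orthogonal to `h`. The Gaussian `W h` is independent
of the `W (ψ i)`, so with those held fixed the claim is the one-dimensional Stein identity along the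
line of direction `a`. -/
theorem integral_fderiv_eq (hW : IsIsonormal W P) {ι : Type*} [Fintype ι] {h : H} (hh : ‖h‖ = 1)
    (φ : ι → H) {u : (ι → ℝ) → ℝ} (hu : ContDiff ℝ 1 u)
    (h1 : Integrable (fun ω => u fun i => W (φ i) ω) P)
    (h2 : Integrable (fun ω => (u fun i => W (φ i) ω) * W h ω) P)
    (h3 : Integrable (fun ω => fderiv ℝ u (fun i => W (φ i) ω) fun i => inner ℝ (φ i) h) P) :
    ∫ ω, fderiv ℝ u (fun i => W (φ i) ω) (fun i => inner ℝ (φ i) h) ∂P =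
      ∫ ω, (u fun i => W (φ i) ω) * W h ω ∂P := by
  set a : ι → ℝ := fun i => inner ℝ (φ i) h with ha
  set ψ : ι → H := fun i => φ i - a i • h with hψ
  have hψ0 : ∀ i, inner ℝ h (ψ i) = 0 := by
    intro i
    simp [hψ, ha, inner_sub_right, inner_smul_right, hh, real_inner_comm]
  have hjoint := map_pair_eq_prod hW hh ψ hψ0
  set Z : Ω → ι → ℝ := fun ω i => W (ψ i) ω with hZ
  have hZm : Measurable Z := measurable_pi_lambda _ fun i => hW.measurable _
  have hXZ : Measurable fun ω => (W h ω, Z ω) := (hW.measurable h).prodMk hZm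
  have hdec : ∀ᵐ ω ∂P, (fun i => W (φ i) ω) = W h ω • a + Z ω := by
    have : ∀ i, ∀ᵐ ω ∂P, W (φ i) ω = W h ω * a i + W (ψ i) ω := by
      intro i
      have e : ∑ b : Bool, (if b then a i else 1) • (if b then h else ψ i) = φ i := by simp [hψ]
      have := hW.ae_sum (fun b : Bool => if b then a i else 1) (fun b => if b then h else ψ i)
      rw [e] at this
      filter_upwards [this] with ω hω
      rw [hω]; simp [mul_comm]
    filter_upwards [ae_all_iff.2 this] with ω hω
    funext i
    simp [hω i, hZ]
  have huc : Continuous u := hu.continuous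
  have hdc : Continuous fun v => fderiv ℝ u v a :=
    (hu.continuous_fderiv (by simp)).clm_apply continuous_const
  set T : ℝ × (ι → ℝ) → (ι → ℝ) := fun y => y.1 • a + y.2 with hT
  have hTc : Continuous T := by fun_prop
  have tr : ∀ v : ℝ × (ι → ℝ) → ℝ, Continuous v →
      Integrable (fun ω => v (W h ω, Z ω)) P →
      Integrable v ((gaussianReal 0 1).prod (P.map Z)) ∧
      ∫ ω, v (W h ω, Z ω) ∂P = ∫ z, ∫ x, v (x, z) ∂gaussianReal 0 1 ∂P.map Z := by
    intro v hv hi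
    have hi' : Integrable v ((gaussianReal 0 1).prod (P.map Z)) := by
      rw [← hjoint]
      exact (integrable_map_measure hv.aestronglyMeasurable hXZ.aemeasurable).2 hi
    refine ⟨hi', ?_⟩
    have : IsProbabilityMeasure (P.map Z) := Measure.isProbabilityMeasure_map hZm.aemeasurable
    rw [← integral_prod_symm _ hi', ← hjoint, integral_map hXZ.aemeasurable hv.aestronglyMeasurable]
  have e1 : (fun ω => u fun i => W (φ i) ω) =ᵐ[P] fun ω => u (T (W h ω, Z ω)) := by
    filter_upwards [hdec] with ω hω; rw [hω]
  have e2 : (fun ω => (u fun i => W (φ i) ω) * W h ω) =ᵐ[P]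
      fun ω => u (T (W h ω, Z ω)) * (W h ω, Z ω).1 := by
    filter_upwards [hdec] with ω hω; rw [hω]
  have e3 : (fun ω => fderiv ℝ u (fun i => W (φ i) ω) a) =ᵐ[P]
      fun ω => fderiv ℝ u (T (W h ω, Z ω)) a := by
    filter_upwards [hdec] with ω hω; rw [hω]
  obtain ⟨i1, -⟩ := tr (fun y => u (T y)) (huc.comp hTc) (h1.congr e1)
  obtain ⟨i2, j2⟩ := tr (fun y => u (T y) * y.1) ((huc.comp hTc).mul continuous_fst) (h2.congr e2)
  obtain ⟨i3, j3⟩ := tr (fun y => fderiv ℝ u (T y) a) (hdc.comp hTc) (h3.congr e3)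
  rw [integral_congr_ae e3, integral_congr_ae e2, j2, j3]
  have : IsProbabilityMeasure (P.map Z) := Measure.isProbabilityMeasure_map hZm.aemeasurable
  refine integral_congr_ae ?_
  filter_upwards [i1.prod_left_ae, i2.prod_left_ae, i3.prod_left_ae] with z k1 k2 k3
  refine integral_deriv_gaussianReal (f := fun x => u (T (x, z))) (fun x => ?_) k1 k2 k3
  have hT' : HasDerivAt (fun x : ℝ => T (x, z)) a x := by
    simpa [hT] using ((hasDerivAt_id x).smul_const a).add_const z
  exact ((hu.differentiable (by simp)) (T (x, z))).hasFDerivAt.comp_hasDerivAt x hT'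

/-! ### Polynomial functionals of the process -/

/-- The polynomial functional obtained by substituting `W h` for the variable `h`. -/
noncomputable def polyVal (W : H → Ω → ℝ) (q : MvPolynomial H ℝ) (ω : Ω) : ℝ :=
  MvPolynomial.eval (fun h => W h ω) q

/-- The derivative of polynomial functionals in the direction `g`. -/
noncomputable def dirDeriv (g : H) : Derivation ℝ (MvPolynomial H ℝ) (MvPolynomial H ℝ) :=
  MvPolynomial.mkDerivation ℝ fun h => MvPolynomial.C (inner ℝ h g)

/-- The Hermite polynomial of `W g`. -/
noncomputable def hermitePoly (n : ℕ) (g : H) : MvPolynomial H ℝ :=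
  Polynomial.aeval (MvPolynomial.X g) (Polynomial.hermite n)

theorem memLp_polyVal (hW : IsIsonormal W P) (q : MvPolynomial H ℝ) {p : ℝ≥0∞} (hp : p ≠ ∞) :
    MemLp (polyVal W q) p P :=
  memLp_eval (fun h _ hp => hW.memLp h hp) q p hp

theorem measurable_polyVal (W : H → Ω → ℝ) (q : MvPolynomial H ℝ) :
    Measurable[sigmaW W] (polyVal W q) := by
  unfold polyVal
  induction q using MvPolynomial.induction_on with
  | C a => simp
  | add p q hp hq => simp only [map_add]; exact hp.add hq
  | mul_X p j hp =>
    simp only [map_mul, MvPolynomial.eval_X]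
    exact hp.mul (measurable_sigmaW W j)

theorem integrable_polyVal (hW : IsIsonormal W P) (q : MvPolynomial H ℝ) :
    Integrable (polyVal W q) P :=
  memLp_one_iff_integrable.1 (memLp_polyVal hW q (by simp))

theorem polyVal_rename {ι : Type*} (φ : ι → H) (q : MvPolynomial ι ℝ) (ω : Ω) :
    polyVal W (MvPolynomial.rename φ q) ω = MvPolynomial.eval (fun i => W (φ i) ω) q := by
  rw [polyVal, MvPolynomial.eval_rename]; rfl

theorem dirDeriv_rename {ι : Type*} [Fintype ι] (φ : ι → H) (g : H) (q : MvPolynomial ι ℝ) :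
    dirDeriv g (MvPolynomial.rename φ q) =
      ∑ i, MvPolynomial.rename φ (MvPolynomial.pderiv i q) *
        MvPolynomial.C (inner ℝ (φ i) g) := by
  classical
  induction q using MvPolynomial.induction_on with
  | C a => simp
  | add p q hp hq => simp [hp, hq, add_mul, Finset.sum_add_distrib]
  | mul_X p j hp =>
    simp only [map_mul, MvPolynomial.rename_X, Derivation.leibniz, hp, smul_eq_mul, map_add,
      MvPolynomial.pderiv_X, add_mul, Finset.sum_add_distrib, Finset.mul_sum]
    congr 1
    · simp [dirDeriv, MvPolynomial.mkDerivation_X, Pi.single_apply, apply_ite, ite_mul]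
    · exact Finset.sum_congr rfl fun i _ => by ring

theorem integral_polyVal_dirDeriv (hW : IsIsonormal W P) {g : H} (hg : ‖g‖ = 1)
    (q : MvPolynomial H ℝ) :
    ∫ ω, polyVal W (dirDeriv g q) ω ∂P = ∫ ω, polyVal W (q * MvPolynomial.X g) ω ∂P := by
  obtain ⟨s, q, rfl⟩ := MvPolynomial.exists_finset_rename q
  have hfd : ∀ ω, polyVal W (dirDeriv g (MvPolynomial.rename (fun i : s => (i : H)) q)) ω =
      fderiv ℝ (fun y : s → ℝ => MvPolynomial.eval y q) (fun i => W i ω)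
        (fun i => inner ℝ (i : H) g) := by
    intro ω
    rw [(hasFDerivAt_eval q _).fderiv, dirDeriv_rename]
    simp only [polyVal, map_sum, map_mul, MvPolynomial.eval_rename, MvPolynomial.eval_C]
    simp [Function.comp_def]
  have hx : ∀ ω, polyVal W (MvPolynomial.rename (fun i : s => (i : H)) q * MvPolynomial.X g) ω =
      (fun y : s → ℝ => MvPolynomial.eval y q) (fun i => W i ω) * W g ω := by
    intro ω
    simp only [polyVal, map_mul, MvPolynomial.eval_rename, MvPolynomial.eval_X]; rfl
  simp only [hfd, hx]
  refine integral_fderiv_eq hW hg (fun i : s => (i : H)) (contDiff_eval q) ?_ ?_ ?_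
  · simp only [← polyVal_rename]
    exact integrable_polyVal hW _
  · refine (integrable_congr (Eventually.of_forall hx)).1 (integrable_polyVal hW _)
  · refine (integrable_congr (Eventually.of_forall hfd)).1 (integrable_polyVal hW _)

/-! ### Hermite polynomials, their orthogonality, and the Ornstein-Uhlenbeck operator on
polynomials. -/

theorem derivative_hermite (n : ℕ) :
    Polynomial.derivative (Polynomial.hermite (n + 1)) = (n + 1 : ℤ) • Polynomial.hermite n := by
  induction n with
  | zero => simp
  | succ n ih =>
    rw [Polynomial.hermite_succ (n + 1), map_sub, Polynomial.derivative_mul,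
      Polynomial.derivative_X, ih, Polynomial.derivative_smul, Polynomial.hermite_succ n]
    simp only [zsmul_eq_mul]
    push_cast
    ring

theorem hermitePoly_zero (g : H) : hermitePoly 0 g = 1 := by
  simp [hermitePoly]

theorem dirDeriv_X (g h : H) :
    dirDeriv g (MvPolynomial.X h) = MvPolynomial.C (inner ℝ h g) :=
  MvPolynomial.mkDerivation_X _ _ _

theorem dirDeriv_aeval (g h : H) (f : Polynomial ℤ) :
    dirDeriv g (Polynomial.aeval (MvPolynomial.X h) f) =
      Polynomial.aeval (MvPolynomial.X h) (Polynomial.derivative f) *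
        MvPolynomial.C (inner ℝ h g) := by
  have := ((dirDeriv g).restrictScalars ℤ).map_aeval f (MvPolynomial.X h)
  rwa [smul_eq_mul, Derivation.restrictScalars_apply, Derivation.restrictScalars_apply,
    dirDeriv_X] at this

theorem dirDeriv_hermitePoly (n : ℕ) (g h : H) :
    dirDeriv g (hermitePoly (n + 1) h) =
      MvPolynomial.C ((n + 1 : ℝ) * inner ℝ h g) * hermitePoly n h := by
  rw [hermitePoly, dirDeriv_aeval, derivative_hermite, map_zsmul, zsmul_eq_mul, hermitePoly]
  simp only [map_mul]
  push_cast
  simp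
  ring

theorem hermitePoly_succ (n : ℕ) {g : H} (hg : ‖g‖ = 1) :
    hermitePoly (n + 1) g = MvPolynomial.X g * hermitePoly n g - dirDeriv g (hermitePoly n g) := by
  rw [hermitePoly, Polynomial.hermite_succ, hermitePoly, dirDeriv_aeval]
  simp [hg]

/-- The recursion for Hermite polynomials says that `hermitePoly (n + 1) g` is the adjoint of
`dirDeriv g` applied to `hermitePoly n g`. This gives both orthogonality of the chaoses and the
eigenvalues of `L`. -/
theorem integral_mul_hermitePoly_succ (hW : IsIsonormal W P) {g : H} (hg : ‖g‖ = 1) (n : ℕ)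
    (q : MvPolynomial H ℝ) :
    ∫ ω, polyVal W (q * hermitePoly (n + 1) g) ω ∂P =
      ∫ ω, polyVal W (dirDeriv g q * hermitePoly n g) ω ∂P := by
  have h1 := integral_polyVal_dirDeriv hW hg (q * hermitePoly n g)
  have e1 : q * hermitePoly (n + 1) g =
      q * hermitePoly n g * MvPolynomial.X g - q * dirDeriv g (hermitePoly n g) := by
    rw [hermitePoly_succ n hg]; ring
  have e2 : dirDeriv g q * hermitePoly n g =
      dirDeriv g (q * hermitePoly n g) - q * dirDeriv g (hermitePoly n g) := by
    rw [Derivation.leibniz]; simp only [smul_eq_mul]; ring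
  have key : ∀ a b : MvPolynomial H ℝ, ∫ ω, polyVal W (a - b) ω ∂P =
      ∫ ω, polyVal W a ω ∂P - ∫ ω, polyVal W b ω ∂P := by
    intro a b
    rw [← integral_sub (integrable_polyVal hW a) (integrable_polyVal hW b)]
    simp [polyVal]
  rw [e1, e2, key, key, h1]

theorem polyVal_C_mul (c : ℝ) (q : MvPolynomial H ℝ) (ω : Ω) :
    polyVal W (MvPolynomial.C c * q) ω = c * polyVal W q ω := by
  simp [polyVal]

/-- Each integration by parts lowers both degrees by one. As the degrees differ, one of them reaches
zero first, and a constant is then differentiated. -/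
theorem integral_hermitePoly_mul_hermitePoly (hW : IsIsonormal W P) {g h : H} (hg : ‖g‖ = 1)
    (hh : ‖h‖ = 1) {m n : ℕ} (hmn : m ≠ n) :
    ∫ ω, polyVal W (hermitePoly m h * hermitePoly n g) ω ∂P = 0 := by
  induction n generalizing m with
  | zero =>
    obtain ⟨m, rfl⟩ := Nat.exists_eq_succ_of_ne_zero hmn
    rw [mul_comm, integral_mul_hermitePoly_succ hW hh, hermitePoly_zero]
    simp [polyVal]
  | succ n ih =>
    rw [integral_mul_hermitePoly_succ hW hg]
    cases m with
    | zero => simp [hermitePoly_zero, polyVal]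
    | succ m =>
      rw [dirDeriv_hermitePoly]
      simp only [mul_assoc, polyVal_C_mul, integral_const_mul]
      rw [ih (by omega)]; simp

/-- The Ornstein-Uhlenbeck operator on polynomials in independent standard Gaussians. -/
noncomputable def ouPoly {ι : Type*} [Fintype ι] (q : MvPolynomial ι ℝ) : MvPolynomial ι ℝ :=
  ∑ i, (MvPolynomial.pderiv i (MvPolynomial.pderiv i q) -
    MvPolynomial.X i * MvPolynomial.pderiv i q)

theorem integral_polyVal_sum (hW : IsIsonormal W P) {ι : Type*} (s : Finset ι)
    (f : ι → MvPolynomial H ℝ) :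
    ∫ ω, polyVal W (∑ i ∈ s, f i) ω ∂P = ∑ i ∈ s, ∫ ω, polyVal W (f i) ω ∂P := by
  rw [← integral_finsetSum _ fun i _ => integrable_polyVal hW (f i)]
  simp [polyVal]

/-- The weak form of the eigenvalue relation on the `n`-th chaos. Integration by parts in each
direction `e i` puts one derivative on the Hermite polynomial, which becomes `n ⟨g, e i⟩` times the
previous one. Summing over `i` reassembles `dirDeriv g` on `q`. The vector `g` may lie outside the
span of `e`. -/
theorem integral_ouPoly_mul_hermitePoly (hW : IsIsonormal W P) {ι : Type*} [Fintype ι]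
    {e : ι → H} (he : Orthonormal ℝ e) {g : H} (hg : ‖g‖ = 1) (n : ℕ) (q : MvPolynomial ι ℝ) :
    ∫ ω, polyVal W (MvPolynomial.rename e (ouPoly q) * hermitePoly n g) ω ∂P =
      -(n : ℝ) * ∫ ω, polyVal W (MvPolynomial.rename e q * hermitePoly n g) ω ∂P := by
  classical
  have hin : ∀ i j, inner ℝ (e i) (e j) = if i = j then (1 : ℝ) else 0 :=
    orthonormal_iff_ite.1 he
  have hterm : ∀ i, ∫ ω, polyVal W (MvPolynomial.rename e
      (MvPolynomial.pderiv i (MvPolynomial.pderiv i q) -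
        MvPolynomial.X i * MvPolynomial.pderiv i q) * hermitePoly n g) ω ∂P =
      -∫ ω, polyVal W (MvPolynomial.rename e (MvPolynomial.pderiv i q) *
        dirDeriv (e i) (hermitePoly n g)) ω ∂P := by
    intro i
    have h := integral_polyVal_dirDeriv hW (he.1 i)
      (MvPolynomial.rename e (MvPolynomial.pderiv i q) * hermitePoly n g)
    have e1 : dirDeriv (e i) (MvPolynomial.rename e (MvPolynomial.pderiv i q)) =
        MvPolynomial.rename e (MvPolynomial.pderiv i (MvPolynomial.pderiv i q)) := by
      rw [dirDeriv_rename]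
      simp [hin, apply_ite]
    rw [Derivation.leibniz, e1] at h
    rw [eq_neg_iff_add_eq_zero, ← integral_add (integrable_polyVal hW _)
      (integrable_polyVal hW _)]
    rw [← sub_eq_zero, ← integral_sub (integrable_polyVal hW _) (integrable_polyVal hW _)] at h
    rw [← h]
    refine integral_congr_ae (Eventually.of_forall fun ω => ?_)
    simp only [polyVal, map_add, map_mul, map_sub, smul_eq_mul, MvPolynomial.rename_X,
      MvPolynomial.eval_X]
    ring
  rw [ouPoly, map_sum, Finset.sum_mul, integral_polyVal_sum hW, Finset.sum_congr rfl
    fun i _ => hterm i]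
  cases n with
  | zero => simp [hermitePoly_zero, polyVal]
  | succ n =>
    rw [integral_mul_hermitePoly_succ hW hg, dirDeriv_rename, Finset.sum_mul,
      integral_polyVal_sum hW, Finset.mul_sum]
    refine Finset.sum_congr rfl fun i _ => ?_
    rw [dirDeriv_hermitePoly, ← integral_neg, ← integral_const_mul]
    refine integral_congr_ae (Eventually.of_forall fun ω => ?_)
    simp only [polyVal, map_mul, MvPolynomial.eval_C, real_inner_comm g (e i)]
    push_cast
    ring

end Malliavin

namespace Malliavin

variable {Ω : Type*} [MeasurableSpace Ω] {P : Measure Ω} [IsProbabilityMeasure P]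
  {H : Type*} [NormedAddCommGroup H] [InnerProductSpace ℝ H] {W : H → Ω → ℝ}

/-! ### Limits in `L^p` -/

theorem tendsto_integral_mul_of_tendsto_eLpNorm {p : ℝ≥0∞} (hp : 1 < p) {f : ℕ → Ω → ℝ}
    {G φ : Ω → ℝ} (hf : ∀ k, AEStronglyMeasurable (f k) P) (hG : MemLp G p P)
    (hφ : ∀ r : ℝ≥0∞, r ≠ ∞ → MemLp φ r P) (hint : ∀ k, Integrable (fun ω => f k ω * φ ω) P)
    (hlim : Tendsto (fun k => eLpNorm (f k - G) p P) atTop (𝓝 0)) :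
    Tendsto (fun k => ∫ ω, f k ω * φ ω ∂P) atTop (𝓝 (∫ ω, G ω * φ ω ∂P)) := by
  have : ENNReal.HolderConjugate p p.conjExponent := ENNReal.HolderConjugate.conjExponent hp.le
  have hq : p.conjExponent ≠ ∞ :=
    ((ENNReal.HolderConjugate.lt_top_iff_one_lt (p := p.conjExponent) (q := p)).2 hp).ne
  have hφm := (hφ 0 (by simp)).1
  refine tendsto_integral_of_L1' _ (hG.1.mul hφm) (Eventually.of_forall hint) ?_
  have hC := (hφ _ hq).eLpNorm_lt_top
  have h0 : Tendsto (fun k => eLpNorm (f k - G) p P * eLpNorm φ p.conjExponent P) atTop (𝓝 0) := by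
    simpa using ENNReal.Tendsto.mul_const hlim (Or.inr hC.ne)
  refine tendsto_of_tendsto_of_tendsto_of_le_of_le tendsto_const_nhds h0 (fun _ => bot_le)
    fun k => ?_
  have := eLpNorm_smul_le_mul_eLpNorm (p := p) (q := p.conjExponent) (r := 1) hφm
    ((hf k).sub hG.1)
  refine le_trans (le_of_eq ?_) this
  congr 1
  funext ω
  simp [sub_mul]

/-- A subsequence converges almost everywhere, and the limsup of `m`-measurable versions along it is
an `m`-measurable version of the limit. -/
theorem aestronglyMeasurable_of_tendsto_eLpNorm {Ω : Type*} {m m0 : MeasurableSpace Ω}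
    {P : Measure Ω} {p : ℝ≥0∞} (hp : p ≠ 0) (hm : m ≤ m0)
    {f : ℕ → Ω → ℝ} {G : Ω → ℝ} (hf : ∀ k, AEStronglyMeasurable[m] (f k) P)
    (hG : AEStronglyMeasurable[m0] G P)
    (hlim : Tendsto (fun k => eLpNorm (f k - G) p P) atTop (𝓝 0)) :
    AEStronglyMeasurable[m] G P := by
  obtain ⟨ns, -, hns⟩ := (tendstoInMeasure_of_tendsto_eLpNorm hp
    (fun k => (hf k).mono hm) hG hlim).exists_seq_tendsto_ae
  refine ⟨fun ω => limsup (fun i => (hf (ns i)).mk _ ω) atTop,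
    (Measurable.limsup fun i => (hf (ns i)).stronglyMeasurable_mk.measurable).stronglyMeasurable,
    ?_⟩
  filter_upwards [hns, ae_all_iff.2 fun k => (hf k).ae_eq_mk] with ω h1 h2
  simp only [h2] at h1
  exact h1.limsup_eq.symm

/-! ### Separation by Hermite polynomials -/

theorem integrable_mul_polyVal (hW : IsIsonormal W P) {p : ℝ≥0∞} (hp : 1 < p) {f : Ω → ℝ}
    (hf : MemLp f p P) (q : MvPolynomial H ℝ) : Integrable (fun ω => f ω * polyVal W q ω) P := by
  have : ENNReal.HolderConjugate p p.conjExponent := ENNReal.HolderConjugate.conjExponent hp.le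
  have hq : p.conjExponent ≠ ∞ :=
    ((ENNReal.HolderConjugate.lt_top_iff_one_lt (p := p.conjExponent) (q := p)).2 hp).ne
  exact hf.integrable_mul (memLp_polyVal hW q hq)

/-- For `n = 0` the truncated `n - 1` is harmless because its coefficient is zero. -/
theorem X_mul_hermitePoly (n : ℕ) {g : H} (hg : ‖g‖ = 1) :
    MvPolynomial.X g * hermitePoly n g =
      hermitePoly (n + 1) g + MvPolynomial.C (n : ℝ) * hermitePoly (n - 1) g := by
  rw [hermitePoly_succ n hg]
  cases n with
  | zero => simp [hermitePoly_zero]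
  | succ n => simp [dirDeriv_hermitePoly, hg]

/-- The three-term recurrence trades a power of `X g` for neighbouring Hermite polynomials, so
orthogonality to the latter passes to `X g ^ n * hermitePoly k g` by induction on `n` for all `k`.
Scaling then reaches vectors of any norm. The hypothesis `h0` covers the case that `H` has no unit
vector. -/
theorem ae_eq_zero_of_forall_integral_mul_hermitePoly (hW : IsIsonormal W P) {p : ℝ≥0∞}
    (hp : 1 < p) {f : Ω → ℝ} (hf : MemLp f p P) (hfm : AEStronglyMeasurable[sigmaW W] f P)
    (h0 : ∫ ω, f ω ∂P = 0)
    (h : ∀ (g : H) (n : ℕ), ‖g‖ = 1 → ∫ ω, f ω * polyVal W (hermitePoly n g) ω ∂P = 0) :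
    f =ᵐ[P] 0 := by
  have hunit : ∀ (g : H), ‖g‖ = 1 → ∀ n k : ℕ,
      ∫ ω, f ω * polyVal W (MvPolynomial.X g ^ n * hermitePoly k g) ω ∂P = 0 := by
    intro g hg n
    induction n with
    | zero => intro k; simpa using h g k hg
    | succ n ih =>
      intro k
      have e : MvPolynomial.X g ^ (n + 1) * hermitePoly k g =
          MvPolynomial.X g ^ n * hermitePoly (k + 1) g +
            MvPolynomial.C (k : ℝ) * (MvPolynomial.X g ^ n * hermitePoly (k - 1) g) := by
        rw [pow_succ, mul_assoc, X_mul_hermitePoly k hg]; ring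
      have e' : ∀ ω, f ω * polyVal W (MvPolynomial.X g ^ (n + 1) * hermitePoly k g) ω =
          f ω * polyVal W (MvPolynomial.X g ^ n * hermitePoly (k + 1) g) ω +
            k * (f ω * polyVal W (MvPolynomial.X g ^ n * hermitePoly (k - 1) g) ω) := by
        intro ω
        rw [e]
        simp only [polyVal, map_add, map_mul, MvPolynomial.eval_C]
        ring
      simp only [e']
      rw [integral_add (integrable_mul_polyVal hW hp hf _)
        ((integrable_mul_polyVal hW hp hf _).const_mul _), integral_const_mul, ih, ih]
      simp
  refine ae_eq_zero_of_forall_integral_mul_pow hW hp hf hfm fun g n => ?_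
  rcases eq_or_ne g 0 with rfl | hg
  · have hz : W (0 : H) =ᵐ[P] 0 := by
      filter_upwards [hW.ae_smul 0 (0 : H)] with ω hω
      simpa using hω
    rcases n with _ | n
    · simpa using h0
    · rw [integral_congr_ae (g := fun _ => 0)]
      · simp
      · filter_upwards [hz] with ω hω
        simp [hω]
  · have hg' : ‖(‖g‖⁻¹ • g)‖ = 1 := by
      rw [norm_smul, norm_inv, norm_norm, inv_mul_cancel₀ (norm_ne_zero_iff.2 hg)]
    have := hunit _ hg' n 0
    rw [integral_congr_ae (g := fun ω => ‖g‖ ^ n *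
      (f ω * polyVal W (MvPolynomial.X (‖g‖⁻¹ • g) ^ n * hermitePoly 0 (‖g‖⁻¹ • g)) ω)),
      integral_const_mul, this, mul_zero]
    filter_upwards [hW.ae_smul ‖g‖⁻¹ g] with ω hω
    have : ‖g‖ ^ n ≠ 0 := pow_ne_zero _ (norm_ne_zero_iff.2 hg)
    simp only [polyVal, hermitePoly_zero, mul_one, map_pow, MvPolynomial.eval_X, hω, mul_pow,
      inv_pow]
    field_simp

/-! ### Wiener chaos -/

theorem hermiteFun_eq (n : ℕ) (h : H) (ω : Ω) :
    hermiteFun n (W h ω) = (n.factorial : ℝ)⁻¹ * polyVal W (hermitePoly n h) ω := by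
  have : Polynomial.aeval (W h ω) (Polynomial.hermite n) = polyVal W (hermitePoly n h) ω := by
    rw [polyVal, hermitePoly, Polynomial.aeval_def, Polynomial.aeval_def, Polynomial.hom_eval₂,
      MvPolynomial.eval_X]
    congr 1
    exact RingHom.ext_int _ _
  rw [hermiteFun, this, div_eq_inv_mul]

/-- The norm condition is dropped in order zero, where the generator is constant and `H` might have
no unit vector. -/
theorem exists_of_mem_chaosGenerators {n : ℕ} {f : Lp ℝ 2 P} (hf : f ∈ chaosGenerators W P n) :
    ∃ (c : ℝ) (h : H), (n ≠ 0 → ‖h‖ = 1) ∧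
      f =ᵐ[P] fun ω => c * polyVal W (hermitePoly n h) ω := by
  cases n with
  | zero =>
    refine ⟨1, 0, by simp, ?_⟩
    filter_upwards [show f =ᵐ[P] fun _ => 1 from hf] with ω hω
    simp [hω, hermitePoly_zero, polyVal]
  | succ n =>
    obtain ⟨h, hh, hfh⟩ := hf
    refine ⟨((n + 1).factorial : ℝ)⁻¹, h, fun _ => hh, ?_⟩
    filter_upwards [hfh] with ω hω
    rw [hω, hermiteFun_eq]

theorem exists_mem_wienerChaos (hW : IsIsonormal W P) (n : ℕ) {h : H} (hh : ‖h‖ = 1) :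
    ∃ v ∈ wienerChaos W P n, v =ᵐ[P] polyVal W (hermitePoly n h) := by
  have hm : MemLp (fun ω => hermiteFun n (W h ω)) 2 P := by
    simp only [hermiteFun_eq]
    exact (memLp_polyVal hW _ (by simp)).const_mul _
  have hg : hm.toLp _ ∈ chaosGenerators W P n := by
    cases n with
    | zero =>
      refine hm.coeFn_toLp.trans (Eventually.of_forall fun ω => ?_)
      simp [hermiteFun]
    | succ n => exact ⟨h, hh, hm.coeFn_toLp⟩
  refine ⟨(n.factorial : ℝ) • hm.toLp _, Submodule.smul_mem _ _
    (Submodule.le_topologicalClosure _ (Submodule.subset_span hg)), ?_⟩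
  filter_upwards [Lp.coeFn_smul (n.factorial : ℝ) (hm.toLp _), hm.coeFn_toLp] with ω h1 h2
  rw [h1, Pi.smul_apply, h2, hermiteFun_eq, smul_eq_mul,
    mul_inv_cancel_left₀ (by exact_mod_cast n.factorial_ne_zero)]

theorem inner_eq_integral {X v : Lp ℝ 2 P} {f g : Ω → ℝ} (hX : X =ᵐ[P] f) (hv : v =ᵐ[P] g) :
    inner ℝ X v = ∫ ω, f ω * g ω ∂P := by
  rw [L2.inner_def]
  refine integral_congr_ae ?_
  filter_upwards [hX, hv] with ω h1 h2
  simp [h1, h2, mul_comm]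

theorem inner_eq_zero_of_forall_generators {n : ℕ} {Z : Lp ℝ 2 P}
    (h : ∀ g ∈ chaosGenerators W P n, inner ℝ Z g = 0) :
    ∀ v ∈ wienerChaos W P n, inner ℝ Z v = 0 := by
  have : wienerChaos W P n ≤ (Submodule.span ℝ {Z})ᗮ := by
    refine Submodule.topologicalClosure_minimal _ (Submodule.span_le.2 fun g hg => ?_)
      (Submodule.isClosed_orthogonal _)
    exact Submodule.mem_orthogonal_singleton_iff_inner_right.2 (h g hg)
  exact fun v hv => Submodule.mem_orthogonal_singleton_iff_inner_right.1 (this hv)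

theorem wienerChaos_isOrtho (hW : IsIsonormal W P) {m n : ℕ} (hmn : m ≠ n) :
    wienerChaos W P m ⟂ wienerChaos W P n := by
  rw [Submodule.isOrtho_iff_inner_eq]
  have hgen : ∀ f ∈ chaosGenerators W P m, ∀ g ∈ chaosGenerators W P n, inner ℝ f g = 0 := by
    intro f hf g hg
    obtain ⟨a, h, hh, hfa⟩ := exists_of_mem_chaosGenerators hf
    obtain ⟨b, k, hk, hgb⟩ := exists_of_mem_chaosGenerators hg
    rw [inner_eq_integral hfa hgb]
    have : ∫ ω, polyVal W (hermitePoly m h * hermitePoly n k) ω ∂P = 0 := by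
      by_cases hm : m = 0
      · subst hm
        have hk1 := hk hmn.symm
        -- In order zero the vector is irrelevant, so it may be replaced by the unit vector of the
        -- other factor.
        rw [hermitePoly_zero, ← hermitePoly_zero k]
        exact integral_hermitePoly_mul_hermitePoly hW hk1 hk1 hmn
      by_cases hn : n = 0
      · subst hn
        have hh1 := hh hm
        rw [hermitePoly_zero, ← hermitePoly_zero h]
        exact integral_hermitePoly_mul_hermitePoly hW hh1 hh1 hmn
      · exact integral_hermitePoly_mul_hermitePoly hW (hk hn) (hh hm) hmn
    rw [integral_congr_ae (g := fun ω => (a * b) *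
      polyVal W (hermitePoly m h * hermitePoly n k) ω), integral_const_mul, this, mul_zero]
    refine Eventually.of_forall fun ω => ?_
    simp only [polyVal, map_mul]; ring
  intro u hu v hv
  rw [real_inner_comm]
  refine inner_eq_zero_of_forall_generators (fun f hf => ?_) u hu
  rw [real_inner_comm]
  exact inner_eq_zero_of_forall_generators (fun g hg => hgen f hf g hg) v hv

theorem orthogonalFamily_wienerChaos (hW : IsIsonormal W P) :
    OrthogonalFamily ℝ (fun n => wienerChaos W P n) fun n => (wienerChaos W P n).subtypeₗᵢ :=
  OrthogonalFamily.of_pairwise fun _ _ hmn => wienerChaos_isOrtho hW hmn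

theorem wienerChaos_le (hW : IsIsonormal W P) (n : ℕ) :
    wienerChaos W P n ≤ lpMeas ℝ ℝ (sigmaW W) 2 P := by
  refine Submodule.topologicalClosure_minimal _ (Submodule.span_le.2 fun g hg => ?_)
    (isClosed_aestronglyMeasurable (sigmaW_le hW))
  obtain ⟨b, k, hk, hgb⟩ := exists_of_mem_chaosGenerators hg
  refine mem_lpMeas_iff_aestronglyMeasurable.2 ⟨_, ?_, hgb⟩
  exact ((measurable_polyVal W _).const_mul b).stronglyMeasurable

theorem hasSum_mem_lpMeas (hW : IsIsonormal W P) {f : ℕ → Lp ℝ 2 P} {Z : Lp ℝ 2 P}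
    (hf : ∀ n, f n ∈ wienerChaos W P n) (h : HasSum f Z) :
    AEStronglyMeasurable[sigmaW W] Z P := by
  refine (mem_lpMeas_iff_aestronglyMeasurable (𝕜 := ℝ)).1 ?_
  have hc : IsClosed (lpMeas ℝ ℝ (sigmaW W) 2 P : Set (Lp ℝ 2 P)) :=
    isClosed_aestronglyMeasurable (sigmaW_le hW)
  exact hc.mem_of_tendsto h (Eventually.of_forall fun s =>
    Submodule.sum_mem _ fun n _ => wienerChaos_le hW n (hf n))

theorem inner_chaosComponent (n : ℕ) (X : Lp ℝ 2 P) {v : Lp ℝ 2 P} (hv : v ∈ wienerChaos W P n) :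
    inner ℝ (chaosComponent W P n X) v = inner ℝ X v := by
  have := (wienerChaos W P n).starProjection_inner_eq_zero X v hv
  rw [inner_sub_left, sub_eq_zero] at this
  exact this.symm

theorem chaosComponent_mem (n : ℕ) (X : Lp ℝ 2 P) :
    chaosComponent W P n X ∈ wienerChaos W P n :=
  Submodule.starProjection_apply_mem _ _

theorem inner_hasSum_chaos (hW : IsIsonormal W P) {f : ℕ → Lp ℝ 2 P} {Z : Lp ℝ 2 P}
    (hf : ∀ n, f n ∈ wienerChaos W P n) (h : HasSum f Z) {n : ℕ} {v : Lp ℝ 2 P}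
    (hv : v ∈ wienerChaos W P n) : inner ℝ Z v = inner ℝ (f n) v := by
  have h1 : HasSum (fun m => inner ℝ v (f m)) (inner ℝ v Z) := h.mapL (innerSL ℝ v)
  have h2 : HasSum (fun m => inner ℝ v (f m)) (inner ℝ v (f n)) :=
    hasSum_single n fun m hm => Submodule.isOrtho_iff_inner_eq.1
      (wienerChaos_isOrtho hW hm.symm) v hv _ (hf m)
  rw [real_inner_comm, h1.unique h2, real_inner_comm]

/-- Bessel's inequality: a partial sum `S` satisfies `⟨X, S⟩ = ‖S‖²`, whence `‖S‖ ≤ ‖X‖`. -/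
theorem summable_chaosComponent (hW : IsIsonormal W P) (X : Lp ℝ 2 P) :
    Summable fun n => chaosComponent W P n X := by
  have hO := orthogonalFamily_wienerChaos hW
  set l : ∀ n, wienerChaos W P n := fun n => ⟨_, chaosComponent_mem n X⟩ with hl
  refine (hO.summable_iff_norm_sq_summable l).2 ?_
  refine summable_of_sum_le (c := ‖X‖ ^ 2) (fun n => sq_nonneg _) fun s => ?_
  have h1 := hO.norm_sum l s
  set S := ∑ i ∈ s, (wienerChaos W P i).subtypeₗᵢ (l i) with hS
  have h2 : inner ℝ X S = ‖S‖ ^ 2 := by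
    rw [h1, hS, inner_sum]
    refine Finset.sum_congr rfl fun n _ => ?_
    have := inner_chaosComponent n X (chaosComponent_mem (W := W) n X)
    rw [real_inner_self_eq_norm_sq] at this
    exact this.symm
  have h3 := real_inner_le_norm X S
  have h4 : ‖S‖ ≤ ‖X‖ := by
    by_contra! hlt
    have : 0 < ‖S‖ := (norm_nonneg X).trans_lt hlt
    nlinarith
  rw [← h1]
  gcongr

/-- The Wiener chaos decomposition: `X` minus the sum of its components is orthogonal to every chaos
and measurable for `σ(W)`, so separation by Hermite polynomials makes it zero. -/
theorem hasSum_chaosComponent (hW : IsIsonormal W P) {X : Lp ℝ 2 P}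
    (hX : AEStronglyMeasurable[sigmaW W] X P) :
    HasSum (fun n => chaosComponent W P n X) X := by
  obtain ⟨Z, hZ⟩ := summable_chaosComponent hW X
  have hZm := hasSum_mem_lpMeas hW (fun n => chaosComponent_mem n X) hZ
  have hin : ∀ n, ∀ v ∈ wienerChaos W P n, inner ℝ (X - Z) v = 0 := by
    intro n v hv
    rw [inner_sub_left, inner_hasSum_chaos hW (fun n => chaosComponent_mem n X) hZ hv,
      inner_chaosComponent n X hv, sub_self]
  have hXZ : (X - Z : Lp ℝ 2 P) =ᵐ[P] 0 := by
    refine ae_eq_zero_of_forall_integral_mul_hermitePoly hW (p := 2) (by norm_num)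
      (Lp.memLp (X - Z)) ?_ ?_ ?_
    · exact (hX.sub hZm).congr (Lp.coeFn_sub X Z).symm
    · have h1 : MemLp (fun _ : Ω => (1 : ℝ)) 2 P := memLp_const 1
      have hv : h1.toLp _ ∈ wienerChaos W P 0 :=
        Submodule.le_topologicalClosure _ (Submodule.subset_span h1.coeFn_toLp)
      have := hin 0 _ hv
      rw [inner_eq_integral (ae_eq_refl _) h1.coeFn_toLp] at this
      simpa using this
    · intro g n hg
      obtain ⟨v, hv, hve⟩ := exists_mem_wienerChaos hW n hg
      rw [← inner_eq_integral (ae_eq_refl _) hve]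
      exact hin n v hv
  have : X - Z = 0 := Lp.ext (hXZ.trans (Lp.coeFn_zero _ _ _).symm)
  rw [← sub_eq_zero.1 this] at hZ
  exact hZ

/-- Chaos components are determined by pairings with the generators, so the weak eigenvalue relation
identifies the components of `Y` as `-n` times those of `X`. Order zero is left to `h0`, since no
unit vector need exist. -/
theorem hasOUL2_of_forall_hermitePoly (hW : IsIsonormal W P) {X Y : Lp ℝ 2 P}
    (hX : AEStronglyMeasurable[sigmaW W] X P) (hY : AEStronglyMeasurable[sigmaW W] Y P)
    (h0 : ∫ ω, Y ω ∂P = 0)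
    (h : ∀ (n : ℕ) (g : H), ‖g‖ = 1 → ∫ ω, Y ω * polyVal W (hermitePoly n g) ω ∂P =
      -(n : ℝ) * ∫ ω, X ω * polyVal W (hermitePoly n g) ω ∂P) : HasOUL2 W P X Y := by
  refine ⟨hasSum_chaosComponent hW hX, ?_⟩
  have : ∀ n, chaosComponent W P n Y = -(n : ℝ) • chaosComponent W P n X := by
    intro n
    refine Submodule.eq_starProjection_of_mem_of_inner_eq_zero
      (Submodule.smul_mem _ _ (chaosComponent_mem n X)) ?_
    refine inner_eq_zero_of_forall_generators fun g hg => ?_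
    have hg' : g ∈ wienerChaos W P n :=
      Submodule.le_topologicalClosure _ (Submodule.subset_span hg)
    rw [inner_sub_left, inner_smul_left, inner_chaosComponent n X hg']
    obtain ⟨c, k, hk, hgc⟩ := exists_of_mem_chaosGenerators hg
    rw [inner_eq_integral (ae_eq_refl Y) hgc, inner_eq_integral (ae_eq_refl X) hgc]
    have e : ∀ Z : Lp ℝ 2 P, ∫ ω, Z ω * (c * polyVal W (hermitePoly n k) ω) ∂P =
        c * ∫ ω, Z ω * polyVal W (hermitePoly n k) ω ∂P := by
      intro Z
      rw [← integral_const_mul]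
      congr 1; funext ω; ring
    rw [e, e]
    by_cases hn : n = 0
    · subst hn
      simp [hermitePoly_zero, polyVal, h0]
    · rw [h n k (hk hn)]
      simp
      ring
  simpa only [this] using hasSum_chaosComponent hW hY

/-! ### Uniqueness for the Ornstein-Uhlenbeck operator -/

theorem integral_mul_of_hasOUL2 (hW : IsIsonormal W P) {X Y : Lp ℝ 2 P} (h : HasOUL2 W P X Y)
    (n : ℕ) {g : H} (hg : ‖g‖ = 1) : ∫ ω, Y ω * polyVal W (hermitePoly n g) ω ∂P =
      -(n : ℝ) * ∫ ω, X ω * polyVal W (hermitePoly n g) ω ∂P := by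
  obtain ⟨v, hv, hve⟩ := exists_mem_wienerChaos hW n hg
  rw [← inner_eq_integral (ae_eq_refl Y) hve, ← inner_eq_integral (ae_eq_refl X) hve,
    inner_hasSum_chaos hW (fun n => Submodule.smul_mem _ _ (chaosComponent_mem n X)) h.2 hv,
    inner_smul_left, inner_chaosComponent n X hv]
  simp

theorem integral_mul_of_hasOU (hW : IsIsonormal W P) {p : ℝ≥0∞} (hp : 1 < p) {G K : Ω → ℝ}
    (h : HasOU W P p G K) (n : ℕ) {g : H} (hg : ‖g‖ = 1) :
    ∫ ω, K ω * polyVal W (hermitePoly n g) ω ∂P =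
      -(n : ℝ) * ∫ ω, G ω * polyVal W (hermitePoly n g) ω ∂P := by
  obtain ⟨hG, hK, X, Y, hX, hXY, hXl, hYl⟩ := h
  have hφ := fun (r : ℝ≥0∞) (hr : r ≠ ∞) => memLp_polyVal hW (hermitePoly n g) hr
  have l1 := tendsto_integral_mul_of_tendsto_eLpNorm hp (fun k => (Lp.memLp (X k)).1) hG hφ
    (fun k => integrable_mul_polyVal hW (by norm_num) (Lp.memLp (X k)) _) hXl
  have l2 := tendsto_integral_mul_of_tendsto_eLpNorm hp (fun k => (Lp.memLp (Y k)).1) hK hφ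
    (fun k => integrable_mul_polyVal hW (by norm_num) (Lp.memLp (Y k)) _) hYl
  simp only [integral_mul_of_hasOUL2 hW (hXY _) n hg] at l2
  exact tendsto_nhds_unique l2 (l1.const_mul _)

theorem aestronglyMeasurable_of_hasOU (hW : IsIsonormal W P) {p : ℝ≥0∞} (hp : 1 < p)
    {G K : Ω → ℝ} (h : HasOU W P p G K) : AEStronglyMeasurable[sigmaW W] G P := by
  obtain ⟨hG, hK, X, Y, hX, hXY, hXl, hYl⟩ := h
  exact aestronglyMeasurable_of_tendsto_eLpNorm (by positivity) (sigmaW_le hW)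
    (fun k => hasSum_mem_lpMeas hW (fun n => chaosComponent_mem n _) (hXY k).1) hG.1 hXl

/-- The Hermite coefficients of order `n ≥ 1` are fixed by `F` after division by `n`, and order zero
is fixed by centering. Membership in the closure supplies the `σ(W)`-measurability that separation
needs. -/
theorem IsNegOUInv.ae_eq (hW : IsIsonormal W P) {p : ℝ≥0∞} (hp : 1 < p) {F G G' : Ω → ℝ}
    (h : IsNegOUInv W P p F G) (h' : IsNegOUInv W P p F G') : G =ᵐ[P] G' := by
  rw [← sub_ae_eq_zero]
  have hG := h.2.1
  have hG' := h'.2.1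
  refine ae_eq_zero_of_forall_integral_mul_hermitePoly hW hp (hG.sub hG')
    ((aestronglyMeasurable_of_hasOU hW hp h.2).sub (aestronglyMeasurable_of_hasOU hW hp h'.2))
    ?_ ?_
  · simp only [Pi.sub_apply]
    rw [integral_sub (hG.integrable hp.le) (hG'.integrable hp.le), h.1, h'.1, sub_zero]
  · intro g n hg
    simp only [Pi.sub_apply, sub_mul]
    rw [integral_sub (integrable_mul_polyVal hW hp hG _) (integrable_mul_polyVal hW hp hG' _)]
    cases n with
    | zero => simp [hermitePoly_zero, polyVal, h.1, h'.1]
    | succ n =>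
      have e1 := integral_mul_of_hasOU hW hp h.2 (n + 1) hg
      have e2 := integral_mul_of_hasOU hW hp h'.2 (n + 1) hg
      rw [e1] at e2
      have : (-((n + 1 : ℕ) : ℝ)) ≠ 0 := neg_ne_zero.2 (by positivity)
      rw [mul_left_cancel₀ this e2, sub_self]

/-! ### Closability of the Malliavin derivative -/

theorem SmoothFunctional.continuous_fderiv_apply (S : SmoothFunctional H) (v : Fin S.n → ℝ) :
    Continuous fun y => fderiv ℝ S.g y v :=
  (S.smooth.continuous_fderiv (by simp)).clm_apply continuous_const

theorem SmoothFunctional.inner_deriv (S : SmoothFunctional H) (W : H → Ω → ℝ) (h : H) (ω : Ω) :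
    inner ℝ (S.deriv W ω) h =
      fderiv ℝ S.g (fun j => W (S.φ j) ω) fun i => inner ℝ (S.φ i) h := by
  classical
  rw [SmoothFunctional.deriv, sum_inner]
  conv_rhs => rw [← Finset.univ_sum_single (fun i => inner ℝ (S.φ i) h)]
  rw [map_sum]
  refine Finset.sum_congr rfl fun i _ => ?_
  have : (Pi.single i (inner ℝ (S.φ i) h) : Fin S.n → ℝ) =
      (inner ℝ (S.φ i) h : ℝ) • (Pi.single i 1 : Fin S.n → ℝ) := by
    rw [← Pi.single_smul]; simp
  rw [this, map_smul, inner_smul_left, smul_eq_mul, mul_comm]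
  simp

theorem SmoothFunctional.measurable_val (S : SmoothFunctional H) (W : H → Ω → ℝ) :
    Measurable[sigmaW W] (S.val W) :=
  S.smooth.continuous.measurable.comp
    (@measurable_pi_lambda _ _ _ (sigmaW W) _ _ fun i => measurable_sigmaW W (S.φ i))

theorem SmoothFunctional.measurable_inner_deriv (S : SmoothFunctional H) (W : H → Ω → ℝ) (h : H) :
    Measurable[sigmaW W] fun ω => inner ℝ (S.deriv W ω) h := by
  simp only [S.inner_deriv]
  exact (S.continuous_fderiv_apply _).measurable.comp
    (@measurable_pi_lambda _ _ _ (sigmaW W) _ _ fun i => measurable_sigmaW W (S.φ i))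

theorem SmoothFunctional.exists_bound_val (S : SmoothFunctional H) :
    ∃ C, ∀ y, ‖S.g y‖ ≤ C :=
  S.compact.exists_bound_of_continuous S.smooth.continuous

theorem SmoothFunctional.exists_bound_deriv (S : SmoothFunctional H) (v : Fin S.n → ℝ) :
    ∃ C, ∀ y, ‖fderiv ℝ S.g y v‖ ≤ C :=
  (S.compact.fderiv_apply (𝕜 := ℝ) v).exists_bound_of_continuous (S.continuous_fderiv_apply v)

/-- The polynomial whose value appears on the right of the duality formula. -/
noncomputable def dualTest (g h : H) (n : ℕ) : MvPolynomial H ℝ :=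
  MvPolynomial.X g ^ n * MvPolynomial.X h -
    MvPolynomial.C (n * inner ℝ g h) * MvPolynomial.X g ^ (n - 1)

/-- The right side contains no derivative of `S`, so it passes to `L^p` limits of the values alone.
This is what makes the derivative closable. -/
theorem SmoothFunctional.integral_duality (hW : IsIsonormal W P) (S : SmoothFunctional H)
    (g : H) {h : H} (hh : ‖h‖ = 1) (n : ℕ) :
    ∫ ω, inner ℝ (S.deriv W ω) h * polyVal W (MvPolynomial.X g ^ n) ω ∂P =
      ∫ ω, S.val W ω * polyVal W (dualTest g h n) ω ∂P := by
  -- The extra coordinate `none` carries `W g`, so that `S.val W` times a power of `W g` is one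
  -- function of finitely many coordinates.
  set φ : Option (Fin S.n) → H := fun o => o.elim g S.φ with hφ
  set r : (Option (Fin S.n) → ℝ) →L[ℝ] (Fin S.n → ℝ) :=
    ContinuousLinearMap.pi fun i => ContinuousLinearMap.proj (some i) with hr
  set z : (Option (Fin S.n) → ℝ) →L[ℝ] ℝ := ContinuousLinearMap.proj none with hz
  set u : (Option (Fin S.n) → ℝ) → ℝ := fun x => S.g (r x) * z x ^ n with hu
  have hg1 : ContDiff ℝ 1 S.g := S.smooth.of_le (by exact_mod_cast le_top)
  have hu1 : ContDiff ℝ 1 u := (hg1.comp r.contDiff).mul (z.contDiff.pow n)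
  have hd : ∀ x v, fderiv ℝ u x v =
      fderiv ℝ S.g (r x) (r v) * z x ^ n + S.g (r x) * (n * z x ^ (n - 1) * z v) := by
    intro x v
    have d1 : HasFDerivAt (fun x => S.g (r x)) ((fderiv ℝ S.g (r x)).comp r) x :=
      ((hg1.differentiable (by simp)) (r x)).hasFDerivAt.comp x r.hasFDerivAt
    have d2 : HasFDerivAt (fun x => z x ^ n) ((n * z x ^ (n - 1)) • z) x := by
      simpa using (z.hasFDerivAt (x := x)).pow n
    rw [show fderiv ℝ u x = _ from (d1.mul d2).fderiv]
    simp
    ring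
  obtain ⟨C, hC⟩ := S.exists_bound_val
  obtain ⟨C', hC'⟩ := S.exists_bound_deriv fun i => inner ℝ (S.φ i) h
  have hle := sigmaW_le hW
  have ival : ∀ q, Integrable (fun ω => S.val W ω * polyVal W q ω) P := fun q =>
    (integrable_polyVal hW q).bdd_mul ((S.measurable_val W).mono hle le_rfl).aestronglyMeasurable
      (Eventually.of_forall fun ω => hC _)
  have ider : ∀ q, Integrable (fun ω => inner ℝ (S.deriv W ω) h * polyVal W q ω) P := fun q =>
    (integrable_polyVal hW q).bdd_mul
      ((S.measurable_inner_deriv W h).mono hle le_rfl).aestronglyMeasurable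
      (Eventually.of_forall fun ω => by rw [S.inner_deriv]; exact hC' _)
  have key := integral_fderiv_eq hW hh φ hu1
  have eu : ∀ ω, (u fun i => W (φ i) ω) = S.val W ω * polyVal W (MvPolynomial.X g ^ n) ω := by
    intro ω; simp [hu, polyVal, SmoothFunctional.val, hr, hz, hφ]
  have eu2 : ∀ ω, (u fun i => W (φ i) ω) * W h ω =
      S.val W ω * polyVal W (MvPolynomial.X g ^ n * MvPolynomial.X h) ω := by
    intro ω; rw [eu]; simp [polyVal, mul_assoc]
  have ed : ∀ ω, fderiv ℝ u (fun i => W (φ i) ω) (fun i => inner ℝ (φ i) h) =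
      inner ℝ (S.deriv W ω) h * polyVal W (MvPolynomial.X g ^ n) ω +
      S.val W ω * polyVal W (MvPolynomial.C (n * inner ℝ g h) * MvPolynomial.X g ^ (n - 1)) ω := by
    intro ω
    rw [hd, S.inner_deriv]
    simp only [polyVal, SmoothFunctional.val, map_mul, map_pow, MvPolynomial.eval_X,
      MvPolynomial.eval_C]
    have a1 : r (fun i => W (φ i) ω) = fun j => W (S.φ j) ω := rfl
    have a2 : r (fun i => inner ℝ (φ i) h) = fun i => inner ℝ (S.φ i) h := rfl
    have a3 : z (fun i => W (φ i) ω) = W g ω := rfl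
    have a4 : z (fun i => inner ℝ (φ i) h) = inner ℝ g h := rfl
    rw [a1, a2, a3, a4]
    ring
  simp only [eu2, ed] at key
  simp only [eu] at key
  specialize key (ival _) (ival _) ((ider _).add (ival _))
  rw [integral_add (ider _) (ival _)] at key
  rw [← sub_eq_iff_eq_add.2 key.symm, ← integral_sub (ival _) (ival _)]
  refine integral_congr_ae (Eventually.of_forall fun ω => ?_)
  simp only [dualTest, polyVal, map_sub]
  ring

theorem tendsto_eLpNorm_inner {p : ℝ≥0∞} {D : ℕ → Ω → H} {U : Ω → H}
    (h : Tendsto (fun k => eLpNorm (D k - U) p P) atTop (𝓝 0)) (x : H) (hx : ‖x‖ = 1) :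
    Tendsto (fun k => eLpNorm ((fun ω => inner ℝ (D k ω) x) - fun ω => inner ℝ (U ω) x) p P)
      atTop (𝓝 0) := by
  refine tendsto_of_tendsto_of_tendsto_of_le_of_le tendsto_const_nhds h (fun _ => bot_le)
    fun k => eLpNorm_mono fun ω => ?_
  simp only [Pi.sub_apply, ← inner_sub_left]
  simpa [hx] using norm_inner_le_norm (𝕜 := ℝ) (D k ω - U ω) x

theorem HasMalliavinDeriv.integral_duality (hW : IsIsonormal W P) {p : ℝ≥0∞} (hp : 1 < p)
    {F : Ω → ℝ} {U : Ω → H} (hF : HasMalliavinDeriv W P p F U) (g : H) {h : H} (hh : ‖h‖ = 1)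
    (n : ℕ) : ∫ ω, inner ℝ (U ω) h * polyVal W (MvPolynomial.X g ^ n) ω ∂P =
      ∫ ω, F ω * polyVal W (dualTest g h n) ω ∂P := by
  obtain ⟨hFp, hUp, S, hS, hD⟩ := hF
  have hle := sigmaW_le hW
  have l1 := tendsto_integral_mul_of_tendsto_eLpNorm hp
    (fun k => (((S k).measurable_val W).mono hle le_rfl).aestronglyMeasurable) hFp
    (fun r hr => memLp_polyVal hW (dualTest g h n) hr) (fun k => by
      obtain ⟨C, hC⟩ := (S k).exists_bound_val
      exact (integrable_polyVal hW _).bdd_mul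
        (((S k).measurable_val W).mono hle le_rfl).aestronglyMeasurable
        (Eventually.of_forall fun ω => hC _)) hS
  have l2 := tendsto_integral_mul_of_tendsto_eLpNorm hp
    (f := fun k ω => inner ℝ ((S k).deriv W ω) h)
    (fun k => (((S k).measurable_inner_deriv W h).mono hle le_rfl).aestronglyMeasurable)
    (hUp.inner_const h) (fun r hr => memLp_polyVal hW (MvPolynomial.X g ^ n) hr) (fun k => by
      obtain ⟨C, hC⟩ := (S k).exists_bound_deriv fun i => inner ℝ ((S k).φ i) h
      exact (integrable_polyVal hW _).bdd_mul
        (((S k).measurable_inner_deriv W h).mono hle le_rfl).aestronglyMeasurable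
        (Eventually.of_forall fun ω => by rw [(S k).inner_deriv]; exact hC _))
    (tendsto_eLpNorm_inner hD h hh)
  simp only [(S _).integral_duality hW g hh n] at l2
  exact tendsto_nhds_unique l2 l1

theorem HasMalliavinDeriv.aestronglyMeasurable_inner (hW : IsIsonormal W P) {p : ℝ≥0∞}
    (hp : 1 < p) {F : Ω → ℝ} {U : Ω → H} (hF : HasMalliavinDeriv W P p F U) {h : H}
    (hh : ‖h‖ = 1) : AEStronglyMeasurable[sigmaW W] (fun ω => inner ℝ (U ω) h) P := by
  obtain ⟨hFp, hUp, S, hS, hD⟩ := hF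
  exact aestronglyMeasurable_of_tendsto_eLpNorm (by positivity) (sigmaW_le hW)
    (fun k => ((S k).measurable_inner_deriv W h).stronglyMeasurable.aestronglyMeasurable)
    (hUp.inner_const h).1 (tendsto_eLpNorm_inner hD h hh)

/-- By duality the pairings of `⟨U, h⟩` with powers of `W g` depend only on `F`, so separation gives
`⟨U - U', h⟩ = 0` almost surely for each `h`. Separability of `H` removes the dependence of the null
set on `h`. -/
theorem HasMalliavinDeriv.ae_eq [TopologicalSpace.SeparableSpace H] (hW : IsIsonormal W P)
    {p : ℝ≥0∞} (hp : 1 < p) {F F' : Ω → ℝ} {U U' : Ω → H} (hF : HasMalliavinDeriv W P p F U)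
    (hF' : HasMalliavinDeriv W P p F' U') (hFF' : F =ᵐ[P] F') : U =ᵐ[P] U' := by
  have : SecondCountableTopology H := UniformSpace.secondCountable_of_separable H
  have hunit : ∀ h : H, ‖h‖ = 1 → (fun ω => inner ℝ ((U - U') ω) h) =ᵐ[P] 0 := by
    intro h hh
    have e : (fun ω => inner ℝ ((U - U') ω) h) =
        (fun ω => inner ℝ (U ω) h) - fun ω => inner ℝ (U' ω) h := by
      funext ω; simp [inner_sub_left]
    rw [e]
    have m1 := hF.2.1.inner_const (𝕜 := ℝ) h
    have m2 := hF'.2.1.inner_const (𝕜 := ℝ) h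
    refine ae_eq_zero_of_forall_integral_mul_pow hW hp (m1.sub m2)
      ((hF.aestronglyMeasurable_inner hW hp hh).sub (hF'.aestronglyMeasurable_inner hW hp hh))
      fun g n => ?_
    have e1 := hF.integral_duality hW hp g hh n
    have e2 := hF'.integral_duality hW hp g hh n
    have e3 : ∫ ω, F ω * polyVal W (dualTest g h n) ω ∂P =
        ∫ ω, F' ω * polyVal W (dualTest g h n) ω ∂P :=
      integral_congr_ae (hFF'.mono fun ω hω => by simp [hω])
    rw [e3, ← e2, ← sub_eq_zero, ← integral_sub (integrable_mul_polyVal hW hp m1 _)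
      (integrable_mul_polyVal hW hp m2 _)] at e1
    rw [← e1]
    refine integral_congr_ae (Eventually.of_forall fun ω => ?_)
    simp [polyVal, sub_mul]
  rw [← sub_ae_eq_zero]
  refine ae_eq_zero_of_forall_inner (𝕜 := ℝ) fun c => ?_
  rcases eq_or_ne c 0 with rfl | hc
  · exact Eventually.of_forall fun ω => by simp
  · have hc' : ‖(‖c‖⁻¹ • c)‖ = 1 := by
      rw [norm_smul, norm_inv, norm_norm, inv_mul_cancel₀ (norm_ne_zero_iff.2 hc)]
    filter_upwards [hunit _ hc'] with ω hω
    rw [inner_smul_right] at hω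
    have : inner ℝ ((U - U') ω) c = 0 := by
      simpa [norm_ne_zero_iff.2 hc] using hω
    rw [real_inner_comm]
    exact this

theorem IsMalliavinBracket.ae_eq [TopologicalSpace.SeparableSpace H] (hW : IsIsonormal W P)
    {p : ℝ≥0∞} (hp : 1 < p) {F Γ Γ' : Ω → ℝ} (h : IsMalliavinBracket W P p F Γ)
    (h' : IsMalliavinBracket W P p F Γ') : Γ =ᵐ[P] Γ' := by
  obtain ⟨G, V, U, hG, hV, hU, hΓ⟩ := h
  obtain ⟨G', V', U', hG', hV', hU', hΓ'⟩ := h'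
  have e1 := hV.ae_eq hW hp hV' (hG.ae_eq hW hp hG')
  have e2 := hU.ae_eq hW hp hU' (ae_eq_refl F)
  filter_upwards [hΓ, hΓ', e1, e2] with ω h1 h2 h3 h4
  rw [h1, h2, h3, h4]

end Malliavin

namespace Malliavin

/-! ### Dominated convergence in `L^p` and Riemann sums -/

theorem tendsto_eLpNorm_of_dominated {α E : Type*} [MeasurableSpace α] {μ : Measure α}
    [NormedAddCommGroup E] {p : ℝ≥0∞} (hp0 : p ≠ 0) (hp : p ≠ ∞) {F : ℕ → α → E} {f : α → E}
    {B : α → ℝ} (hF : ∀ k, AEStronglyMeasurable (F k) μ) (hB : MemLp B p μ)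
    (hbound : ∀ k x, ‖F k x‖ ≤ B x) (hlim : ∀ x, Tendsto (fun k => F k x) atTop (𝓝 (f x))) :
    MemLp f p μ ∧ Tendsto (fun k => eLpNorm (F k - f) p μ) atTop (𝓝 0) := by
  have hfm : AEStronglyMeasurable f μ :=
    aestronglyMeasurable_of_tendsto_ae atTop hF (Eventually.of_forall hlim)
  have hfB : ∀ x, ‖f x‖ ≤ B x := fun x =>
    le_of_tendsto (hlim x).norm (Eventually.of_forall fun k => hbound k x)
  have hf : MemLp f p μ := hB.mono' hfm (Eventually.of_forall hfB)
  refine ⟨hf, ?_⟩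
  have hpr : 0 < p.toReal := ENNReal.toReal_pos hp0 hp
  have h2B : MemLp (fun x => B x + B x) p μ := hB.add hB
  have hfin : ∫⁻ x, ‖B x + B x‖ₑ ^ p.toReal ∂μ ≠ ∞ :=
    (lintegral_rpow_enorm_lt_top_of_eLpNorm_lt_top hp0 hp h2B.2).ne
  have key := tendsto_lintegral_of_dominated_convergence' (μ := μ)
    (F := fun k x => ‖(F k - f) x‖ₑ ^ p.toReal) (f := fun _ => 0)
    (fun x => ‖B x + B x‖ₑ ^ p.toReal)
    (fun k => ((hF k).sub hfm).enorm.pow_const _)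
    (fun k => Eventually.of_forall fun x => by
      have : ‖(F k - f) x‖ ≤ ‖B x + B x‖ := by
        rw [Pi.sub_apply]
        refine (norm_sub_le _ _).trans ((add_le_add (hbound k x) (hfB x)).trans (le_abs_self _))
      exact ENNReal.rpow_le_rpow (enorm_le_iff_norm_le.2 this) hpr.le) hfin
    (Eventually.of_forall fun x => by
      have h1 : Tendsto (fun k => ‖(F k - f) x‖ₑ) atTop (𝓝 0) := by
        have := ((hlim x).sub_const (f x)).enorm
        simpa using this
      simpa [hpr] using h1.ennrpow_const p.toReal)
  simp only [lintegral_zero] at key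
  simp only [eLpNorm_eq_lintegral_rpow_enorm_toReal hp0 hp]
  simpa [hpr] using key.ennrpow_const (1 / p.toReal)

/-- Right endpoints are used so that the node `0` is never sampled: the integrands in
`InJetClosure.integral` are only known to lie in the closure for `v > 0`. -/
theorem tendsto_riemannSum {E : Type*} [NormedAddCommGroup E] [NormedSpace ℝ E] [CompleteSpace E]
    {f : ℝ → E} (hf : ContinuousOn f (Set.Icc 0 1)) :
    Tendsto (fun N : ℕ => ∑ j ∈ Finset.range (N + 1),
      (1 / (N + 1 : ℝ)) • f ((j + 1 : ℝ) / (N + 1))) atTop (𝓝 (∫ v in (0 : ℝ)..1, f v)) := by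
  rw [Metric.tendsto_atTop]
  intro ε hε
  have huc := isCompact_Icc.uniformContinuousOn_of_continuous hf
  obtain ⟨δ, hδ, hfδ⟩ := Metric.uniformContinuousOn_iff.1 huc (ε / 2) (half_pos hε)
  obtain ⟨N0, hN0⟩ := exists_nat_one_div_lt hδ
  refine ⟨N0, fun N hN => ?_⟩
  have hNpos : (0 : ℝ) < N + 1 := by positivity
  set a : ℕ → ℝ := fun j => j / (N + 1 : ℝ) with ha
  have hstep : ∀ j, a (j + 1) - a j = 1 / (N + 1 : ℝ) := by
    intro j; simp only [ha]; push_cast; field_simp; ring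
  have hle : ∀ j, a j ≤ a (j + 1) := fun j => by
    have := hstep j
    have : 0 < 1 / (N + 1 : ℝ) := by positivity
    linarith
  have hmem : ∀ j, j < N + 1 → Set.Icc (a j) (a (j + 1)) ⊆ Set.Icc 0 1 := by
    intro j hj x hx
    refine ⟨le_trans (by positivity) hx.1, hx.2.trans ?_⟩
    simp only [ha]
    rw [div_le_one hNpos]
    exact_mod_cast hj
  have hii : ∀ j < N + 1, IntervalIntegrable f volume (a j) (a (j + 1)) := fun j hj =>
    (hf.mono (by rw [Set.uIcc_of_le (hle j)]; exact hmem j hj)).intervalIntegrable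
  have hsum := intervalIntegral.sum_integral_adjacent_intervals hii
  have ha0 : a 0 = 0 := by simp [ha]
  have ha1 : a (N + 1) = 1 := by simp only [ha]; push_cast; field_simp
  rw [ha0, ha1] at hsum
  rw [← hsum, dist_eq_norm, ← Finset.sum_sub_distrib]
  have hterm : ∀ j ∈ Finset.range (N + 1),
      ‖(1 / (N + 1 : ℝ)) • f ((j + 1 : ℝ) / (N + 1)) - ∫ v in a j..a (j + 1), f v‖ ≤
        ε / 2 * (1 / (N + 1 : ℝ)) := by
    intro j hj
    have hj' := Finset.mem_range.1 hj
    have e : (1 / (N + 1 : ℝ)) • f ((j + 1 : ℝ) / (N + 1)) =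
        ∫ v in a j..a (j + 1), f (a (j + 1)) := by
      rw [intervalIntegral.integral_const, hstep]
      simp [ha]
    rw [e, ← intervalIntegral.integral_sub (by simp) (hii j hj')]
    refine (intervalIntegral.norm_integral_le_of_norm_le_const (C := ε / 2) fun v hv => ?_).trans ?_
    · rw [Set.uIoc_of_le (hle j)] at hv
      rw [← dist_eq_norm]
      refine (hfδ _ (hmem j hj' ⟨hle j, le_rfl⟩) _ (hmem j hj' ⟨hv.1.le, hv.2⟩) ?_).le
      rw [Real.dist_eq, abs_of_nonneg (by linarith [hv.2])]
      have h1 : (1 : ℝ) / (N + 1) ≤ 1 / (N0 + 1) := by gcongr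
      linarith [hstep j, hv.1]
    · rw [hstep, abs_of_pos (by positivity)]
  refine (norm_sum_le_of_le _ hterm).trans_lt ?_
  rw [Finset.sum_const, Finset.card_range, nsmul_eq_mul]
  push_cast
  field_simp
  linarith

/-! ### The closure of the jets of polynomials -/

variable {ι : Type*} [Fintype ι]

/-- Value, gradient and Ornstein-Uhlenbeck operator of a polynomial. -/
noncomputable def jet (q : MvPolynomial ι ℝ) (x : ι → ℝ) : ℝ × (ι → ℝ) × ℝ :=
  (MvPolynomial.eval x q, fun i => MvPolynomial.eval x (MvPolynomial.pderiv i q),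
    MvPolynomial.eval x (ouPoly q))

/-- The closure in `L^p(γ)` of the set of jets of polynomials. -/
def InJetClosure (γ : Measure (ι → ℝ)) (p : ℝ≥0∞) (Φ : (ι → ℝ) → ℝ × (ι → ℝ) × ℝ) : Prop :=
  MemLp Φ p γ ∧ ∀ ε : ℝ≥0∞, ε ≠ 0 → ∃ q, eLpNorm (jet q - Φ) p γ ≤ ε

theorem ouPoly_add (q r : MvPolynomial ι ℝ) : ouPoly (q + r) = ouPoly q + ouPoly r := by
  simp only [ouPoly, ← Finset.sum_add_distrib, map_add]
  exact Finset.sum_congr rfl fun i _ => by ring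

theorem ouPoly_C_mul (c : ℝ) (q : MvPolynomial ι ℝ) :
    ouPoly (MvPolynomial.C c * q) = MvPolynomial.C c * ouPoly q := by
  simp only [ouPoly, Finset.mul_sum, MvPolynomial.pderiv_C_mul]
  refine Finset.sum_congr rfl fun i _ => ?_
  ring

theorem jet_add (q r : MvPolynomial ι ℝ) : jet (q + r) = jet q + jet r := by
  funext x
  refine Prod.ext ?_ (Prod.ext ?_ ?_)
  · simp [jet]
  · funext i; simp [jet]
  · simp [jet, ouPoly_add]

theorem jet_C_mul (c : ℝ) (q : MvPolynomial ι ℝ) : jet (MvPolynomial.C c * q) = c • jet q := by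
  funext x
  refine Prod.ext ?_ (Prod.ext ?_ ?_)
  · simp [jet]
  · funext i; simp [jet]
  · simp [jet, ouPoly_C_mul]

theorem memLp_triple {α : Type*} [MeasurableSpace α] {μ : Measure α} {p : ℝ≥0∞} {u k : α → ℝ}
    {d : ι → α → ℝ} (hu : MemLp u p μ) (hd : ∀ i, MemLp (d i) p μ) (hk : MemLp k p μ) :
    MemLp (fun x => (u x, (fun i => d i x), k x)) p μ := by
  have hb : MemLp (fun x => ‖u x‖ + ∑ i, ‖d i x‖ + ‖k x‖) p μ :=
    (hu.norm.add (memLp_finsetSum _ fun i _ => (hd i).norm)).add hk.norm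
  refine hb.mono' (hu.1.prodMk
    ((aemeasurable_pi_lambda _ fun i => (hd i).1.aemeasurable).aestronglyMeasurable.prodMk hk.1))
    (Eventually.of_forall fun x => ?_)
  have h0 : 0 ≤ ∑ i, ‖d i x‖ := Finset.sum_nonneg fun i _ => norm_nonneg _
  have h1 : ‖fun i => d i x‖ ≤ ∑ i, ‖d i x‖ :=
    (pi_norm_le_iff_of_nonneg h0).2 fun i =>
      Finset.single_le_sum (f := fun i => ‖d i x‖) (fun i _ => norm_nonneg _) (Finset.mem_univ i)
  refine norm_prod_le_iff.2 ⟨?_, norm_prod_le_iff.2 ⟨?_, ?_⟩⟩ <;> dsimp only <;>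
    linarith [norm_nonneg (u x), norm_nonneg (k x)]

variable {γ : Measure (ι → ℝ)} {p : ℝ≥0∞}

theorem memLp_jet [IsFiniteMeasure γ] (hγ : ∀ i (p : ℝ≥0∞), p ≠ ∞ → MemLp (fun x => x i) p γ)
    (hp : p ≠ ∞) (q : MvPolynomial ι ℝ) : MemLp (jet q) p γ :=
  memLp_triple (memLp_eval hγ _ p hp) (fun _ => memLp_eval hγ _ p hp) (memLp_eval hγ _ p hp)

theorem inJetClosure_jet [IsFiniteMeasure γ]
    (hγ : ∀ i (p : ℝ≥0∞), p ≠ ∞ → MemLp (fun x => x i) p γ)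
    (hp : p ≠ ∞) (q : MvPolynomial ι ℝ) : InJetClosure γ p (jet q) :=
  ⟨memLp_jet hγ hp q, fun ε _ => ⟨q, by simp⟩⟩

namespace InJetClosure

variable {Φ Ψ : (ι → ℝ) → ℝ × (ι → ℝ) × ℝ}

theorem jet_aestronglyMeasurable (q : MvPolynomial ι ℝ) : AEStronglyMeasurable (jet q) γ := by
  have : Continuous (jet q) := by
    unfold jet
    exact (continuous_eval _).prodMk
      ((continuous_pi fun i => continuous_eval _).prodMk (continuous_eval _))
  exact this.aestronglyMeasurable

theorem add (hp : 1 ≤ p) (hΦ : InJetClosure γ p Φ) (hΨ : InJetClosure γ p Ψ) :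
    InJetClosure γ p (Φ + Ψ) := by
  refine ⟨hΦ.1.add hΨ.1, fun ε hε => ?_⟩
  obtain ⟨q, hq⟩ := hΦ.2 (ε / 2) (ENNReal.half_pos hε).ne'
  obtain ⟨r, hr⟩ := hΨ.2 (ε / 2) (ENNReal.half_pos hε).ne'
  refine ⟨q + r, ?_⟩
  have e : jet (q + r) - (Φ + Ψ) = (jet q - Φ) + (jet r - Ψ) := by rw [jet_add]; abel
  rw [e, ← ENNReal.add_halves ε]
  exact (eLpNorm_add_le ((jet_aestronglyMeasurable q).sub hΦ.1.1)
    ((jet_aestronglyMeasurable r).sub hΨ.1.1) hp).trans (add_le_add hq hr)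

theorem const_smul (hΦ : InJetClosure γ p Φ) (c : ℝ) : InJetClosure γ p (c • Φ) := by
  refine ⟨hΦ.1.const_smul c, fun ε hε => ?_⟩
  obtain ⟨q, hq⟩ := hΦ.2 (ε / (‖c‖ₑ + 1)) (ENNReal.div_pos hε (by simp)).ne'
  refine ⟨MvPolynomial.C c * q, ?_⟩
  rw [jet_C_mul, ← smul_sub, eLpNorm_const_smul]
  refine (mul_le_mul' (le_self_add (b := 1)) hq).trans ?_
  exact ENNReal.mul_div_le

theorem sum (hp : 1 ≤ p) {κ : Type*} (s : Finset κ) {Φ : κ → (ι → ℝ) → ℝ × (ι → ℝ) × ℝ}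
    (h : ∀ k ∈ s, InJetClosure γ p (Φ k)) : InJetClosure γ p (∑ k ∈ s, Φ k) := by
  classical
  induction s using Finset.induction_on with
  | empty =>
    have : jet (0 : MvPolynomial ι ℝ) = 0 := by
      have := jet_C_mul 0 (0 : MvPolynomial ι ℝ); simpa using this
    exact ⟨by simp, fun ε _ => ⟨0, by simp [this]⟩⟩
  | insert a s ha ih =>
    rw [Finset.sum_insert ha]
    exact (h a (by simp)).add hp (ih fun k hk => h k (by simp [hk]))

theorem of_tendsto (hp : 1 ≤ p) {F : ℕ → (ι → ℝ) → ℝ × (ι → ℝ) × ℝ}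
    (hF : ∀ k, InJetClosure γ p (F k)) (hΦ : MemLp Φ p γ)
    (h : Tendsto (fun k => eLpNorm (F k - Φ) p γ) atTop (𝓝 0)) : InJetClosure γ p Φ := by
  refine ⟨hΦ, fun ε hε => ?_⟩
  have hε2 := ENNReal.half_pos hε
  obtain ⟨k, hk⟩ := ((tendsto_order.1 h).2 _ hε2).exists
  obtain ⟨q, hq⟩ := (hF k).2 _ hε2.ne'
  refine ⟨q, ?_⟩
  have e : jet q - Φ = (jet q - F k) + (F k - Φ) := by abel
  rw [e, ← ENNReal.add_halves ε]
  exact (eLpNorm_add_le ((jet_aestronglyMeasurable q).sub (hF k).1.1)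
    ((hF k).1.1.sub hΦ.1) hp).trans (add_le_add hq hk.le)

theorem of_dominated (hp : 1 ≤ p) (hp' : p ≠ ∞) {F : ℕ → (ι → ℝ) → ℝ × (ι → ℝ) × ℝ}
    (hF : ∀ k, InJetClosure γ p (F k)) {B : (ι → ℝ) → ℝ} (hB : MemLp B p γ)
    (hbound : ∀ k x, ‖F k x‖ ≤ B x) (hlim : ∀ x, Tendsto (fun k => F k x) atTop (𝓝 (Φ x))) :
    InJetClosure γ p Φ := by
  obtain ⟨h1, h2⟩ := tendsto_eLpNorm_of_dominated (by positivity) hp' (fun k => (hF k).1.1) hB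
    hbound hlim
  exact of_tendsto hp hF h1 h2

/-- Riemann sums are linear combinations of members of the closure, they are dominated by `B`, and
they converge pointwise by continuity in `v`. -/
theorem integral (hp : 1 ≤ p) (hp' : p ≠ ∞) {F : ℝ → (ι → ℝ) → ℝ × (ι → ℝ) × ℝ}
    (hF : ∀ v, 0 < v → v ≤ 1 → InJetClosure γ p (F v)) {B : (ι → ℝ) → ℝ} (hB : MemLp B p γ)
    (hbound : ∀ v, 0 ≤ v → v ≤ 1 → ∀ x, ‖F v x‖ ≤ B x)
    (hc : ∀ x, ContinuousOn (fun v => F v x) (Set.Icc 0 1)) :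
    InJetClosure γ p fun x => ∫ v in (0 : ℝ)..1, F v x := by
  have hv : ∀ N j : ℕ, j ∈ Finset.range (N + 1) →
      0 < (j + 1 : ℝ) / (N + 1) ∧ (j + 1 : ℝ) / (N + 1) ≤ 1 := by
    intro N j hj
    have : (j + 1 : ℝ) ≤ N + 1 := by exact_mod_cast Finset.mem_range.1 hj
    exact ⟨by positivity, (div_le_one (by positivity)).2 this⟩
  refine of_dominated hp hp' (F := fun N x => ∑ j ∈ Finset.range (N + 1),
      (1 / (N + 1 : ℝ)) • F ((j + 1 : ℝ) / (N + 1)) x) (fun N => ?_) hB (fun N x => ?_)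
      fun x => tendsto_riemannSum (hc x)
  · have := sum hp (Finset.range (N + 1)) (Φ := fun j => (1 / (N + 1 : ℝ)) •
      F ((j + 1 : ℝ) / (N + 1))) fun j hj => (hF _ (hv N j hj).1 (hv N j hj).2).const_smul _
    convert this using 1
    funext x
    simp
  · refine (norm_sum_le_of_le (n := fun _ => 1 / (N + 1 : ℝ) * B x) _ fun j hj => ?_).trans ?_
    · rw [norm_smul, Real.norm_of_nonneg (by positivity)]
      exact mul_le_mul_of_nonneg_left (hbound _ (hv N j hj).1.le (hv N j hj).2 x) (by positivity)
    · rw [Finset.sum_const, Finset.card_range, nsmul_eq_mul]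
      push_cast
      field_simp
      exact le_rfl

end InJetClosure

/-! ### Jets of products of polynomials and exponentials of polynomials -/

/-- The jet of `q * exp ψ`. -/
noncomputable def expJet (ψ q : MvPolynomial ι ℝ) (x : ι → ℝ) : ℝ × (ι → ℝ) × ℝ :=
  Real.exp (MvPolynomial.eval x ψ) •
    (MvPolynomial.eval x q,
      fun i => MvPolynomial.eval x (MvPolynomial.pderiv i q + q * MvPolynomial.pderiv i ψ),
      MvPolynomial.eval x (ouPoly q + 2 * ∑ i, MvPolynomial.pderiv i q * MvPolynomial.pderiv i ψ +
        q * (ouPoly ψ + ∑ i, MvPolynomial.pderiv i ψ ^ 2)))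

theorem expJet_zero (q : MvPolynomial ι ℝ) : expJet 0 q = jet q := by
  funext x
  simp [expJet, jet, ouPoly]

/-- All polynomial multiples of `exp ψ` are in `L^p(γ)`. -/
def ExpMemLp (γ : Measure (ι → ℝ)) (p : ℝ≥0∞) (ψ : MvPolynomial ι ℝ) : Prop :=
  ∀ q : MvPolynomial ι ℝ,
    MemLp (fun x => Real.exp (MvPolynomial.eval x ψ) * MvPolynomial.eval x q) p γ

/-- Hölder with `1/p = 1/p' + 1/r`: the strictly larger exponent `p'` leaves a finite `r` for the
polynomial factor. -/
theorem expMemLp_of_memLp [IsFiniteMeasure γ]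
    (hγ : ∀ i (p : ℝ≥0∞), p ≠ ∞ → MemLp (fun x => x i) p γ) {p' : ℝ≥0∞} (hpp : p < p')
    {ψ : MvPolynomial ι ℝ} (h : MemLp (fun x => Real.exp (MvPolynomial.eval x ψ)) p' γ) :
    ExpMemLp γ p ψ := by
  intro q
  set r : ℝ≥0∞ := (p⁻¹ - p'⁻¹)⁻¹ with hr
  have hlt : p'⁻¹ < p⁻¹ := ENNReal.inv_lt_inv.2 hpp
  have hr' : r ≠ ∞ := by
    rw [hr, Ne, ENNReal.inv_eq_top]
    exact (tsub_pos_of_lt hlt).ne'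
  have : ENNReal.HolderTriple p' r p := ⟨by
    rw [hr, inv_inv, add_tsub_cancel_of_le hlt.le]⟩
  exact (memLp_eval hγ q r hr').mul' h

/-- The Taylor polynomials of `exp η`. -/
noncomputable def expTrunc (η : MvPolynomial ι ℝ) (M : ℕ) : MvPolynomial ι ℝ :=
  ∑ k ∈ Finset.range M, MvPolynomial.C ((k.factorial : ℝ)⁻¹) * η ^ k

theorem eval_expTrunc (η : MvPolynomial ι ℝ) (M : ℕ) (x : ι → ℝ) :
    MvPolynomial.eval x (expTrunc η M) =
      ∑ k ∈ Finset.range M, MvPolynomial.eval x η ^ k / k.factorial := by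
  simp only [expTrunc, map_sum, map_mul, map_pow, MvPolynomial.eval_C, div_eq_inv_mul]

theorem tendsto_eval_expTrunc (η : MvPolynomial ι ℝ) (x : ι → ℝ) :
    Tendsto (fun M => MvPolynomial.eval x (expTrunc η M)) atTop
      (𝓝 (Real.exp (MvPolynomial.eval x η))) := by
  simp only [eval_expTrunc]
  have := NormedSpace.expSeries_div_hasSum_exp (MvPolynomial.eval x η : ℝ)
  rw [← Real.exp_eq_exp_ℝ] at this
  exact this.tendsto_sum_nat

theorem abs_eval_expTrunc_le (η : MvPolynomial ι ℝ) (M : ℕ) (x : ι → ℝ) :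
    |MvPolynomial.eval x (expTrunc η M)| ≤
      Real.exp (MvPolynomial.eval x η) + Real.exp (-MvPolynomial.eval x η) := by
  refine le_trans ?_ (Real.exp_abs_le _)
  rw [eval_expTrunc]
  refine (Finset.abs_sum_le_sum_abs _ _).trans ?_
  refine le_trans (le_of_eq ?_) (Real.sum_le_exp_of_nonneg (abs_nonneg (MvPolynomial.eval x η)) M)
  refine Finset.sum_congr rfl fun k _ => ?_
  rw [abs_div, abs_pow, Nat.abs_cast]

theorem pderiv_expTrunc (η : MvPolynomial ι ℝ) (M : ℕ) (i : ι) :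
    MvPolynomial.pderiv i (expTrunc η (M + 1)) = expTrunc η M * MvPolynomial.pderiv i η := by
  induction M with
  | zero => simp [expTrunc]
  | succ M ih =>
    have e : ∀ M, expTrunc η (M + 1) =
        expTrunc η M + MvPolynomial.C ((M.factorial : ℝ)⁻¹) * η ^ M := fun M => by
      rw [expTrunc, Finset.sum_range_succ]; rfl
    rw [e (M + 1), map_add, ih, e M, MvPolynomial.pderiv_C_mul, Derivation.leibniz_pow, add_mul]
    congr 1
    rw [Nat.factorial_succ, add_tsub_cancel_right]
    simp only [nsmul_eq_mul, smul_eq_mul]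
    have : MvPolynomial.C (((M + 1) * M.factorial : ℕ) : ℝ)⁻¹ * ((M + 1 : ℕ) : MvPolynomial ι ℝ) =
        MvPolynomial.C ((M.factorial : ℝ)⁻¹) := by
      rw [← map_natCast (MvPolynomial.C (σ := ι) (R := ℝ)), ← map_mul]
      congr 1
      push_cast
      field_simp
    rw [← this]
    ring

/-- The part of the jet of `q * T(η) * exp ψ` with a first derivative of `T`. -/
noncomputable def expJetFst (ψ η q : MvPolynomial ι ℝ) (x : ι → ℝ) : ℝ × (ι → ℝ) × ℝ :=
  Real.exp (MvPolynomial.eval x ψ) •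
    (MvPolynomial.eval x 0, fun i => MvPolynomial.eval x (q * MvPolynomial.pderiv i η),
      MvPolynomial.eval x (2 * (∑ i, MvPolynomial.pderiv i q * MvPolynomial.pderiv i η) +
        q * (ouPoly η + 2 * ∑ i, MvPolynomial.pderiv i ψ * MvPolynomial.pderiv i η)))

/-- The part of the jet of `q * T(η) * exp ψ` with a second derivative of `T`. -/
noncomputable def expJetSnd (ψ η q : MvPolynomial ι ℝ) (x : ι → ℝ) : ℝ × (ι → ℝ) × ℝ :=
  Real.exp (MvPolynomial.eval x ψ) •
    (MvPolynomial.eval x 0, fun _ => MvPolynomial.eval x 0,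
      MvPolynomial.eval x (q * ∑ i, MvPolynomial.pderiv i η ^ 2))

/-- Differentiating a Taylor polynomial of the exponential lowers its length by one. A jet of second
order thus involves the lengths `M + 2`, `M + 1` and `M`, which all have the limit `exp η`;
`expJet_add` is the resulting limit. -/
theorem expJet_mul_expTrunc (ψ η q : MvPolynomial ι ℝ) (M : ℕ) (x : ι → ℝ) :
    expJet ψ (q * expTrunc η (M + 2)) x =
      MvPolynomial.eval x (expTrunc η (M + 2)) • expJet ψ q x +
      MvPolynomial.eval x (expTrunc η (M + 1)) • expJetFst ψ η q x +
      MvPolynomial.eval x (expTrunc η M) • expJetSnd ψ η q x := by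
  have hou : ouPoly (q * expTrunc η (M + 2)) = ouPoly q * expTrunc η (M + 2) +
      expTrunc η (M + 1) * (2 * (∑ i, MvPolynomial.pderiv i q * MvPolynomial.pderiv i η) +
        q * ouPoly η) + expTrunc η M * (q * ∑ i, MvPolynomial.pderiv i η ^ 2) := by
    simp only [ouPoly, Finset.mul_sum, Finset.sum_mul, ← Finset.sum_add_distrib]
    refine Finset.sum_congr rfl fun i _ => ?_
    simp only [MvPolynomial.pderiv_mul, map_add, pderiv_expTrunc]
    ring
  have hgr : (∑ i, MvPolynomial.pderiv i (q * expTrunc η (M + 2)) * MvPolynomial.pderiv i ψ) =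
      (∑ i, MvPolynomial.pderiv i q * MvPolynomial.pderiv i ψ) * expTrunc η (M + 2) +
      expTrunc η (M + 1) * (q * ∑ i, MvPolynomial.pderiv i ψ * MvPolynomial.pderiv i η) := by
    simp only [Finset.mul_sum, Finset.sum_mul, ← Finset.sum_add_distrib]
    refine Finset.sum_congr rfl fun i _ => ?_
    simp only [MvPolynomial.pderiv_mul, pderiv_expTrunc]
    ring
  refine Prod.ext ?_ (Prod.ext ?_ ?_)
  · simp only [expJet, expJetFst, expJetSnd, Prod.smul_mk, Prod.mk_add_mk, map_zero, map_mul,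
      smul_eq_mul]
    ring
  · funext i
    simp only [expJet, expJetFst, expJetSnd, Prod.smul_mk, Prod.mk_add_mk, map_zero, map_mul,
      map_add, smul_eq_mul, Pi.add_apply, Pi.smul_apply, MvPolynomial.pderiv_mul, pderiv_expTrunc]
    ring
  · simp only [expJet, expJetFst, expJetSnd, Prod.smul_mk, Prod.mk_add_mk, hou, hgr, map_mul,
      map_add, smul_eq_mul]
    ring

theorem expJet_add (ψ η q : MvPolynomial ι ℝ) (x : ι → ℝ) :
    expJet (ψ + η) q x = Real.exp (MvPolynomial.eval x η) •
      (expJet ψ q x + expJetFst ψ η q x + expJetSnd ψ η q x) := by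
  have hgr : (∑ i, MvPolynomial.pderiv i q * (MvPolynomial.pderiv i ψ + MvPolynomial.pderiv i η)) =
      (∑ i, MvPolynomial.pderiv i q * MvPolynomial.pderiv i ψ) +
      ∑ i, MvPolynomial.pderiv i q * MvPolynomial.pderiv i η := by
    simp only [mul_add, Finset.sum_add_distrib]
  have hsq : (∑ i, (MvPolynomial.pderiv i ψ + MvPolynomial.pderiv i η) ^ 2) =
      (∑ i, MvPolynomial.pderiv i ψ ^ 2) +
      2 * (∑ i, MvPolynomial.pderiv i ψ * MvPolynomial.pderiv i η) +
      ∑ i, MvPolynomial.pderiv i η ^ 2 := by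
    simp only [Finset.mul_sum, ← Finset.sum_add_distrib]
    exact Finset.sum_congr rfl fun i _ => by ring
  refine Prod.ext ?_ (Prod.ext ?_ ?_)
  · simp only [expJet, expJetFst, expJetSnd, Prod.smul_mk, Prod.mk_add_mk, map_zero,
      smul_eq_mul, map_add, Real.exp_add]
    ring
  · funext i
    simp only [expJet, expJetFst, expJetSnd, Prod.smul_mk, Prod.mk_add_mk, map_zero, map_mul,
      map_add, smul_eq_mul, Pi.add_apply, Pi.smul_apply, Real.exp_add]
    ring
  · simp only [expJet, expJetFst, expJetSnd, Prod.smul_mk, Prod.mk_add_mk, map_mul, ouPoly_add,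
      map_add, smul_eq_mul, Real.exp_add, hgr, hsq]
    ring

theorem memLp_exp_smul_triple {ψ : MvPolynomial ι ℝ} (hψ : ExpMemLp γ p ψ)
    (a : MvPolynomial ι ℝ) (b : ι → MvPolynomial ι ℝ) (c : MvPolynomial ι ℝ) :
    MemLp (fun x => Real.exp (MvPolynomial.eval x ψ) •
      (MvPolynomial.eval x a, (fun i => MvPolynomial.eval x (b i)), MvPolynomial.eval x c)) p γ :=
  memLp_triple (hψ a) (fun i => hψ (b i)) (hψ c)

/-- Approximate `exp (ψ + η)` by `exp ψ` times Taylor polynomials of `exp η`. These are bounded by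
`exp η + exp (-η)`, which explains why both `ψ + η` and `ψ - η` must have integrable exponentials.
-/
theorem inJetClosure_expJet_add (hp : 1 ≤ p) (hp' : p ≠ ∞) {ψ η : MvPolynomial ι ℝ}
    (hψ : ∀ q, InJetClosure γ p (expJet ψ q)) (h1 : ExpMemLp γ p (ψ + η))
    (h2 : ExpMemLp γ p (ψ - η)) (q : MvPolynomial ι ℝ) :
    InJetClosure γ p (expJet (ψ + η) q) := by
  have hb : ∀ (a : MvPolynomial ι ℝ) (b : ι → MvPolynomial ι ℝ) (c : MvPolynomial ι ℝ),
      MemLp (fun x => (Real.exp (MvPolynomial.eval x η) + Real.exp (-MvPolynomial.eval x η)) *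
        ‖Real.exp (MvPolynomial.eval x ψ) • (MvPolynomial.eval x a,
          (fun i => MvPolynomial.eval x (b i)), MvPolynomial.eval x c)‖) p γ := by
    intro a b c
    refine ((memLp_exp_smul_triple h1 a b c).norm.add
      (memLp_exp_smul_triple h2 a b c).norm).ae_eq (Eventually.of_forall fun x => ?_)
    simp only [Pi.add_apply, norm_smul, Real.norm_eq_abs, Real.abs_exp, map_add, map_sub]
    rw [Real.exp_add, sub_eq_add_neg, Real.exp_add]
    ring
  refine InJetClosure.of_dominated hp hp' (F := fun M => expJet ψ (q * expTrunc η (M + 2)))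
    (fun M => hψ _) (((hb _ _ _).add (hb _ _ _)).add (hb _ _ _)
      : MemLp (fun x =>
        (Real.exp (MvPolynomial.eval x η) + Real.exp (-MvPolynomial.eval x η)) * ‖expJet ψ q x‖ +
        (Real.exp (MvPolynomial.eval x η) + Real.exp (-MvPolynomial.eval x η)) *
          ‖expJetFst ψ η q x‖ +
        (Real.exp (MvPolynomial.eval x η) + Real.exp (-MvPolynomial.eval x η)) *
          ‖expJetSnd ψ η q x‖) p γ) (fun M x => ?_) fun x => ?_
  · rw [expJet_mul_expTrunc]
    have t : ∀ M (v : ℝ × (ι → ℝ) × ℝ), ‖MvPolynomial.eval x (expTrunc η M) • v‖ ≤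
        (Real.exp (MvPolynomial.eval x η) + Real.exp (-MvPolynomial.eval x η)) * ‖v‖ := by
      intro M v
      rw [norm_smul]
      exact mul_le_mul_of_nonneg_right (abs_eval_expTrunc_le η M x) (norm_nonneg _)
    exact (norm_add₃_le).trans (add_le_add (add_le_add (t _ _) (t _ _)) (t _ _))
  · simp only [expJet_mul_expTrunc]
    rw [expJet_add, smul_add, smul_add]
    have t := tendsto_eval_expTrunc η x
    exact ((((tendsto_add_atTop_iff_nat 2).2 t).smul_const _).add
      (((tendsto_add_atTop_iff_nat 1).2 t).smul_const _)).add (t.smul_const _)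

end Malliavin

namespace Malliavin

/-! ### Integration along the Mehler semigroup -/

/-- Here `M v` plays the role of the Mehler transform at time `-log v`. Its gradient is `v N v`, and
`hcl` includes the equation `L M v = -v M' v`. Subtracting the constant `C`, dividing the jet by `v`
and integrating over `[0, 1]` yields `u`, and the last component telescopes to `-(M 1 - C)`. -/
theorem exists_inJetClosure_of_mehler {ι : Type*} [Fintype ι] {γ : Measure (ι → ℝ)}
    [IsFiniteMeasure γ] (hγ : ∀ i (p : ℝ≥0∞), p ≠ ∞ → MemLp (fun x => x i) p γ) {p : ℝ≥0∞}
    (hp : 1 ≤ p) (hp' : p ≠ ∞) {M M' : ℝ → (ι → ℝ) → ℝ} {N : ℝ → (ι → ℝ) → ι → ℝ} {C : ℝ}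
    (hcl : ∀ v, 0 < v → v ≤ 1 → InJetClosure γ p fun x => (M v x, v • N v x, -(v * M' v x)))
    (h0 : ∀ x, M 0 x = C)
    (hd : ∀ v ∈ Set.Icc (0 : ℝ) 1, ∀ x, HasDerivAt (fun v => M v x) (M' v x) v)
    (hM' : ∀ x, ContinuousOn (fun v => M' v x) (Set.Icc 0 1))
    (hN : ∀ x, ContinuousOn (fun v => N v x) (Set.Icc 0 1)) {B : (ι → ℝ) → ℝ} (hB : MemLp B p γ)
    (hM'B : ∀ v, 0 ≤ v → v ≤ 1 → ∀ x, |M' v x| ≤ B x)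
    (hNB : ∀ v, 0 ≤ v → v ≤ 1 → ∀ x, ‖N v x‖ ≤ B x) :
    ∃ u : (ι → ℝ) → ℝ, InJetClosure γ p fun x =>
      (u x, ∫ v in (0 : ℝ)..1, N v x, -(M 1 x - C)) := by
  -- The quotient `(M v x - C) / v` is extended to `v = 0` by the derivative; it is then continuous,
  -- and the mean value inequality bounds it by `B`.
  set F : ℝ → (ι → ℝ) → ℝ × (ι → ℝ) × ℝ := fun v x =>
    (dslope (fun w => M w x) 0 v, N v x, -M' v x) with hF
  have hjet1 : jet (1 : MvPolynomial ι ℝ) = fun _ => ((1 : ℝ), (0 : ι → ℝ), (0 : ℝ)) := by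
    funext x
    refine Prod.ext ?_ (Prod.ext ?_ ?_)
    · simp [jet]
    · funext i; simp [jet]
    · simp [jet, ouPoly]
  have h01 : (0 : ℝ) ∈ Set.Icc (0 : ℝ) 1 := by simp
  have hds : ∀ v, 0 < v → ∀ x, dslope (fun w => M w x) 0 v = v⁻¹ * (M v x - C) := by
    intro v hv x
    rw [dslope_of_ne _ hv.ne', slope_def_module, h0]
    simp
  have hcont : ∀ x, ContinuousOn (fun v => F v x) (Set.Icc 0 1) := by
    intro x
    refine ContinuousOn.prodMk (fun v hv => ?_) ((hN x).prodMk (hM' x).neg)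
    rcases eq_or_ne v 0 with rfl | hv0
    · exact (continuousAt_dslope_same.2 (hd 0 hv x).differentiableAt).continuousWithinAt
    · exact ((continuousAt_dslope_of_ne hv0).2 (hd v hv x).continuousAt).continuousWithinAt
  have hbd : ∀ v, 0 ≤ v → v ≤ 1 → ∀ x, ‖F v x‖ ≤ B x := by
    intro v hv hv1 x
    refine norm_prod_le_iff.2 ⟨?_, norm_prod_le_iff.2 ⟨hNB v hv hv1 x, ?_⟩⟩
    · rcases hv.eq_or_lt with rfl | hv0
      · simp only [hF, dslope_same, (hd 0 h01 x).deriv]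
        exact hM'B 0 le_rfl zero_le_one x
      · simp only [hF]
        rw [hds v hv0, norm_mul, norm_inv, Real.norm_of_nonneg hv, inv_mul_le_iff₀ hv0]
        have := (convex_Icc (0 : ℝ) 1).norm_image_sub_le_of_norm_hasDerivWithin_le
          (f := fun w => M w x) (f' := fun w => M' w x) (C := B x)
          (fun w hw => (hd w hw x).hasDerivWithinAt) (fun w hw => hM'B w hw.1 hw.2 x) h01
          ⟨hv, hv1⟩
        rw [h0, sub_zero, Real.norm_of_nonneg hv, mul_comm] at this
        exact this
    · simpa [hF] using hM'B v hv hv1 x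
  have hFcl : ∀ v, 0 < v → v ≤ 1 → InJetClosure γ p (F v) := by
    intro v hv hv1
    have h1 := (((hcl v hv hv1).add hp ((inJetClosure_jet hγ hp' 1).const_smul (-C))).const_smul
      v⁻¹)
    convert h1 using 1
    funext x
    rw [hjet1]
    refine Prod.ext ?_ (Prod.ext ?_ ?_)
    · simp [hF, hds v hv, sub_eq_add_neg]
    · funext i; simp [hF, hv.ne']
    · simp [hF, hv.ne']
  have hI := InJetClosure.integral hp hp' hFcl hB hbd hcont
  refine ⟨fun x => (∫ v in (0 : ℝ)..1, F v x).1, ?_⟩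
  convert hI using 1
  funext x
  have hii : IntervalIntegrable (fun v => F v x) volume 0 1 :=
    ContinuousOn.intervalIntegrable (by rw [Set.uIcc_of_le zero_le_one]; exact hcont x)
  have e2 := (ContinuousLinearMap.fst ℝ (ι → ℝ) ℝ ∘L
    ContinuousLinearMap.snd ℝ ℝ ((ι → ℝ) × ℝ)).intervalIntegral_comp_comm hii
  have e3 := (ContinuousLinearMap.snd ℝ (ι → ℝ) ℝ ∘L
    ContinuousLinearMap.snd ℝ ℝ ((ι → ℝ) × ℝ)).intervalIntegral_comp_comm hii
  refine Prod.ext rfl (Prod.ext ?_ ?_)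
  · exact e2
  · refine Eq.trans ?_ e3
    have : ∫ v in (0 : ℝ)..1, M' v x = M 1 x - M 0 x :=
      intervalIntegral.integral_eq_sub_of_hasDerivAt
        (fun v hv => hd v (by rwa [Set.uIcc_of_le zero_le_one] at hv) x)
        (ContinuousOn.intervalIntegrable (by rw [Set.uIcc_of_le zero_le_one]; exact hM' x))
    simp only [hF, ContinuousLinearMap.comp_apply, ContinuousLinearMap.coe_snd']
    rw [intervalIntegral.integral_neg, this, h0]

/-! ### Orthonormal families -/

section

variable {Ω : Type*} [MeasurableSpace Ω] {P : Measure Ω} [IsProbabilityMeasure P]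
  {H : Type*} [NormedAddCommGroup H] [InnerProductSpace ℝ H] {W : H → Ω → ℝ}

theorem map_orthonormal_eq_pi (hW : IsIsonormal W P) {ι : Type*} [Fintype ι] {e : ι → H}
    (he : Orthonormal ℝ e) :
    P.map (fun ω i => W (e i) ω) = Measure.pi fun _ => gaussianReal 0 1 := by
  have hG : IsGaussianProcess (fun (q : (_ : ι) × Unit) ω => W (e q.1) ω) P :=
    hW.gaussian.comp_right (fun q : (_ : ι) × Unit => e q.1)
  have hind := hG.iIndepFun_of_covariance_eq_zero (X := fun t (_ : Unit) => W (e t))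
    (fun _ _ => (hW.measurable _).aemeasurable) (fun i j hij _ _ => by rw [hW.cov_eq, he.2 hij])
  have hind' : iIndepFun (fun i => W (e i)) P :=
    hind.comp (fun _ (u : Unit → ℝ) => u ()) fun _ => measurable_pi_apply _
  rw [(iIndepFun_iff_map_fun_eq_pi_map fun i => (hW.measurable _).aemeasurable).1 hind']
  congr 1
  funext i
  exact hW.map_eq_of_norm (he.1 i)

theorem measurable_family (hW : IsIsonormal W P) {ι : Type*} (e : ι → H) :
    Measurable fun ω i => W (e i) ω :=
  measurable_pi_lambda _ fun _ => hW.measurable _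

theorem memLp_coord_map (hW : IsIsonormal W P) {ι : Type*} [Fintype ι] (e : ι → H) (i : ι)
    (p : ℝ≥0∞) (hp : p ≠ ∞) : MemLp (fun x : ι → ℝ => x i) p (P.map fun ω i => W (e i) ω) :=
  (memLp_map_measure_iff (measurable_pi_apply i).aestronglyMeasurable
    (measurable_family hW e).aemeasurable).2 (hW.memLp (e i) hp)

theorem integral_ouPoly_eq_zero (hW : IsIsonormal W P) {ι : Type*} [Fintype ι] {e : ι → H}
    (he : Orthonormal ℝ e) (q : MvPolynomial ι ℝ) :
    ∫ ω, MvPolynomial.eval (fun i => W (e i) ω) (ouPoly q) ∂P = 0 := by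
  rcases isEmpty_or_nonempty ι with h | ⟨⟨i⟩⟩
  · simp [ouPoly]
  · have := integral_ouPoly_mul_hermitePoly hW he (he.1 i) 0 q
    simpa [hermitePoly_zero, polyVal_rename] using this

theorem tendsto_inv_add_one : Tendsto (fun k : ℕ => ((k + 1 : ℕ) : ℝ≥0∞)⁻¹) atTop (𝓝 0) :=
  (tendsto_add_atTop_iff_nat 1).2 ENNReal.tendsto_inv_nat_nhds_zero

theorem InJetClosure.exists_seq {ι : Type*} [Fintype ι] {γ : Measure (ι → ℝ)} {p : ℝ≥0∞}
    {Φ : (ι → ℝ) → ℝ × (ι → ℝ) × ℝ} (h : InJetClosure γ p Φ) :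
    ∃ q : ℕ → MvPolynomial ι ℝ, ∀ k, eLpNorm (jet (q k) - Φ) p γ ≤ ((k + 1 : ℕ) : ℝ≥0∞)⁻¹ := by
  choose q hq using fun k : ℕ => h.2 ((k + 1 : ℕ) : ℝ≥0∞)⁻¹ (by simp)
  exact ⟨q, hq⟩

theorem eLpNorm_comp_le (hW : IsIsonormal W P) {ι : Type*} [Fintype ι] {e : ι → H}
    {p : ℝ≥0∞} {Ψ : (ι → ℝ) → ℝ × (ι → ℝ) × ℝ}
    (hΨ : AEStronglyMeasurable Ψ (P.map fun ω i => W (e i) ω)) {E : Type*} [NormedAddCommGroup E]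
    {f : Ω → E} (c : ℝ) (hf : ∀ ω, ‖f ω‖ ≤ c * ‖Ψ fun i => W (e i) ω‖) :
    eLpNorm f p P ≤ ENNReal.ofReal c * eLpNorm Ψ p (P.map fun ω i => W (e i) ω) := by
  rw [eLpNorm_map_measure hΨ (measurable_family hW e).aemeasurable]
  exact eLpNorm_le_mul_eLpNorm_of_ae_le_mul (Eventually.of_forall hf) p

theorem InJetClosure.memLp_comp (hW : IsIsonormal W P) {ι : Type*} [Fintype ι] {e : ι → H}
    {p : ℝ≥0∞} {Φ : (ι → ℝ) → ℝ × (ι → ℝ) × ℝ}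
    (h : InJetClosure (P.map fun ω i => W (e i) ω) p Φ) :
    MemLp (fun ω => Φ fun i => W (e i) ω) p P :=
  (memLp_map_measure_iff h.1.1 (measurable_family hW e).aemeasurable).1 h.1

/-- Orthonormality of `e` is what makes `ouPoly` agree with the chaos definition of `L` on the
approximating polynomials. -/
theorem InJetClosure.hasOU (hW : IsIsonormal W P) {n : ℕ} {e : Fin n → H} (he : Orthonormal ℝ e)
    {p : ℝ≥0∞} {Φ : (Fin n → ℝ) → ℝ × (Fin n → ℝ) × ℝ}
    (h : InJetClosure (P.map fun ω i => W (e i) ω) p Φ) :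
    HasOU W P p (fun ω => (Φ fun i => W (e i) ω).1) fun ω => (Φ fun i => W (e i) ω).2.2 := by
  have hm := h.memLp_comp hW
  have hval : ∀ q : MvPolynomial (Fin n) ℝ,
      MemLp (fun ω => MvPolynomial.eval (fun i => W (e i) ω) q) 2 P := fun q =>
    memLp_eval (fun i _ hp => hW.memLp (e i) hp) q 2 (by simp)
  have hmeas : ∀ q : MvPolynomial (Fin n) ℝ,
      AEStronglyMeasurable[sigmaW W] ((hval q).toLp _) P := by
    intro q
    refine ⟨polyVal W (MvPolynomial.rename e q), (measurable_polyVal W _).stronglyMeasurable,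
      (hval q).coeFn_toLp.trans (Eventually.of_forall fun ω => (polyVal_rename e q ω).symm)⟩
  obtain ⟨q, hq⟩ := h.exists_seq
  have hlim := tendsto_of_tendsto_of_tendsto_of_le_of_le tendsto_const_nhds tendsto_inv_add_one
    (fun _ => bot_le) hq
  have hb : ∀ (f : ℕ → Ω → ℝ), (∀ k ω, ‖f k ω‖ ≤ ‖(jet (q k) - Φ) fun i => W (e i) ω‖) →
      Tendsto (fun k => eLpNorm (f k) p P) atTop (𝓝 0) := by
    intro f hf
    refine tendsto_of_tendsto_of_tendsto_of_le_of_le tendsto_const_nhds hlim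
      (fun _ => bot_le) fun k => ?_
    simpa using eLpNorm_comp_le hW ((InJetClosure.jet_aestronglyMeasurable (q k)).sub h.1.1)
      (f := f k) 1 (fun ω => by simpa using hf k ω)
  refine ⟨hm.fst, hm.snd.snd, fun k => (hval (q k)).toLp _,
    fun k => (hval (ouPoly (q k))).toLp _, fun k => ⟨_, ⟨n, e, q k, rfl⟩, (hval _).coeFn_toLp⟩,
    fun k => ?_, ?_, ?_⟩
  · refine hasOUL2_of_forall_hermitePoly hW (hmeas _) (hmeas _) ?_ fun m g hg => ?_
    · rw [integral_congr_ae (hval _).coeFn_toLp]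
      exact integral_ouPoly_eq_zero hW he _
    · have := integral_ouPoly_mul_hermitePoly hW he hg m (q k)
      have e1 : ∀ r : MvPolynomial (Fin n) ℝ,
          ∫ ω, (hval r).toLp _ ω * polyVal W (hermitePoly m g) ω ∂P =
            ∫ ω, polyVal W (MvPolynomial.rename e r * hermitePoly m g) ω ∂P := by
        intro r
        refine integral_congr_ae ?_
        filter_upwards [(hval r).coeFn_toLp] with ω hω
        rw [hω, ← polyVal_rename]
        simp [polyVal]
      rw [e1, e1, this]
  · refine (hb (fun k ω => (jet (q k) fun i => W (e i) ω).1 - (Φ fun i => W (e i) ω).1)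
      fun k ω => norm_fst_le ((jet (q k) - Φ) fun i => W (e i) ω)).congr fun k => ?_
    refine eLpNorm_congr_ae ?_
    filter_upwards [(hval (q k)).coeFn_toLp] with ω hω
    simp [hω, jet]
  · refine (hb (fun k ω => (jet (q k) fun i => W (e i) ω).2.2 - (Φ fun i => W (e i) ω).2.2)
      fun k ω => (norm_snd_le ((jet (q k) - Φ) fun i => W (e i) ω).2).trans
        (norm_snd_le ((jet (q k) - Φ) fun i => W (e i) ω))).congr fun k => ?_
    refine eLpNorm_congr_ae ?_
    filter_upwards [(hval (ouPoly (q k))).coeFn_toLp] with ω hω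
    simp [hω, jet]

/-! ### The Malliavin derivative of polynomials and of their limits -/

theorem fderiv_eval_mul_comp_smul {n : ℕ} (q : MvPolynomial (Fin n) ℝ) {χ : (Fin n → ℝ) → ℝ}
    (hχ : Differentiable ℝ χ) (r : ℝ) (x v : Fin n → ℝ) :
    fderiv ℝ (fun x => MvPolynomial.eval x q * χ (r • x)) x v =
      (∑ i, MvPolynomial.eval x (MvPolynomial.pderiv i q) * v i) * χ (r • x) +
        MvPolynomial.eval x q * (r * fderiv ℝ χ (r • x) v) := by
  have d1 := hasFDerivAt_eval q x
  have d2 : HasFDerivAt (fun x => χ (r • x)) ((fderiv ℝ χ (r • x)).comp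
      (r • ContinuousLinearMap.id ℝ (Fin n → ℝ))) x :=
    (hχ (r • x)).hasFDerivAt.comp x ((hasFDerivAt_id x).const_smul r)
  rw [show fderiv ℝ (fun x => MvPolynomial.eval x q * χ (r • x)) x = _ from (d1.mul d2).fderiv]
  simp
  ring

/-- Multiply the polynomial by a cutoff `χ (r x)` and let `r` tend to zero. The extra derivative
term carries a factor `r`, and everything is dominated uniformly for `r ≤ 1`. -/
theorem exists_smoothFunctional_approx (hW : IsIsonormal W P) {n : ℕ} (e : Fin n → H)
    {p : ℝ≥0∞} (hp0 : p ≠ 0) (hp : p ≠ ∞) (q : MvPolynomial (Fin n) ℝ) {ε : ℝ≥0∞} (hε : ε ≠ 0) :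
    ∃ S : SmoothFunctional H,
      eLpNorm (S.val W - fun ω => MvPolynomial.eval (fun i => W (e i) ω) q) p P ≤ ε ∧
      eLpNorm (S.deriv W - fun ω => ∑ i, MvPolynomial.eval (fun i => W (e i) ω)
        (MvPolynomial.pderiv i q) • e i) p P ≤ ε := by
  obtain ⟨χ, hχs, hχc, hχ1, hχ0⟩ : ∃ χ : (Fin n → ℝ) → ℝ, ContDiff ℝ (⊤ : ℕ∞) χ ∧
      HasCompactSupport χ ∧ (∀ y, |χ y| ≤ 1) ∧ χ 0 = 1 := by
    let χ : ContDiffBump (0 : Fin n → ℝ) := ⟨1, 2, one_pos, one_lt_two⟩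
    exact ⟨χ, χ.contDiff, χ.hasCompactSupport, fun y => by
      rw [abs_of_nonneg χ.nonneg]; exact χ.le_one,
      χ.one_of_mem_closedBall (by simp [χ.rIn_pos.le])⟩
  obtain ⟨r, hrpos, hr1, hrlim⟩ : ∃ r : ℕ → ℝ, (∀ k, 0 < r k) ∧ (∀ k, r k ≤ 1) ∧
      Tendsto r atTop (𝓝 0) :=
    ⟨fun k => 1 / ((k : ℝ) + 1), fun k => by positivity, fun k => by
      rw [div_le_one (by positivity)]; linarith [(Nat.cast_nonneg k : (0 : ℝ) ≤ k)],
      tendsto_one_div_add_atTop_nhds_zero_nat⟩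
  set g : ℕ → (Fin n → ℝ) → ℝ := fun k x => MvPolynomial.eval x q * χ (r k • x) with hg
  have hsm : ∀ k, ContDiff ℝ (⊤ : ℕ∞) (g k) := fun k =>
    (contDiff_eval q).mul (hχs.comp (contDiff_const_smul (r k)))
  have hcs : ∀ k, HasCompactSupport (g k) := fun k =>
    HasCompactSupport.mul_left
      (hχc.comp_homeomorph (Homeomorph.smulOfNeZero (r k) (hrpos k).ne'))
  set S : ℕ → SmoothFunctional H := fun k => ⟨n, g k, hsm k, hcs k, e⟩ with hS
  have hfd : ∀ k x v, fderiv ℝ (g k) x v =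
      (∑ i, MvPolynomial.eval x (MvPolynomial.pderiv i q) * v i) * χ (r k • x) +
        MvPolynomial.eval x q * (r k * fderiv ℝ χ (r k • x) v) := by
    exact fun k x v => fderiv_eval_mul_comp_smul q (hχs.differentiable (by simp)) (r k) x v
  have hbd : ∀ i : Fin n, ∃ C, ∀ x, ‖fderiv ℝ χ x (Pi.single i 1)‖ ≤ C := fun i =>
    (hχc.fderiv_apply (𝕜 := ℝ) (Pi.single i 1)).exists_bound_of_continuous
      ((hχs.continuous_fderiv (by simp)).clm_apply continuous_const)
  choose C hC using hbd
  have hmem : ∀ q : MvPolynomial (Fin n) ℝ,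
      MemLp (fun ω => MvPolynomial.eval (fun i => W (e i) ω) q) p P := fun q =>
    memLp_eval (fun i _ hp => hW.memLp (e i) hp) q p hp
  have hχlim : ∀ x : Fin n → ℝ, Tendsto (fun k => χ (r k • x)) atTop (𝓝 1) := by
    intro x
    have h1 : Tendsto (fun k => r k • x) atTop (𝓝 0) := by simpa using hrlim.smul_const x
    have h2 := (hχs.continuous.tendsto 0).comp h1
    rwa [hχ0] at h2
  have hdlim : ∀ (x v : Fin n → ℝ), Tendsto (fun k => fderiv ℝ (g k) x v) atTop
      (𝓝 (∑ i, MvPolynomial.eval x (MvPolynomial.pderiv i q) * v i)) := by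
    intro x v
    simp only [hfd]
    have h1 : Tendsto (fun k => r k • x) atTop (𝓝 0) := by simpa using hrlim.smul_const x
    have h2 : Tendsto (fun k => fderiv ℝ χ (r k • x) v) atTop (𝓝 (fderiv ℝ χ 0 v)) :=
      (((hχs.continuous_fderiv (by simp)).clm_apply continuous_const).tendsto 0).comp h1
    simpa using ((hχlim x).const_mul
      (∑ i, MvPolynomial.eval x (MvPolynomial.pderiv i q) * v i)).add
        ((hrlim.mul h2).const_mul (MvPolynomial.eval x q))
  have hfam := measurable_family hW e
  have t1 := (tendsto_eLpNorm_of_dominated (μ := P) hp0 hp (F := fun k => (S k).val W)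
    (f := fun ω => MvPolynomial.eval (fun i => W (e i) ω) q)
    (B := fun ω => ‖MvPolynomial.eval (fun i => W (e i) ω) q‖)
    (fun k => ((hsm k).continuous.measurable.comp hfam).aestronglyMeasurable) (hmem q).norm
    (fun k ω => by
      change ‖MvPolynomial.eval _ q * χ _‖ ≤ _
      rw [norm_mul]
      exact mul_le_of_le_one_right (norm_nonneg _) (hχ1 _))
    (fun ω => by
      simpa [hS, SmoothFunctional.val, hg] using (hχlim fun i => W (e i) ω).const_mul
        (MvPolynomial.eval (fun i => W (e i) ω) q))).2
  have hpt : ∀ (x : Fin n → ℝ) (i : Fin n), ∑ j, MvPolynomial.eval x (MvPolynomial.pderiv j q) *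
      (Pi.single i 1 : Fin n → ℝ) j = MvPolynomial.eval x (MvPolynomial.pderiv i q) := by
    intro x i
    rw [Finset.sum_eq_single i (by intro j _ hj; simp [hj]) (by simp), Pi.single_eq_same, mul_one]
  have hle : ∀ k ω i, ‖fderiv ℝ (g k) (fun i => W (e i) ω) (Pi.single i 1)‖ ≤
      ‖MvPolynomial.eval (fun i => W (e i) ω) (MvPolynomial.pderiv i q)‖ +
        ‖MvPolynomial.eval (fun i => W (e i) ω) q‖ * C i := by
    intro k ω i
    rw [hfd, hpt]
    refine (norm_add_le _ _).trans (add_le_add ?_ ?_)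
    · rw [norm_mul]
      exact mul_le_of_le_one_right (norm_nonneg _) (hχ1 _)
    · rw [norm_mul, norm_mul]
      refine mul_le_mul_of_nonneg_left ?_ (norm_nonneg _)
      have hrk : ‖r k‖ ≤ 1 := by
        rw [Real.norm_of_nonneg (hrpos k).le]
        exact hr1 k
      exact (mul_le_of_le_one_left (norm_nonneg _) hrk).trans (hC i _)
  have hmeas : ∀ k, AEStronglyMeasurable ((S k).deriv W) P := by
    intro k
    refine Finset.aestronglyMeasurable_fun_sum _ fun i _ => ?_
    exact ((((hsm k).continuous_fderiv (by simp)).clm_apply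
      continuous_const).measurable.comp hfam).aestronglyMeasurable.smul_const _
  have hB : MemLp (fun ω => ∑ i, (‖MvPolynomial.eval (fun i => W (e i) ω)
      (MvPolynomial.pderiv i q)‖ + ‖MvPolynomial.eval (fun i => W (e i) ω) q‖ * C i) * ‖e i‖) p P :=
    memLp_finsetSum _ fun i _ => ((hmem _).norm.add ((hmem q).norm.mul_const _)).mul_const _
  have hbound : ∀ k ω, ‖(S k).deriv W ω‖ ≤ ∑ i, (‖MvPolynomial.eval (fun i => W (e i) ω)
      (MvPolynomial.pderiv i q)‖ + ‖MvPolynomial.eval (fun i => W (e i) ω) q‖ * C i) * ‖e i‖ := by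
    intro k ω
    refine norm_sum_le_of_le _ fun i _ => ?_
    rw [norm_smul]
    exact mul_le_mul_of_nonneg_right (hle k ω i) (norm_nonneg _)
  have hlim : ∀ ω, Tendsto (fun k => (S k).deriv W ω) atTop (𝓝 (∑ i,
      MvPolynomial.eval (fun i => W (e i) ω) (MvPolynomial.pderiv i q) • e i)) := by
    intro ω
    have hi : ∀ i, Tendsto (fun k => fderiv ℝ (g k) (fun i => W (e i) ω) (Pi.single i 1) • e i) atTop
        (𝓝 (MvPolynomial.eval (fun i => W (e i) ω) (MvPolynomial.pderiv i q) • e i)) := by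
      intro i
      have := hdlim (fun i => W (e i) ω) (Pi.single i 1)
      rw [hpt] at this
      exact this.smul_const (e i)
    have hs := tendsto_finsetSum (Finset.univ : Finset (Fin n)) fun i _ => hi i
    exact hs
  have t2 := (tendsto_eLpNorm_of_dominated (μ := P) hp0 hp hmeas hB hbound hlim).2
  have h1 := (tendsto_order.1 t1).2 ε (pos_iff_ne_zero.2 hε)
  have h2 := (tendsto_order.1 t2).2 ε (pos_iff_ne_zero.2 hε)
  obtain ⟨k, hk1, hk2⟩ := (h1.and h2).exists
  exact ⟨S k, hk1.le, hk2.le⟩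

theorem SmoothFunctional.aestronglyMeasurable_deriv (hW : IsIsonormal W P)
    (S : SmoothFunctional H) : AEStronglyMeasurable (S.deriv W) P := by
  refine Finset.aestronglyMeasurable_fun_sum _ fun i _ => ?_
  exact ((S.continuous_fderiv_apply _).measurable.comp
    (measurable_family hW S.φ)).aestronglyMeasurable.smul_const _

theorem InJetClosure.hasMalliavinDeriv (hW : IsIsonormal W P) {n : ℕ} (e : Fin n → H)
    {p : ℝ≥0∞} (hp1 : 1 ≤ p) (hp : p ≠ ∞) {Φ : (Fin n → ℝ) → ℝ × (Fin n → ℝ) × ℝ}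
    (h : InJetClosure (P.map fun ω i => W (e i) ω) p Φ) :
    HasMalliavinDeriv W P p (fun ω => (Φ fun i => W (e i) ω).1)
      fun ω => ∑ i, (Φ fun i => W (e i) ω).2.1 i • e i := by
  have hm := h.memLp_comp hW
  have hmi : ∀ i, MemLp (fun ω => (Φ fun i => W (e i) ω).2.1 i) p P := fun i =>
    memLp_pi_iff.1 hm.snd.fst i
  have hUm : MemLp (fun ω => ∑ i, (Φ fun i => W (e i) ω).2.1 i • e i) p P :=
    memLp_finsetSum _ fun i _ => ((hmi i).norm.mul_const ‖e i‖).mono'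
      ((hmi i).1.smul_const _) (by simp [norm_smul])
  obtain ⟨q, hq⟩ := h.exists_seq
  choose S hS1 hS2 using fun k : ℕ => exists_smoothFunctional_approx hW e (by positivity) hp (q k)
    (ε := ((k + 1 : ℕ) : ℝ≥0∞)⁻¹) (by simp)
  have hqm := fun q : MvPolynomial (Fin n) ℝ => (memLp_eval (fun i _ hp => hW.memLp (e i) hp) q p hp)
  set c : ℝ := ∑ i, ‖e i‖ with hc
  refine ⟨hm.fst, hUm, S, ?_, ?_⟩
  · have hl : Tendsto (fun k : ℕ => ((k + 1 : ℕ) : ℝ≥0∞)⁻¹ + ((k + 1 : ℕ) : ℝ≥0∞)⁻¹) atTop (𝓝 0) :=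
      by simpa using tendsto_inv_add_one.add tendsto_inv_add_one
    refine tendsto_of_tendsto_of_tendsto_of_le_of_le tendsto_const_nhds hl
      (fun _ => bot_le) fun k => ?_
    have e1 : ((S k).val W - fun ω => (Φ fun i => W (e i) ω).1) =
        ((S k).val W - fun ω => MvPolynomial.eval (fun i => W (e i) ω) (q k)) +
        fun ω => ((jet (q k) - Φ) fun i => W (e i) ω).1 := by
      funext ω; simp [jet]
    have b := eLpNorm_comp_le hW (p := p) ((InJetClosure.jet_aestronglyMeasurable (q k)).sub h.1.1)
      (f := fun ω => ((jet (q k) - Φ) fun i => W (e i) ω).1) 1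
      (fun ω => by simpa using norm_fst_le ((jet (q k) - Φ) fun i => W (e i) ω))
    rw [ENNReal.ofReal_one, one_mul] at b
    simp only
    rw [e1]
    refine (eLpNorm_add_le ?_ ?_ hp1).trans (add_le_add (hS1 k) (b.trans (hq k)))
    · exact (((S k).measurable_val W).mono (sigmaW_le hW) le_rfl).aestronglyMeasurable.sub
        (hqm _).1
    · exact (hqm _).1.sub hm.fst.1
  · have hl : Tendsto (fun k : ℕ => ((k + 1 : ℕ) : ℝ≥0∞)⁻¹ +
        ENNReal.ofReal c * ((k + 1 : ℕ) : ℝ≥0∞)⁻¹) atTop (𝓝 0) := by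
      simpa using tendsto_inv_add_one.add (ENNReal.Tendsto.const_mul tendsto_inv_add_one
        (Or.inr ENNReal.ofReal_ne_top))
    refine tendsto_of_tendsto_of_tendsto_of_le_of_le tendsto_const_nhds hl
      (fun _ => bot_le) fun k => ?_
    have e1 : ((S k).deriv W - fun ω => ∑ i, (Φ fun i => W (e i) ω).2.1 i • e i) =
        ((S k).deriv W - fun ω => ∑ i, MvPolynomial.eval (fun i => W (e i) ω)
          (MvPolynomial.pderiv i (q k)) • e i) +
        fun ω => ∑ i, ((jet (q k) - Φ) fun i => W (e i) ω).2.1 i • e i := by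
      funext ω
      simp [jet, sub_smul]
    have b := eLpNorm_comp_le hW (p := p) ((InJetClosure.jet_aestronglyMeasurable (q k)).sub h.1.1)
      (f := fun ω => ∑ i, ((jet (q k) - Φ) fun i => W (e i) ω).2.1 i • e i) c (fun ω => by
        rw [hc, Finset.sum_mul]
        refine norm_sum_le_of_le _ fun i _ => ?_
        rw [norm_smul, mul_comm]
        refine mul_le_mul_of_nonneg_left ?_ (norm_nonneg _)
        exact (norm_le_pi_norm _ i).trans ((norm_fst_le _).trans (norm_snd_le _)))
    have hd : ∀ q : MvPolynomial (Fin n) ℝ, AEStronglyMeasurable (fun ω =>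
        ∑ i, MvPolynomial.eval (fun i => W (e i) ω) (MvPolynomial.pderiv i q) • e i) P := fun q =>
      Finset.aestronglyMeasurable_fun_sum _ fun i _ => (hqm _).1.smul_const _
    simp only
    rw [e1]
    refine (eLpNorm_add_le ?_ ?_ hp1).trans (add_le_add (hS2 k)
      (b.trans (mul_le_mul_right (hq k) _)))
    · exact ((S k).aestronglyMeasurable_deriv hW).sub (hd _)
    · refine ((hd (q k)).sub hUm.1).congr (Eventually.of_forall fun ω => ?_)
      simp [jet, sub_smul]

theorem integral_eq_zero_of_hasOU (hW : IsIsonormal W P) {p : ℝ≥0∞} (hp : 1 < p) {G K : Ω → ℝ}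
    (h : HasOU W P p G K) : ∫ ω, K ω ∂P = 0 := by
  obtain ⟨hG, hK, X, Y, hX, hXY, hXl, hYl⟩ := h
  have l2 := tendsto_integral_mul_of_tendsto_eLpNorm hp (fun k => (Lp.memLp (Y k)).1) hK
    (fun r hr => memLp_polyVal hW 1 hr)
    (fun k => integrable_mul_polyVal hW (by norm_num) (Lp.memLp (Y k)) 1) hYl
  have h1 : MemLp (fun _ : Ω => (1 : ℝ)) 2 P := memLp_const 1
  have hv : h1.toLp _ ∈ wienerChaos W P 0 :=
    Submodule.le_topologicalClosure _ (Submodule.subset_span h1.coeFn_toLp)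
  have hz : ∀ k, ∫ ω, Y k ω * polyVal W 1 ω ∂P = 0 := by
    intro k
    have := inner_hasSum_chaos hW (fun n => Submodule.smul_mem _ _ (chaosComponent_mem n (X k)))
      (hXY k).2 hv
    rw [inner_eq_integral (ae_eq_refl _) h1.coeFn_toLp] at this
    simpa [polyVal] using this
  simp only [hz] at l2
  have := tendsto_nhds_unique l2 tendsto_const_nhds
  simpa [polyVal] using this

/-- The constant `C` must be the mean of `F` because images under `L` are centered. Recentering `u`
changes neither its gradient nor `L u`, and in an orthonormal system the inner product of the
derivatives is the dot product of the gradients. -/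
theorem isMalliavinBracket_of_inJetClosure (hW : IsIsonormal W P) {n : ℕ} {e : Fin n → H}
    (he : Orthonormal ℝ e) {p : ℝ≥0∞} (hp1 : 1 < p) (hp : p ≠ ∞)
    {f u Lf : (Fin n → ℝ) → ℝ} {Df Du : (Fin n → ℝ) → Fin n → ℝ} {C : ℝ}
    (hf : InJetClosure (P.map fun ω i => W (e i) ω) p fun x => (f x, Df x, Lf x))
    (hu : InJetClosure (P.map fun ω i => W (e i) ω) p fun x => (u x, Du x, -(f x - C))) :
    IsMalliavinBracket W P p (fun ω => f fun i => W (e i) ω) fun ω =>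
      ∑ i, Du (fun i => W (e i) ω) i * Df (fun i => W (e i) ω) i := by
  have hfm := (hf.memLp_comp hW).fst
  have hum := (hu.memLp_comp hW).fst
  have hC : ∫ ω, f (fun i => W (e i) ω) ∂P = C := by
    have := integral_eq_zero_of_hasOU hW hp1 (hu.hasOU hW he)
    simp only at this
    rw [integral_neg, integral_sub (hfm.integrable hp1.le) (integrable_const C)] at this
    simp at this
    linarith
  have : IsProbabilityMeasure (P.map fun ω i => W (e i) ω) :=
    Measure.isProbabilityMeasure_map (measurable_family hW e).aemeasurable
  set a : ℝ := ∫ ω, u (fun i => W (e i) ω) ∂P with ha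
  have hu' : InJetClosure (P.map fun ω i => W (e i) ω) p
      fun x => (u x - a, Du x, -(f x - C)) := by
    have h1 := hu.add hp1.le ((inJetClosure_jet (memLp_coord_map hW e) hp 1).const_smul (-a))
    convert h1 using 1
    funext x
    refine Prod.ext ?_ (Prod.ext ?_ ?_)
    · simp [jet, sub_eq_add_neg]
    · funext i; simp [jet]
    · simp [jet, ouPoly]
  refine ⟨fun ω => u (fun i => W (e i) ω) - a, fun ω => ∑ i, Du (fun i => W (e i) ω) i • e i,
    fun ω => ∑ i, Df (fun i => W (e i) ω) i • e i, ⟨?_, ?_⟩,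
    hu'.hasMalliavinDeriv hW e hp1.le hp, hf.hasMalliavinDeriv hW e hp1.le hp,
    Eventually.of_forall fun ω => ?_⟩
  · rw [integral_sub (hum.integrable hp1.le) (integrable_const a)]
    simp [ha]
  · rw [hC]
    exact hu'.hasOU hW he
  · simp only
    rw [he.inner_sum]
    simp

end

end Malliavin

namespace Malliavin

/-! ### Exponentials of polynomials -/

section

variable {ι : Type*} [Fintype ι] {γ : Measure (ι → ℝ)} {p : ℝ≥0∞}

/-- Expanding `exp (t ψ)` at once would require `exp (-t ψ)` in `L^p`, which can fail for quadratic
`ψ`. Advancing by `t / N` at a time only needs exponents slightly below zero. -/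
theorem inJetClosure_expJet_C_mul [IsFiniteMeasure γ]
    (hγ : ∀ i (p : ℝ≥0∞), p ≠ ∞ → MemLp (fun x => x i) p γ) (hp : 1 ≤ p) (hp' : p ≠ ∞)
    {ψ : MvPolynomial ι ℝ} {δ : ℝ} (hδ : 0 < δ)
    (hE : ∀ t, -δ ≤ t → t ≤ 1 → ExpMemLp γ p (MvPolynomial.C t * ψ)) {t : ℝ} (ht0 : 0 ≤ t)
    (ht1 : t ≤ 1) (q : MvPolynomial ι ℝ) :
    InJetClosure γ p (expJet (MvPolynomial.C t * ψ) q) := by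
  -- The step from `k` to `k + 1` uses the exponents `(k ± 1) t / N`. Only `k = 0` produces a
  -- negative one, and it is at least `-1/N ≥ -δ`.
  obtain ⟨N, hN⟩ := exists_nat_gt (1 / δ)
  have hNpos : (0 : ℝ) < N := (by positivity : (0 : ℝ) < 1 / δ).trans hN
  have hNδ : 1 / (N : ℝ) ≤ δ := by
    rw [div_lt_iff₀ hδ] at hN
    rw [div_le_iff₀ hNpos]
    linarith
  have htN : t / N ≤ 1 / N := div_le_div_of_nonneg_right ht1 hNpos.le
  have htN0 : 0 ≤ t / N := by positivity
  have key : ∀ k : ℕ, k ≤ N → ∀ q, InJetClosure γ p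
      (expJet (MvPolynomial.C (k * (t / N)) * ψ) q) := by
    intro k
    induction k with
    | zero =>
      intro _ q
      simpa [expJet_zero] using inJetClosure_jet hγ hp' q
    | succ k ih =>
      intro hk q
      have hk' : ((k : ℝ) + 1) ≤ N := by exact_mod_cast hk
      have e1 : MvPolynomial.C ((k : ℝ) * (t / N)) * ψ + MvPolynomial.C (t / N) * ψ =
          MvPolynomial.C (((k : ℝ) + 1) * (t / N)) * ψ := by
        rw [← add_mul, ← map_add]; congr 2; ring
      have e2 : MvPolynomial.C ((k : ℝ) * (t / N)) * ψ - MvPolynomial.C (t / N) * ψ =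
          MvPolynomial.C (((k : ℝ) - 1) * (t / N)) * ψ := by
        rw [← sub_mul, ← map_sub]; congr 2; ring
      have hub : ((k : ℝ) + 1) * (t / N) ≤ 1 := by
        calc ((k : ℝ) + 1) * (t / N) ≤ N * (t / N) := by gcongr
          _ = t := by field_simp
          _ ≤ 1 := ht1
      have hk0 : (0 : ℝ) ≤ k * (t / N) := by positivity
      have := inJetClosure_expJet_add hp hp' (ih (by omega))
        (by rw [e1]; exact hE _ (by linarith) hub)
        (by rw [e2]; exact hE _ (by linarith) (by linarith)) q
      rw [e1] at this
      push_cast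
      exact this
  have := key N le_rfl q
  rwa [mul_div_cancel₀ _ hNpos.ne'] at this

theorem memLp_one_add_exp_mul_abs {ψ : MvPolynomial ι ℝ} (h0 : ExpMemLp γ p 0)
    (h1 : ExpMemLp γ p ψ) (q : MvPolynomial ι ℝ) :
    MemLp (fun x => (1 + Real.exp (MvPolynomial.eval x ψ)) * |MvPolynomial.eval x q|) p γ := by
  refine ((h0 q).norm.add (h1 q).norm).ae_eq (Eventually.of_forall fun x => ?_)
  simp [add_mul]

end

section

variable {Ω : Type*} [MeasurableSpace Ω] {P : Measure Ω} [IsProbabilityMeasure P]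
  {H : Type*} [NormedAddCommGroup H] [InnerProductSpace ℝ H] {W : H → Ω → ℝ}

/-- The ansatz is that the Mehler transform of `exp ψ` is `θ v * exp (α v * ψ)`. The hypothesis
`hou` is `L M v = -v ∂_v M v` with the exponential cancelled, and `hβ` allows the gradient to be
divided by `v`. Both gradients are multiples of `∇ψ`, whence the factor `|∇ψ|²`. -/
theorem isMalliavinBracket_exp (hW : IsIsonormal W P) {n : ℕ} {e : Fin n → H}
    (he : Orthonormal ℝ e) {p : ℝ≥0∞} (hp1 : 1 < p) (hp : p ≠ ∞) {ψ : MvPolynomial (Fin n) ℝ}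
    {δ : ℝ} (hδ : 0 < δ)
    (hE : ∀ t, -δ ≤ t → t ≤ 1 → ExpMemLp (P.map fun ω i => W (e i) ω) p (MvPolynomial.C t * ψ))
    {θ θ' α α' β : ℝ → ℝ} (hα0 : α 0 = 0) (hα1 : α 1 = 1) (hθ1 : θ 1 = 1)
    (hα : ∀ v ∈ Set.Icc (0 : ℝ) 1, α v ∈ Set.Icc (0 : ℝ) 1)
    (hβ : ∀ v ∈ Set.Icc (0 : ℝ) 1, α v = v * β v)
    (hθd : ∀ v ∈ Set.Icc (0 : ℝ) 1, HasDerivAt θ (θ' v) v)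
    (hαd : ∀ v ∈ Set.Icc (0 : ℝ) 1, HasDerivAt α (α' v) v)
    (hθc : ContinuousOn θ' (Set.Icc 0 1)) (hαc : ContinuousOn α' (Set.Icc 0 1))
    (hβc : ContinuousOn β (Set.Icc 0 1))
    (hou : ∀ v ∈ Set.Icc (0 : ℝ) 1, ∀ x, θ v * (α v * MvPolynomial.eval x (ouPoly ψ) +
      α v ^ 2 * ∑ i, MvPolynomial.eval x (MvPolynomial.pderiv i ψ) ^ 2) =
        -(v * (θ' v + θ v * (α' v * MvPolynomial.eval x ψ)))) :
    IsMalliavinBracket W P p (fun ω => Real.exp (MvPolynomial.eval (fun i => W (e i) ω) ψ))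
      fun ω => (∑ i, MvPolynomial.eval (fun i => W (e i) ω) (MvPolynomial.pderiv i ψ) ^ 2) *
        Real.exp (MvPolynomial.eval (fun i => W (e i) ω) ψ) *
        ∫ v in (0 : ℝ)..1, θ v * β v * Real.exp (MvPolynomial.eval (fun i => W (e i) ω) ψ) ^ α v := by
  set γ := P.map fun ω i => W (e i) ω with hγd
  have : IsProbabilityMeasure γ :=
    Measure.isProbabilityMeasure_map (measurable_family hW e).aemeasurable
  have hγ : ∀ i (p : ℝ≥0∞), p ≠ ∞ → MemLp (fun x => x i) p γ := fun i p hp =>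
    memLp_coord_map hW e i p hp
  have hθcont : ContinuousOn θ (Set.Icc 0 1) := fun v hv => (hθd v hv).continuousAt.continuousWithinAt
  have hαcont : ContinuousOn α (Set.Icc 0 1) := fun v hv => (hαd v hv).continuousAt.continuousWithinAt
  have hcl := fun {t : ℝ} (h0 : 0 ≤ t) (h1 : t ≤ 1) => inJetClosure_expJet_C_mul hγ hp1.le hp hδ hE h0 h1
  have hE0 : ExpMemLp γ p 0 := by simpa using hE 0 (by linarith) zero_le_one
  have hE1 : ExpMemLp γ p ψ := by simpa using hE 1 (by linarith) le_rfl
  set M : ℝ → (Fin n → ℝ) → ℝ := fun v x => θ v * Real.exp (α v * MvPolynomial.eval x ψ) with hM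
  set M' : ℝ → (Fin n → ℝ) → ℝ := fun v x => (θ' v + θ v * (α' v * MvPolynomial.eval x ψ)) *
    Real.exp (α v * MvPolynomial.eval x ψ) with hM'
  set N : ℝ → (Fin n → ℝ) → Fin n → ℝ := fun v x =>
    (θ v * β v * Real.exp (α v * MvPolynomial.eval x ψ)) •
      fun i => MvPolynomial.eval x (MvPolynomial.pderiv i ψ) with hN
  obtain ⟨K1, hK1⟩ := isCompact_Icc.exists_bound_of_continuousOn hθc
  obtain ⟨K2, hK2⟩ := isCompact_Icc.exists_bound_of_continuousOn (hθcont.mul hαc)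
  obtain ⟨K3, hK3⟩ := isCompact_Icc.exists_bound_of_continuousOn (hθcont.mul hβc)
  have hz : (0 : ℝ) ∈ Set.Icc (0 : ℝ) 1 := by simp
  have hK1' : 0 ≤ K1 := (norm_nonneg _).trans (hK1 0 hz)
  have hK2' : 0 ≤ K2 := (norm_nonneg _).trans (hK2 0 hz)
  have hK3' : 0 ≤ K3 := (norm_nonneg _).trans (hK3 0 hz)
  set B : (Fin n → ℝ) → ℝ := fun x => K1 * ((1 + Real.exp (MvPolynomial.eval x ψ)) *
      |MvPolynomial.eval x (1 : MvPolynomial (Fin n) ℝ)|) +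
    K2 * ((1 + Real.exp (MvPolynomial.eval x ψ)) * |MvPolynomial.eval x ψ|) +
    ∑ i, K3 * ((1 + Real.exp (MvPolynomial.eval x ψ)) *
      |MvPolynomial.eval x (MvPolynomial.pderiv i ψ)|) with hB
  have hBm : MemLp B p γ := (((memLp_one_add_exp_mul_abs hE0 hE1 1).const_mul K1).add
    ((memLp_one_add_exp_mul_abs hE0 hE1 ψ).const_mul K2)).add
    (memLp_finsetSum _ fun i _ => (memLp_one_add_exp_mul_abs hE0 hE1 _).const_mul K3)
  -- Since `α v` stays in `[0, 1]`, this bound is uniform in `v` and lies in `L^p`.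
  have hexp : ∀ v ∈ Set.Icc (0 : ℝ) 1, ∀ x, Real.exp (α v * MvPolynomial.eval x ψ) ≤
      1 + Real.exp (MvPolynomial.eval x ψ) := by
    intro v hv x
    obtain ⟨a0, a1⟩ := hα v hv
    rcases le_total 0 (MvPolynomial.eval x ψ) with h | h
    · have : Real.exp (α v * MvPolynomial.eval x ψ) ≤ Real.exp (MvPolynomial.eval x ψ) :=
        Real.exp_le_exp.2 (mul_le_of_le_one_left h a1)
      linarith
    · have : Real.exp (α v * MvPolynomial.eval x ψ) ≤ 1 :=
        Real.exp_le_one_iff.2 (mul_nonpos_of_nonneg_of_nonpos a0 h)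
      linarith [Real.exp_pos (MvPolynomial.eval x ψ)]
  have hmain : ∃ u : (Fin n → ℝ) → ℝ, InJetClosure γ p fun x =>
      (u x, ∫ v in (0 : ℝ)..1, N v x, -(M 1 x - θ 0)) := by
    refine exists_inJetClosure_of_mehler hγ hp1.le hp (M' := M') (B := B)
      ?_ ?_ ?_ ?_ ?_ hBm ?_ ?_
    · intro v hv0 hv1
      have hv : v ∈ Set.Icc (0 : ℝ) 1 := ⟨hv0.le, hv1⟩
      have h1 := (hcl (hα v hv).1 (hα v hv).2 1).const_smul (θ v)
      convert h1 using 1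
      funext x
      refine Prod.ext ?_ (Prod.ext ?_ ?_)
      · simp [hM, expJet]
      · funext i
        simp [hN, expJet, hβ v hv]
        ring
      · have h2 : MvPolynomial.eval x (ouPoly (MvPolynomial.C (α v) * ψ)) =
            α v * MvPolynomial.eval x (ouPoly ψ) := by rw [ouPoly_C_mul]; simp
        have h3 : MvPolynomial.eval x (ouPoly (1 : MvPolynomial (Fin n) ℝ)) = 0 := by simp [ouPoly]
        have h4 := hou v hv x
        simp only [hM', expJet, Pi.smul_apply, Prod.smul_snd, smul_eq_mul, map_add, map_mul, h2, h3,
          map_sum, map_pow, MvPolynomial.pderiv_C_mul, MvPolynomial.eval_C, map_one,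
          MvPolynomial.pderiv_one, zero_mul, Finset.sum_const_zero, mul_zero, map_zero, zero_add,
          one_mul, mul_pow, ← Finset.mul_sum]
        linear_combination -(Real.exp (α v * MvPolynomial.eval x ψ)) * h4
    · intro x; simp [hM, hα0]
    · intro v hv x
      have h1 := (hθd v hv).mul (((hαd v hv).mul_const (MvPolynomial.eval x ψ)).exp)
      exact h1.congr_deriv (by simp only [hM']; ring)
    · intro x
      exact (hθc.add (hθcont.mul (hαc.mul continuousOn_const))).mul
        (Real.continuous_exp.comp_continuousOn (hαcont.mul continuousOn_const))
    · intro x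
      exact ((hθcont.mul hβc).mul
        (Real.continuous_exp.comp_continuousOn (hαcont.mul continuousOn_const))).smul
        continuousOn_const
    · intro v h0 h1 x
      have hv : v ∈ Set.Icc (0 : ℝ) 1 := ⟨h0, h1⟩
      have hs : 0 ≤ ∑ i, K3 * ((1 + Real.exp (MvPolynomial.eval x ψ)) *
        |MvPolynomial.eval x (MvPolynomial.pderiv i ψ)|) :=
        Finset.sum_nonneg fun i _ => by positivity
      calc |M' v x| = |θ' v + θ v * α' v * MvPolynomial.eval x ψ| *
            Real.exp (α v * MvPolynomial.eval x ψ) := by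
            rw [hM', abs_mul, Real.abs_exp, mul_assoc]
        _ ≤ (K1 + K2 * |MvPolynomial.eval x ψ|) * (1 + Real.exp (MvPolynomial.eval x ψ)) := by
            refine mul_le_mul ?_ (hexp v hv x) (Real.exp_pos _).le (by positivity)
            refine (abs_add_le _ _).trans (add_le_add (hK1 v hv) ?_)
            rw [abs_mul]
            exact mul_le_mul_of_nonneg_right (hK2 v hv) (abs_nonneg _)
        _ ≤ B x := by
            simp only [hB, map_one, abs_one, mul_one]
            linarith
    · intro v h0 h1 x
      have hv : v ∈ Set.Icc (0 : ℝ) 1 := ⟨h0, h1⟩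
      have hB0 : 0 ≤ B x := by simp only [hB]; positivity
      rw [pi_norm_le_iff_of_nonneg hB0]
      intro i
      calc ‖N v x i‖ = |θ v * β v| * (Real.exp (α v * MvPolynomial.eval x ψ) *
            |MvPolynomial.eval x (MvPolynomial.pderiv i ψ)|) := by
            simp only [hN, Pi.smul_apply, smul_eq_mul, Real.norm_eq_abs]
            rw [abs_mul, abs_mul, Real.abs_exp, mul_assoc]
        _ ≤ K3 * ((1 + Real.exp (MvPolynomial.eval x ψ)) *
            |MvPolynomial.eval x (MvPolynomial.pderiv i ψ)|) := by
            refine mul_le_mul (hK3 v hv) ?_ (by positivity) hK3'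
            exact mul_le_mul_of_nonneg_right (hexp v hv x) (abs_nonneg _)
        _ ≤ ∑ i, K3 * ((1 + Real.exp (MvPolynomial.eval x ψ)) *
            |MvPolynomial.eval x (MvPolynomial.pderiv i ψ)|) :=
            Finset.single_le_sum (f := fun i => K3 * ((1 + Real.exp (MvPolynomial.eval x ψ)) *
            |MvPolynomial.eval x (MvPolynomial.pderiv i ψ)|)) (fun i _ => by positivity)
              (Finset.mem_univ i)
        _ ≤ B x := by
            simp only [hB]
            have : 0 ≤ K1 * ((1 + Real.exp (MvPolynomial.eval x ψ)) *
              |MvPolynomial.eval x (1 : MvPolynomial (Fin n) ℝ)|) +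
              K2 * ((1 + Real.exp (MvPolynomial.eval x ψ)) * |MvPolynomial.eval x ψ|) := by
              positivity
            linarith
  obtain ⟨u, hu⟩ := hmain
  have hf : InJetClosure γ p fun x => (Real.exp (MvPolynomial.eval x ψ),
      fun i => Real.exp (MvPolynomial.eval x ψ) * MvPolynomial.eval x (MvPolynomial.pderiv i ψ),
      (expJet ψ 1 x).2.2) := by
    have h1 := hcl zero_le_one le_rfl 1
    simp only [map_one, one_mul] at h1
    convert h1 using 1
    funext x
    refine Prod.ext ?_ (Prod.ext ?_ rfl)
    · simp [expJet]
    · funext i; simp [expJet]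
  have hM1 : ∀ x, M 1 x = Real.exp (MvPolynomial.eval x ψ) := by
    intro x; simp [hM, hα1, hθ1]
  simp only [hM1] at hu
  have h := isMalliavinBracket_of_inJetClosure hW he hp1 hp hf hu
  convert h using 1
  funext ω
  simp only [hN, intervalIntegral.integral_smul_const, Pi.smul_apply, smul_eq_mul]
  simp only [← Real.exp_mul, mul_comm _ (α _)]
  rw [Finset.sum_mul, Finset.sum_mul]
  refine Finset.sum_congr rfl fun i _ => ?_
  ring

end

end Malliavin

namespace Malliavin

/-! ### The four families -/

section

variable {Ω : Type*} [MeasurableSpace Ω] {P : Measure Ω} [IsProbabilityMeasure P]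
  {H : Type*} [NormedAddCommGroup H] [InnerProductSpace ℝ H] {W : H → Ω → ℝ} {p : ℝ≥0∞}

theorem orthonormal_const_fin_one {h : H} (hh : ‖h‖ = 1) : Orthonormal ℝ fun _ : Fin 1 => h :=
  ⟨fun _ => hh, fun i j hij => (hij (Subsingleton.elim i j)).elim⟩

theorem pderiv_two {ι : Type*} (i : ι) : MvPolynomial.pderiv i (2 : MvPolynomial ι ℝ) = 0 := by
  rw [show (2 : MvPolynomial ι ℝ) = MvPolynomial.C 2 from (map_ofNat MvPolynomial.C 2).symm,
    MvPolynomial.pderiv_C]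

/-- First chaos: `(-L)⁻¹ F = F`, so the same jet serves for both arguments of the bracket. -/
theorem isMalliavinBracket_linear (hW : IsIsonormal W P) {h : H} (hh : ‖h‖ = 1) (c : ℝ)
    (hp1 : 1 < p) (hp : p ≠ ∞) :
    IsMalliavinBracket W P p (fun ω => c * W h ω) fun _ => c ^ 2 := by
  have he := orthonormal_const_fin_one hh
  have : IsProbabilityMeasure (P.map fun ω (_ : Fin 1) => W h ω) :=
    Measure.isProbabilityMeasure_map (measurable_family hW _).aemeasurable
  have hj := inJetClosure_jet (memLp_coord_map hW fun _ : Fin 1 => h) hp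
    (MvPolynomial.C c * MvPolynomial.X 0)
  have e1 : jet (MvPolynomial.C c * MvPolynomial.X 0 : MvPolynomial (Fin 1) ℝ) =
      fun x => (c * x 0, fun _ => c, -(c * x 0 - 0)) := by
    funext x
    refine Prod.ext ?_ (Prod.ext ?_ ?_)
    · simp [jet]
    · funext i
      rw [Subsingleton.elim i 0]
      simp [jet]
    · simp [jet, ouPoly, mul_comm]
  rw [e1] at hj
  have := isMalliavinBracket_of_inJetClosure hW he hp1 hp hj hj
  convert this using 1
  funext ω
  simp [sq]

theorem isMalliavinBracket_square (hW : IsIsonormal W P) {h : H} (hh : ‖h‖ = 1) (c : ℝ)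
    (hp1 : 1 < p) (hp : p ≠ ∞) :
    IsMalliavinBracket W P p (fun ω => c * (W h ω ^ 2 - 1))
      fun ω => 2 * c * (c * (W h ω ^ 2 - 1)) + 2 * c ^ 2 := by
  have he := orthonormal_const_fin_one hh
  have : IsProbabilityMeasure (P.map fun ω (_ : Fin 1) => W h ω) :=
    Measure.isProbabilityMeasure_map (measurable_family hW _).aemeasurable
  have e1 : ∀ b : ℝ, jet (MvPolynomial.C b * (MvPolynomial.X 0 ^ 2 - 1) : MvPolynomial (Fin 1) ℝ) =
      fun x => (b * (x 0 ^ 2 - 1), fun _ => 2 * b * x 0, -(2 * b * (x 0 ^ 2 - 1))) := by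
    intro b
    funext x
    refine Prod.ext ?_ (Prod.ext ?_ ?_)
    · simp [jet]
    · funext i
      rw [Subsingleton.elim i 0]
      simp [jet]
      ring
    · simp [jet, ouPoly, pderiv_two]
      ring
  have hj := fun b : ℝ => inJetClosure_jet (memLp_coord_map hW fun _ : Fin 1 => h) hp
    (MvPolynomial.C b * (MvPolynomial.X 0 ^ 2 - 1))
  simp only [e1] at hj
  -- In the second chaos `(-L)⁻¹` halves `F`, so the bracket is `½ (2 c W h)² = 2 c² (W h)²`.
  have hu := hj (c / 2)
  have e2 : (fun x : Fin 1 → ℝ => (c / 2 * (x 0 ^ 2 - 1), fun _ : Fin 1 => 2 * (c / 2) * x 0,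
      -(2 * (c / 2) * (x 0 ^ 2 - 1)))) = fun x => (c / 2 * (x 0 ^ 2 - 1), fun _ => c * x 0,
      -(c * (x 0 ^ 2 - 1) - 0)) := by
    funext x
    simp only [Prod.mk.injEq]
    exact ⟨trivial, by funext; ring, by ring⟩
  rw [e2] at hu
  have := isMalliavinBracket_of_inJetClosure hW he hp1 hp (hj c) hu
  convert this using 1
  funext ω
  simp
  ring

theorem expMemLp_linear (hW : IsIsonormal W P) (h : H) (c : ℝ) (hp : p ≠ ∞) :
    ExpMemLp (P.map fun ω (_ : Fin 1) => W h ω) p (MvPolynomial.C c * MvPolynomial.X 0) := by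
  have : IsProbabilityMeasure (P.map fun ω (_ : Fin 1) => W h ω) :=
    Measure.isProbabilityMeasure_map (measurable_family hW _).aemeasurable
  refine expMemLp_of_memLp (memLp_coord_map hW fun _ : Fin 1 => h) (p' := p + 1)
    (ENNReal.lt_add_right hp one_ne_zero) ?_
  refine (memLp_map_measure_iff (continuous_eval _).measurable.exp.aestronglyMeasurable
    (measurable_family hW _).aemeasurable).2 ?_
  convert hW.memLp_exp_mul c h (p := p + 1) (by simp [hp]) using 1
  funext ω
  simp

/-- The Mehler transform of `exp (c x)` is `exp (c²(1 - v²)/2) exp (v c x)`, which gives `θ`, `α v =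
v` and `β = 1`. -/
theorem isMalliavinBracket_exp_linear (hW : IsIsonormal W P) {h : H} (hh : ‖h‖ = 1) (c : ℝ)
    (hp1 : 1 < p) (hp : p ≠ ∞) :
    IsMalliavinBracket W P p (fun ω => Real.exp (c * W h ω)) fun ω =>
      c ^ 2 * Real.exp (c * W h ω) * ∫ v in (0 : ℝ)..1,
        Real.exp (c * W h ω) ^ v * Real.exp (c ^ 2 / 2 * (1 - v ^ 2)) := by
  have hθd : ∀ v : ℝ, HasDerivAt (fun v => Real.exp (c ^ 2 / 2 * (1 - v ^ 2)))
      (Real.exp (c ^ 2 / 2 * (1 - v ^ 2)) * (-(c ^ 2 * v))) v := by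
    intro v
    refine (((((hasDerivAt_id v).pow 2).const_sub 1).const_mul (c ^ 2 / 2)).exp).congr_deriv ?_
    simp
    ring
  have := isMalliavinBracket_exp hW (orthonormal_const_fin_one hh) hp1 hp
    (ψ := MvPolynomial.C c * MvPolynomial.X 0) one_pos
    (fun t _ _ => by
      rw [← mul_assoc, ← map_mul]
      exact expMemLp_linear hW h (t * c) hp)
    (θ := fun v => Real.exp (c ^ 2 / 2 * (1 - v ^ 2)))
    (θ' := fun v => Real.exp (c ^ 2 / 2 * (1 - v ^ 2)) * (-(c ^ 2 * v)))
    (α := fun v => v) (α' := fun _ => 1) (β := fun _ => 1) rfl rfl (by simp) (fun v hv => hv)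
    (fun v _ => (mul_one v).symm) (fun v _ => hθd v) (fun v _ => hasDerivAt_id v)
    (by fun_prop) (by fun_prop) (by fun_prop)
    (fun v _ x => by
      simp [ouPoly]
      ring)
  convert this using 1
  · simp
  · funext ω
    simp [mul_comm]

/-! #### Exponentials of sums of squares -/

theorem integrable_exp_mul_sq_gaussianReal_iff (r : ℝ) :
    Integrable (fun x => Real.exp (r * x ^ 2)) (gaussianReal 0 1) ↔ r < 1 / 2 := by
  rw [gaussianReal_of_var_ne_zero 0 one_ne_zero, integrable_withDensity_iff_integrable_smul'
    (measurable_gaussianPDF 0 1) (Eventually.of_forall fun x => gaussianPDF_lt_top)]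
  have : (fun x => (gaussianPDF 0 1 x).toReal • Real.exp (r * x ^ 2)) =
      fun x => (√(2 * Real.pi))⁻¹ * Real.exp (-(1 / 2 - r) * x ^ 2) := by
    funext x
    rw [toReal_gaussianPDF, gaussianPDFReal, smul_eq_mul, mul_assoc, ← Real.exp_add,
      NNReal.coe_one]
    ring_nf
  rw [this, integrable_const_mul_iff, integrable_exp_neg_mul_sq_iff]
  · exact sub_pos
  · exact (inv_pos.2 (by positivity)).ne'.isUnit

theorem memLp_exp_sum_sq (hW : IsIsonormal W P) {n : ℕ} {e : Fin n → H} (he : Orthonormal ℝ e)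
    (hp0 : p ≠ 0) (hp : p ≠ ∞) {b : ℝ} (hb : p.toReal * b < 1 / 2) :
    MemLp (fun x => Real.exp (MvPolynomial.eval x (MvPolynomial.C b * ∑ i, MvPolynomial.X i ^ 2)))
      p (P.map fun ω i => W (e i) ω) := by
  rw [memLp_exp_of_integrable (continuous_eval _).measurable.aemeasurable hp0 hp,
    map_orthonormal_eq_pi hW he]
  have := Integrable.fintype_prod (μ := fun _ : Fin n => gaussianReal 0 1)
    (f := fun _ x => Real.exp (p.toReal * b * x ^ 2))
    fun _ => (integrable_exp_mul_sq_gaussianReal_iff _).2 hb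
  refine this.congr (Eventually.of_forall fun x => ?_)
  simp only [← Real.exp_sum, map_mul, map_sum, map_pow, MvPolynomial.eval_X, MvPolynomial.eval_C,
    Finset.mul_sum, mul_assoc]

/-- The integrability condition is open in the exponent, which leaves room for the polynomial
factors. -/
theorem exists_gt_mul_lt {a b : ℝ} (h : a * b < 1 / 2) : ∃ a', a < a' ∧ a' * b < 1 / 2 := by
  have : Tendsto (fun x : ℝ => x * b) (𝓝[>] a) (𝓝 (a * b)) :=
    ((continuous_id.mul continuous_const).tendsto a).mono_left nhdsWithin_le_nhds
  obtain ⟨x, h1, h2⟩ := ((this.eventually_lt_const h).and self_mem_nhdsWithin).exists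
  exact ⟨x, h2, h1⟩

theorem expMemLp_sum_sq (hW : IsIsonormal W P) {n : ℕ} {e : Fin n → H} (he : Orthonormal ℝ e)
    (hp : p ≠ ∞) {b : ℝ} (hb : p.toReal * b < 1 / 2) :
    ExpMemLp (P.map fun ω i => W (e i) ω) p (MvPolynomial.C b * ∑ i, MvPolynomial.X i ^ 2) := by
  have : IsProbabilityMeasure (P.map fun ω i => W (e i) ω) :=
    Measure.isProbabilityMeasure_map (measurable_family hW _).aemeasurable
  obtain ⟨r, hr, hrb⟩ := exists_gt_mul_lt hb
  have hpr : p < ENNReal.ofReal r := (ENNReal.lt_ofReal_iff_toReal_lt hp).2 hr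
  refine expMemLp_of_memLp (memLp_coord_map hW e) hpr (memLp_exp_sum_sq hW he
    (bot_le.trans_lt hpr).ne' ENNReal.ofReal_ne_top ?_)
  rwa [ENNReal.toReal_ofReal (ENNReal.toReal_nonneg.trans hr.le)]

/-- For `c > 0` the variable dominates the exponential of a single square, whose integrability is
decided exactly by the Gaussian integral. At least one square must be present, as otherwise `F = 1`
lies in every `L^p`. -/
theorem toReal_mul_lt_of_memLp (hW : IsIsonormal W P) {n : ℕ} {e : Fin n → H}
    (he : Orthonormal ℝ e) (hn : n ≠ 0) (hp0 : p ≠ 0) (hp : p ≠ ∞) {c : ℝ}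
    (h : MemLp (fun ω => Real.exp (c * ∑ i, W (e i) ω ^ 2)) p P) : p.toReal * c < 1 / 2 := by
  rcases le_or_gt c 0 with hc | hc
  · have := mul_nonpos_of_nonneg_of_nonpos (ENNReal.toReal_nonneg (a := p)) hc
    linarith
  let i : Fin n := ⟨0, Nat.pos_of_ne_zero hn⟩
  have hm : Measurable fun ω => c * W (e i) ω ^ 2 := ((hW.measurable (e i)).pow_const 2).const_mul c
  have h1 : MemLp (fun ω => Real.exp (c * W (e i) ω ^ 2)) p P := by
    refine h.mono' hm.exp.aestronglyMeasurable (Eventually.of_forall fun ω => ?_)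
    rw [Real.norm_eq_abs, Real.abs_exp]
    refine Real.exp_le_exp.2 (mul_le_mul_of_nonneg_left ?_ hc.le)
    exact Finset.single_le_sum (f := fun i => W (e i) ω ^ 2) (fun i _ => sq_nonneg _)
      (Finset.mem_univ i)
  rw [memLp_exp_of_integrable hm.aemeasurable hp0 hp] at h1
  rw [← integrable_exp_mul_sq_gaussianReal_iff, ← hW.map_eq_of_norm (he.1 i),
    integrable_map_measure (by fun_prop) (hW.measurable _).aemeasurable]
  refine h1.congr (Eventually.of_forall fun ω => ?_)
  simp [mul_assoc]

theorem eval_C_mul_sum_sq {ι : Type*} [Fintype ι] (c : ℝ) (x : ι → ℝ) :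
    MvPolynomial.eval x (MvPolynomial.C c * ∑ i, MvPolynomial.X i ^ 2) = c * ∑ i, x i ^ 2 := by
  simp

theorem pderiv_C_mul_sum_sq {ι : Type*} [Fintype ι] (c : ℝ) (i : ι) :
    MvPolynomial.pderiv i (MvPolynomial.C c * ∑ j, MvPolynomial.X j ^ 2) =
      MvPolynomial.C (2 * c) * MvPolynomial.X i := by
  classical
  rw [MvPolynomial.pderiv_C_mul, map_sum, Finset.sum_eq_single i]
  · simp only [MvPolynomial.pderiv_pow, MvPolynomial.pderiv_X_self, map_mul, map_ofNat]
    ring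
  · intro j _ hj
    simp [MvPolynomial.pderiv_X_of_ne hj]
  · simp

theorem eval_ouPoly_C_mul_sum_sq {n : ℕ} (c : ℝ) (x : Fin n → ℝ) :
    MvPolynomial.eval x (ouPoly (MvPolynomial.C c * ∑ i, MvPolynomial.X i ^ 2)) =
      2 * c * n - 2 * c * ∑ i, x i ^ 2 := by
  have : ∀ i, MvPolynomial.pderiv i (MvPolynomial.pderiv i
      (MvPolynomial.C c * ∑ j : Fin n, MvPolynomial.X j ^ 2)) = MvPolynomial.C (2 * c) := by
    intro i
    rw [pderiv_C_mul_sum_sq, MvPolynomial.pderiv_C_mul, MvPolynomial.pderiv_X_self, mul_one]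
  simp_rw [ouPoly, this, pderiv_C_mul_sum_sq, map_sum, map_sub, map_mul, MvPolynomial.eval_C,
    MvPolynomial.eval_X]
  rw [Finset.sum_sub_distrib, Finset.mul_sum]
  congr 1
  · simp [mul_comm]
  · exact Finset.sum_congr rfl fun i _ => by ring

/-- In each coordinate, `E exp (c (v x + √(1 - v²) Z)²) = m^{-1/2} exp (c v² x² / m)` with `m = 1 -
2c(1 - v²)`. The product over coordinates gives `θ = m^{-n/2}`, `α = v²/m` and `β = v/m`. -/
theorem isMalliavinBracket_exp_sum_sq (hW : IsIsonormal W P) {n : ℕ} {e : Fin n → H}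
    (he : Orthonormal ℝ e) (hp1 : 1 < p) (hp : p ≠ ∞) {c : ℝ} (hc : c < 1 / 2)
    (hpc : p.toReal * c < 1 / 2) :
    IsMalliavinBracket W P p (fun ω => Real.exp (c * ∑ k, W (e k) ω ^ 2)) fun ω =>
      4 * c * Real.exp (c * ∑ k, W (e k) ω ^ 2) * Real.log (Real.exp (c * ∑ k, W (e k) ω ^ 2)) *
        ∫ v in (0 : ℝ)..1, v * Real.exp (c * ∑ k, W (e k) ω ^ 2) ^
          (v ^ 2 / (1 - 2 * c * (1 - v ^ 2))) / (1 - 2 * c * (1 - v ^ 2)) ^ ((n : ℝ) / 2 + 1) := by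
  set m : ℝ → ℝ := fun v => 1 - 2 * c * (1 - v ^ 2) with hm
  have hmpos : ∀ v ∈ Set.Icc (0 : ℝ) 1, 0 < m v := by
    rintro v ⟨h0, h1⟩
    have : v ^ 2 ≤ 1 := pow_le_one₀ h0 h1
    simp only [hm]
    rcases le_total c 0 with h | h
    · nlinarith
    · nlinarith [mul_nonneg h (sq_nonneg v)]
  have hmd : ∀ v, HasDerivAt m (4 * c * v) v := by
    intro v
    refine ((((((hasDerivAt_id v).pow 2).const_sub 1).const_mul (2 * c))).const_sub 1).congr_deriv ?_
    simp
    ring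
  have hmc : Continuous m := by fun_prop
  have hm0 : ∀ v ∈ Set.Icc (0 : ℝ) 1, m v ≠ 0 := fun v hv => (hmpos v hv).ne'
  -- For `c < 0` the exponential of `-δ ψ` grows; the chosen `δ` satisfies `p δ |c| < 1/2`.
  obtain ⟨δ, hδ, hδc⟩ : ∃ δ : ℝ, 0 < δ ∧ p.toReal * (-δ * c) < 1 / 2 := by
    refine ⟨1 / (2 * (p.toReal * |c| + 1)), by positivity, ?_⟩
    have h1 : p.toReal * (-(1 / (2 * (p.toReal * |c| + 1))) * c) ≤
        (p.toReal * |c|) / (2 * (p.toReal * |c| + 1)) := by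
      rw [one_div, div_eq_mul_inv]
      have := mul_le_mul_of_nonneg_left (neg_le_abs c) (by positivity :
        0 ≤ p.toReal * (2 * (p.toReal * |c| + 1))⁻¹)
      linarith
    refine h1.trans_lt ?_
    rw [div_lt_div_iff₀ (by positivity) (by positivity)]
    linarith
  have h := isMalliavinBracket_exp hW he hp1 hp
    (ψ := MvPolynomial.C c * ∑ i, MvPolynomial.X i ^ 2) hδ
    (fun t ht0 ht1 => by
      rw [← mul_assoc, ← map_mul]
      refine expMemLp_sum_sq hW he hp ?_
      have hp0 := ENNReal.toReal_nonneg (a := p)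
      rcases le_total 0 c with h | h
      · exact (mul_le_mul_of_nonneg_left (mul_le_of_le_one_left h ht1) hp0).trans_lt hpc
      · exact (mul_le_mul_of_nonneg_left (mul_le_mul_of_nonpos_right ht0 h) hp0).trans_lt hδc)
    (θ := fun v => m v ^ (-((n : ℝ) / 2)))
    (θ' := fun v => 4 * c * v * (-((n : ℝ) / 2)) * m v ^ (-((n : ℝ) / 2) - 1))
    (α := fun v => v ^ 2 / m v) (α' := fun v => 2 * v * (1 - 2 * c) / m v ^ 2)
    (β := fun v => v / m v) (by simp) (by simp [hm]) (by simp [hm])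
    (fun v hv => by
      refine ⟨by have := hmpos v hv; positivity, ?_⟩
      rw [div_le_one (hmpos v hv)]
      have : v ^ 2 ≤ 1 := pow_le_one₀ hv.1 hv.2
      simp only [hm]
      nlinarith)
    (fun v _ => by ring)
    (fun v hv => (hmd v).rpow_const (Or.inl (hm0 v hv)))
    (fun v hv => by
      refine (((hasDerivAt_id v).pow 2).div (hmd v) (hm0 v hv)).congr_deriv ?_
      simp [hm]
      ring)
    ((by fun_prop : Continuous fun v : ℝ => 4 * c * v * (-((n : ℝ) / 2))).continuousOn.mul
      (hmc.continuousOn.rpow_const fun v hv => Or.inl (hm0 v hv)))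
    ((by fun_prop : Continuous fun v : ℝ => 2 * v * (1 - 2 * c)).continuousOn.div
      (hmc.pow 2).continuousOn fun v hv => pow_ne_zero 2 (hm0 v hv))
    (continuousOn_id.div hmc.continuousOn hm0)
    (fun v hv x => by
      have hmv := hm0 v hv
      simp only [eval_C_mul_sum_sq, eval_ouPoly_C_mul_sum_sq, pderiv_C_mul_sum_sq]
      simp only [map_mul, MvPolynomial.eval_C, MvPolynomial.eval_X, mul_pow, ← Finset.mul_sum]
      rw [Real.rpow_sub_one hmv]
      field_simp
      simp only [hm]
      ring)
  convert h using 1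
  · simp
  · funext ω
    -- The logarithm in the formula comes from `|∇ψ|² = 4 c² ∑ xᵢ² = 4 c ψ = 4 c log F`, and the
    -- power `n/2 + 1` from `θ β`.
    simp only [eval_C_mul_sum_sq, pderiv_C_mul_sum_sq, Real.log_exp]
    simp only [map_mul, MvPolynomial.eval_C, MvPolynomial.eval_X, mul_pow, ← Finset.mul_sum]
    have : ∀ v ∈ Set.uIcc (0 : ℝ) 1, v * Real.exp (c * ∑ k, W (e k) ω ^ 2) ^ (v ^ 2 / m v) /
        m v ^ ((n : ℝ) / 2 + 1) = m v ^ (-((n : ℝ) / 2)) * (v / m v) *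
          Real.exp (c * ∑ k, W (e k) ω ^ 2) ^ (v ^ 2 / m v) := by
      intro v hv
      rw [Set.uIcc_of_le zero_le_one] at hv
      rw [Real.rpow_add_one (hm0 v hv), Real.rpow_neg (hmpos v hv).le]
      have := hm0 v hv
      have := (Real.rpow_pos_of_pos (hmpos v hv) ((n : ℝ) / 2)).ne'
      field_simp
    rw [intervalIntegral.integral_congr this]
    ring

end

end Malliavin

namespace Malliavin

/-! ### Existence, measurability and the formulas -/

theorem measurable_intervalIntegral_right {f : ℝ → ℝ → ℝ} (hf : Measurable (Function.uncurry f))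
    (a b : ℝ) : Measurable fun y => ∫ v in a..b, f y v := by
  simp only [intervalIntegral]
  exact (hf.stronglyMeasurable.integral_prod_right (ν := volume.restrict _)).measurable.sub
    (hf.stronglyMeasurable.integral_prod_right (ν := volume.restrict _)).measurable

section

variable {Ω : Type*} [MeasurableSpace Ω] {P : Measure Ω} [IsProbabilityMeasure P]
  {H : Type*} [NormedAddCommGroup H] [InnerProductSpace ℝ H] {W : H → Ω → ℝ} {p : ℝ≥0∞}

theorem Family.exists_measurable {F R : Ω → ℝ} (h : Family W F R) :
    ∃ r : ℝ → ℝ, Measurable r ∧ R = fun ω => r (F ω) := by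
  cases h with
  | linear c h hh F hF => exact ⟨fun _ => c ^ 2, measurable_const, rfl⟩
  | square c h hh F hF => exact ⟨fun y => 2 * c * y + 2 * c ^ 2, by fun_prop, rfl⟩
  | exp c h hh F hF =>
    refine ⟨fun y => c ^ 2 * y * ∫ v in (0 : ℝ)..1, y ^ v * Real.exp (c ^ 2 / 2 * (1 - v ^ 2)),
      (by fun_prop : Measurable fun y : ℝ => c ^ 2 * y).mul
        (measurable_intervalIntegral_right ?_ 0 1), rfl⟩
    exact (measurable_fst.pow measurable_snd).mul (by fun_prop)
  | expSquares n c hc h hh F hF =>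
    refine ⟨fun y => 4 * c * y * Real.log y * ∫ v in (0 : ℝ)..1,
      v * y ^ (v ^ 2 / (1 - 2 * c * (1 - v ^ 2))) / (1 - 2 * c * (1 - v ^ 2)) ^ ((n : ℝ) / 2 + 1),
      (by fun_prop : Measurable fun y : ℝ => 4 * c * y * Real.log y).mul
        (measurable_intervalIntegral_right ?_ 0 1), rfl⟩
    have h1 : Measurable fun z : ℝ × ℝ => z.2 ^ 2 / (1 - 2 * c * (1 - z.2 ^ 2)) := by fun_prop
    have h2 : Measurable fun z : ℝ × ℝ => 1 - 2 * c * (1 - z.2 ^ 2) := by fun_prop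
    exact (measurable_snd.mul (measurable_fst.pow h1)).div (h2.pow_const _)

theorem Family.exists_memLp (hW : IsIsonormal W P) {F R : Ω → ℝ} (h : Family W F R) :
    ∃ p : ℝ≥0∞, 1 < p ∧ p ≠ ∞ ∧ MemLp F p P := by
  cases h with
  | linear c h hh F hF =>
    subst hF
    exact ⟨2, by simp, by simp, (hW.memLp h (by simp)).const_mul c⟩
  | square c h hh F hF =>
    subst hF
    refine ⟨2, by simp, by simp, MemLp.const_mul (MemLp.sub ?_ (memLp_const 1)) c⟩
    have := memLp_eval (fun (_ : Fin 1) _ hp => hW.memLp h hp) (MvPolynomial.X 0 ^ 2) (μ := P) 2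
      (by simp)
    simpa using this
  | exp c h hh F hF =>
    subst hF
    exact ⟨2, by simp, by simp, hW.memLp_exp_mul c h (by simp)⟩
  | expSquares n c hc h hh F hF =>
    subst hF
    obtain ⟨r, hr, hrc⟩ := exists_gt_mul_lt (a := 1) (by simpa using hc)
    have hr0 : (0 : ℝ) ≤ r := by linarith
    have h1 : 1 < ENNReal.ofReal r := by simpa using hr
    refine ⟨ENNReal.ofReal r, h1, ENNReal.ofReal_ne_top, ?_⟩
    have := (memLp_map_measure_iff (continuous_eval _).measurable.exp.aestronglyMeasurable
      (measurable_family hW h).aemeasurable).1 (memLp_exp_sum_sq hW hh (bot_le.trans_lt h1).ne'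
        ENNReal.ofReal_ne_top (b := c) (by rwa [ENNReal.toReal_ofReal hr0]))
    refine this.ae_eq (Eventually.of_forall fun ω => ?_)
    simp

theorem Family.isMalliavinBracket (hW : IsIsonormal W P) {F R : Ω → ℝ} (h : Family W F R)
    (hp1 : 1 < p) (hp : p ≠ ∞) (hF : MemLp F p P) : IsMalliavinBracket W P p F R := by
  cases h with
  | linear c h hh F hF' =>
    subst hF'
    exact isMalliavinBracket_linear hW hh c hp1 hp
  | square c h hh F hF' =>
    subst hF'
    exact isMalliavinBracket_square hW hh c hp1 hp
  | exp c h hh F hF' =>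
    subst hF'
    exact isMalliavinBracket_exp_linear hW hh c hp1 hp
  | expSquares n c hc h hh F hF' =>
    subst hF'
    -- With no squares `F = 1`, and membership in `L^p` puts no bound on `p c`. Both sides of the
    -- formula are then zero, since `log 1 = 0`.
    rcases Nat.eq_zero_or_pos n with rfl | hn
    · have : IsProbabilityMeasure (P.map fun ω i => W (h i) ω) :=
        Measure.isProbabilityMeasure_map (measurable_family hW _).aemeasurable
      have e : ∀ b : ℝ, jet (MvPolynomial.C b : MvPolynomial (Fin 0) ℝ) =
          fun x => (b, 0, -((1 : ℝ) - 1)) := by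
        intro b
        funext x
        simp only [jet, ouPoly, MvPolynomial.eval_C, sub_self, neg_zero, Prod.mk.injEq]
        exact ⟨trivial, Subsingleton.elim _ _, by simp⟩
      have hj := fun b : ℝ => inJetClosure_jet (memLp_coord_map hW h) hp (MvPolynomial.C b)
      simp only [e] at hj
      have := isMalliavinBracket_of_inJetClosure hW hh hp1 hp (hj 1) (hj 0)
      convert this using 1
      · simp
      · simp
    · exact isMalliavinBracket_exp_sum_sq hW hh hp1 hp hc
        (toReal_mul_lt_of_memLp hW hh hn.ne' (zero_lt_one.trans hp1).ne' hp hF)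

theorem Family.bracket_formula [TopologicalSpace.SeparableSpace H] (hW : IsIsonormal W P)
    {F R : Ω → ℝ} (h : Family W F R) (hp1 : 1 < p) (hp : p ≠ ∞) (hF : MemLp F p P) :
    (∃ Γ : Ω → ℝ, IsMalliavinBracket W P p F Γ) ∧
      ∀ Γ : Ω → ℝ, IsMalliavinBracket W P p F Γ →
        AEStronglyMeasurable[MeasurableSpace.comap F (borel ℝ)] Γ P ∧ Γ =ᵐ[P] R := by
  have hR := h.isMalliavinBracket hW hp1 hp hF
  refine ⟨⟨R, hR⟩, fun Γ hΓ => ?_⟩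
  have hae := hΓ.ae_eq hW hp1 hR
  obtain ⟨r, hr, hRr⟩ := h.exists_measurable
  refine ⟨⟨R, ?_, hae⟩, hae⟩
  rw [hRr]
  refine Measurable.stronglyMeasurable ?_
  refine hr.comp ?_
  rw [BorelSpace.measurable_eq (α := ℝ)]
  exact comap_measurable F

end

end Malliavin

namespace Malliavin

/-! ### The laws -/

theorem map_withDensity_of_bijOn {s t : Set ℝ} (hs : MeasurableSet s) {φ φ' : ℝ → ℝ}
    (hφ : Measurable φ) (hd : ∀ x ∈ s, HasDerivAt φ (φ' x) x) (hb : Set.BijOn φ s t)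
    {f g : ℝ → ℝ≥0∞}
    (hfg : ∀ x ∈ s, f x = ENNReal.ofReal |φ' x| * g (φ x)) :
    ((volume.restrict s).withDensity f).map φ = (volume.restrict t).withDensity g := by
  ext A hA
  have hφA := hφ hA
  rw [Measure.map_apply hφ hA, withDensity_apply _ hφA, withDensity_apply _ hA,
    ← lintegral_indicator hφA, ← lintegral_indicator hA, ← hb.image_eq,
    lintegral_image_eq_lintegral_abs_deriv_mul hs (fun x hx => (hd x hx).hasDerivWithinAt) hb.injOn]
  refine setLIntegral_congr_fun hs fun x hx => ?_
  by_cases h : φ x ∈ A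
  · simp [Set.indicator, h, hfg x hx]
  · simp [Set.indicator, h]

theorem withDensity_restrict_eq {s : Set ℝ} (hs : MeasurableSet s) {f : ℝ → ℝ≥0∞}
    (hf : ∀ᵐ x, x ∉ s → f x = 0) : (volume.restrict s).withDensity f = volume.withDensity f := by
  rw [← withDensity_indicator hs]
  refine withDensity_congr_ae ?_
  filter_upwards [hf] with x hx
  by_cases h : x ∈ s
  · simp [h]
  · simp [h, hx h]

/-- Each open half-line is mapped bijectively onto `(0, ∞)` and contributes half of the Gamma
density; the origin is a null set. -/
theorem gaussianReal_map_const_mul_sq {c : ℝ} (hc : 0 < c) :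
    (gaussianReal 0 1).map (fun x => c * x ^ 2) = gammaMeasure (1 / 2) (1 / (2 * c)) := by
  have hm : Measurable fun x : ℝ => c * x ^ 2 := by fun_prop
  have hsplit : gaussianReal 0 1 = (volume.restrict (Set.Ioi 0)).withDensity (gaussianPDF 0 1) +
      (volume.restrict (Set.Iio 0)).withDensity (gaussianPDF 0 1) := by
    rw [gaussianReal_of_var_ne_zero 0 one_ne_zero, ← withDensity_add_measure,
      restrict_Iio_eq_restrict_Iic, add_comm, ← Set.compl_Iic,
      Measure.restrict_add_restrict_compl measurableSet_Iic]
  have hpdf : ∀ x : ℝ, x ≠ 0 → gaussianPDF 0 1 x =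
      ENNReal.ofReal |2 * c * x| * (2⁻¹ * gammaPDF (1 / 2) (1 / (2 * c)) (c * x ^ 2)) := by
    intro x hx
    have h2 : (2⁻¹ : ℝ≥0∞) = ENNReal.ofReal 2⁻¹ := by
      rw [ENNReal.ofReal_inv_of_pos two_pos]; simp
    rw [gammaPDF_of_nonneg (by positivity), gaussianPDF, h2, ← ENNReal.ofReal_mul (by positivity),
      ← ENNReal.ofReal_mul (by positivity), gaussianPDFReal]
    congr 1
    have h3 : (1 / (2 * c)) ^ (1 / 2 : ℝ) = (√(2 * c))⁻¹ := by
      rw [← Real.sqrt_eq_rpow, one_div, Real.sqrt_inv]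
    have h4 : (c * x ^ 2) ^ ((1 / 2 : ℝ) - 1) = (√c * |x|)⁻¹ := by
      rw [show (1 / 2 : ℝ) - 1 = -(1 / 2) by norm_num, Real.rpow_neg (by positivity),
        ← Real.sqrt_eq_rpow, Real.sqrt_mul hc.le, Real.sqrt_sq_eq_abs]
    have h5 : 1 / (2 * c) * (c * x ^ 2) = x ^ 2 / 2 := by field_simp
    rw [h3, h4, h5, Real.Gamma_one_half_eq, abs_mul, abs_of_pos (by positivity : 0 < 2 * c)]
    have hx' : |x| ≠ 0 := abs_ne_zero.2 hx
    have hc' : √c ≠ 0 := (Real.sqrt_pos.2 hc).ne'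
    have hsq : √c * √c = c := Real.mul_self_sqrt hc.le
    have h2' : √2 ≠ 0 := by positivity
    have hpi : √Real.pi ≠ 0 := by positivity
    rw [Real.sqrt_mul zero_le_two c]
    simp only [NNReal.coe_one, mul_one, sub_zero, neg_div]
    rw [Real.sqrt_mul zero_le_two]
    field_simp
    linear_combination hsq
  have hgm : Measurable fun y => 2⁻¹ * gammaPDF (1 / 2) (1 / (2 * c)) y :=
    (measurable_gammaPDFReal _ _).ennreal_ofReal.const_mul _
  have hd : ∀ x : ℝ, HasDerivAt (fun x => c * x ^ 2) (2 * c * x) x := fun x =>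
    (((hasDerivAt_id x).pow 2).const_mul c).congr_deriv (by simp; ring)
  have hsurj : ∀ y : ℝ, 0 < y → c * √(y / c) ^ 2 = y := by
    intro y hy
    rw [Real.sq_sqrt (by positivity)]
    field_simp
  have e1 := map_withDensity_of_bijOn measurableSet_Ioi (t := Set.Ioi 0) hm (fun x _ => hd x)
    ⟨fun x (hx : 0 < x) => by simp only [Set.mem_Ioi]; positivity,
      fun x (hx : 0 < x) y (hy : 0 < y) hxy =>
        (sq_eq_sq₀ hx.le hy.le).1 (mul_left_cancel₀ hc.ne' hxy),
      fun y (hy : 0 < y) => ⟨√(y / c), Real.sqrt_pos.2 (by positivity), hsurj y hy⟩⟩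
    (g := fun y => 2⁻¹ * gammaPDF (1 / 2) (1 / (2 * c)) y)
    (f := gaussianPDF 0 1) (fun x (hx : 0 < x) => hpdf x hx.ne')
  have e2 := map_withDensity_of_bijOn measurableSet_Iio (t := Set.Ioi 0) hm (fun x _ => hd x)
    ⟨fun x (hx : x < 0) => by
        have := sq_pos_of_neg hx
        simp only [Set.mem_Ioi]; positivity,
      fun x (hx : x < 0) y (hy : y < 0) hxy => by
        have h1 : (-x) ^ 2 = (-y) ^ 2 := by
          rw [neg_sq, neg_sq]; exact mul_left_cancel₀ hc.ne' hxy
        exact neg_injective ((sq_eq_sq₀ (by linarith) (by linarith)).1 h1),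
      fun y (hy : 0 < y) => ⟨-√(y / c), neg_lt_zero.2 (Real.sqrt_pos.2 (by positivity)), by
        simp only [neg_sq]; exact hsurj y hy⟩⟩
    (g := fun y => 2⁻¹ * gammaPDF (1 / 2) (1 / (2 * c)) y)
    (f := gaussianPDF 0 1) (fun x (hx : x < 0) => hpdf x hx.ne)
  rw [hsplit, Measure.map_add _ _ hm, e1, e2, ← withDensity_add_left hgm, gammaMeasure]
  have e3 : ((fun y => 2⁻¹ * gammaPDF (1 / 2) (1 / (2 * c)) y) +
      fun y => 2⁻¹ * gammaPDF (1 / 2) (1 / (2 * c)) y) = gammaPDF (1 / 2) (1 / (2 * c)) := by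
    funext y
    rw [Pi.add_apply, ← add_mul, ENNReal.inv_two_add_inv_two, one_mul]
  rw [e3]
  refine withDensity_restrict_eq measurableSet_Ioi ?_
  filter_upwards [Measure.ae_ne volume (0 : ℝ)] with x hx hx'
  exact gammaPDF_of_neg (lt_of_le_of_ne (not_lt.1 hx') hx)

/-- The density of the Rayleigh law. -/
noncomputable def rayleighPDF (r : ℝ) : ℝ≥0∞ := ENNReal.ofReal (r * Real.exp (-r ^ 2 / 2))

theorem measurable_rayleighPDF : Measurable rayleighPDF := by
  unfold rayleighPDF
  fun_prop

/-- In polar coordinates the joint density depends on the radius only, and the angle contributes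
`2π`, which cancels the normalisation. -/
theorem lintegral_gaussianReal_prod_sq_add_sq {f : ℝ → ℝ≥0∞} (hf : Measurable f) :
    ∫⁻ z : ℝ × ℝ, f (z.1 ^ 2 + z.2 ^ 2) ∂((gaussianReal 0 1).prod (gaussianReal 0 1)) =
      ∫⁻ r in Set.Ioi (0 : ℝ), rayleighPDF r * f (r ^ 2) := by
  have hm := measurable_gaussianPDF 0 1
  rw [gaussianReal_of_var_ne_zero 0 one_ne_zero, prod_withDensity hm hm,
    lintegral_withDensity_eq_lintegral_mul _ (by fun_prop) (by fun_prop),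
    ← Measure.volume_eq_prod, ← lintegral_comp_polarCoord_symm, polarCoord_target,
    Measure.volume_eq_prod, ← Measure.prod_restrict]
  have h1 : ∀ z : ℝ × ℝ, 0 < z.1 → ENNReal.ofReal z.1 • ((fun z : ℝ × ℝ => gaussianPDF 0 1 z.1 *
      gaussianPDF 0 1 z.2) * fun z : ℝ × ℝ => f (z.1 ^ 2 + z.2 ^ 2)) (polarCoord.symm z) =
      ENNReal.ofReal (2 * Real.pi)⁻¹ * (rayleighPDF z.1 * f (z.1 ^ 2)) := by
    rintro ⟨r, θ⟩ hr
    simp only at hr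
    have hsq : (r * Real.cos θ) ^ 2 + (r * Real.sin θ) ^ 2 = r ^ 2 := by
      rw [mul_pow, mul_pow, ← mul_add, Real.cos_sq_add_sin_sq, mul_one]
    have key : ENNReal.ofReal r * (gaussianPDF 0 1 (r * Real.cos θ) *
        gaussianPDF 0 1 (r * Real.sin θ)) = ENNReal.ofReal (2 * Real.pi)⁻¹ * rayleighPDF r := by
      rw [gaussianPDF, gaussianPDF, rayleighPDF,
        ← ENNReal.ofReal_mul (gaussianPDFReal_nonneg _ _ _),
        ← ENNReal.ofReal_mul hr.le, ← ENNReal.ofReal_mul (by positivity), gaussianPDFReal,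
        gaussianPDFReal]
      congr 1
      have hpi : (√(2 * Real.pi))⁻¹ * (√(2 * Real.pi))⁻¹ = (2 * Real.pi)⁻¹ := by
        rw [← mul_inv, Real.mul_self_sqrt (by positivity)]
      have he : Real.exp (-(r * Real.cos θ) ^ 2 / 2) * Real.exp (-(r * Real.sin θ) ^ 2 / 2) =
          Real.exp (-r ^ 2 / 2) := by
        rw [← Real.exp_add]; congr 1; linear_combination -hsq / 2
      simp only [NNReal.coe_one, mul_one, sub_zero]
      linear_combination r * (√(2 * Real.pi))⁻¹ * (√(2 * Real.pi))⁻¹ * he +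
        r * Real.exp (-r ^ 2 / 2) * hpi
    simp only [polarCoord_symm_apply, Pi.mul_apply, hsq, smul_eq_mul]
    rw [← mul_assoc, key, mul_assoc]
  have hmr : Measurable fun r => rayleighPDF r * f (r ^ 2) :=
    measurable_rayleighPDF.mul (by fun_prop)
  have hmr' : Measurable fun z : ℝ × ℝ => rayleighPDF z.1 * f (z.1 ^ 2) := hmr.comp measurable_fst
  rw [Measure.prod_restrict, setLIntegral_congr_fun (measurableSet_Ioi.prod measurableSet_Ioo)
    (fun z hz => h1 z hz.1), ← Measure.prod_restrict,
    lintegral_const_mul _ hmr', lintegral_prod _ hmr'.aemeasurable]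
  simp only [lintegral_const, Measure.restrict_apply MeasurableSet.univ, Set.univ_inter,
    Real.volume_Ioo]
  rw [lintegral_mul_const _ hmr, mul_comm, mul_assoc,
    ← ENNReal.ofReal_mul (by linarith [Real.pi_pos]),
    show (Real.pi - -Real.pi) * (2 * Real.pi)⁻¹ = 1 by
      have := Real.pi_pos.ne'
      field_simp; ring]
  simp

section

variable {Ω : Type*} [MeasurableSpace Ω] {P : Measure Ω} [IsProbabilityMeasure P]
  {H : Type*} [NormedAddCommGroup H] [InnerProductSpace ℝ H] {W : H → Ω → ℝ}

theorem map_sum_sq_two (hW : IsIsonormal W P) {h : Fin 2 → H} (hh : Orthonormal ℝ h) {k : ℝ → ℝ}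
    (hk : Measurable k) : P.map (fun ω => k (∑ i, W (h i) ω ^ 2)) =
      ((volume.restrict (Set.Ioi 0)).withDensity rayleighPDF).map fun r => k (r ^ 2) := by
  have hmk : Measurable fun r : ℝ => k (r ^ 2) := by fun_prop
  have hpair : P.map (fun ω => (W (h 0) ω, W (h 1) ω)) =
      (gaussianReal 0 1).prod (gaussianReal 0 1) := by
    rw [← (measurePreserving_finTwoArrow (gaussianReal 0 1)).map_eq,
      ← map_orthonormal_eq_pi hW hh, Measure.map_map (by fun_prop) (measurable_family hW h)]
    rfl
  have hpm : Measurable fun ω => (W (h 0) ω, W (h 1) ω) :=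
    (hW.measurable _).prodMk (hW.measurable _)
  refine Measure.ext_of_lintegral _ fun f hf => ?_
  rw [lintegral_map hf hmk, lintegral_withDensity_eq_lintegral_mul _ measurable_rayleighPDF (by fun_prop)]
  have := lintegral_gaussianReal_prod_sq_add_sq (f := fun s => f (k s)) (by fun_prop)
  rw [← hpair, lintegral_map (by fun_prop) hpm] at this
  rw [lintegral_map hf (by
    simp only [Fin.sum_univ_two]
    exact hk.comp (((hW.measurable _).pow_const 2).add ((hW.measurable _).pow_const 2)))]
  simpa [Fin.sum_univ_two] using this

theorem map_const_mul (hW : IsIsonormal W P) {h : H} (hh : ‖h‖ = 1) (c : ℝ) :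
    P.map (fun ω => c * W h ω) = gaussianReal 0 (Real.toNNReal (c ^ 2)) := by
  have := gaussianReal_map_const_mul (μ := 0) (v := 1) c
  rw [← hW.map_eq_of_norm hh, Measure.map_map (by fun_prop) (hW.measurable h)] at this
  rw [show (fun ω => c * W h ω) = (fun x => c * x) ∘ W h from rfl, this, mul_zero, mul_one]
  congr 1
  exact (Real.toNNReal_of_nonneg (sq_nonneg c)).symm

theorem map_square (hW : IsIsonormal W P) {h : H} (hh : ‖h‖ = 1) {c : ℝ} (hc : 0 < c) :
    P.map (fun ω => c * (W h ω ^ 2 - 1)) =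
      (gammaMeasure (1 / 2) (1 / (2 * c))).map fun x => x - c := by
  rw [← gaussianReal_map_const_mul_sq hc, ← hW.map_eq_of_norm hh,
    Measure.map_map (by fun_prop) (hW.measurable h),
    Measure.map_map (by fun_prop) ((by fun_prop : Measurable fun x : ℝ => c * x ^ 2).comp
      (hW.measurable h))]
  congr 1
  funext ω
  simp only [Function.comp_apply]
  ring

theorem map_exp (hW : IsIsonormal W P) {h : H} (hh : ‖h‖ = 1) (c : ℝ) :
    P.map (fun ω => Real.exp (c * W h ω)) =
      (gaussianReal 0 (Real.toNNReal (c ^ 2))).map Real.exp := by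
  rw [← map_const_mul hW hh c, Measure.map_map (by fun_prop) ((hW.measurable h).const_mul c)]
  rfl

/-! ### The Pareto, beta and uniform laws. -/

theorem hasDerivAt_exp_const_mul_sq (c r : ℝ) :
    HasDerivAt (fun r => Real.exp (c * r ^ 2)) (2 * c * r * Real.exp (c * r ^ 2)) r :=
  (((hasDerivAt_id r).pow 2).const_mul c).exp.congr_deriv (by simp; ring)

theorem injOn_exp_const_mul_sq {c : ℝ} (hc : c ≠ 0) :
    Set.InjOn (fun r : ℝ => Real.exp (c * r ^ 2)) (Set.Ioi 0) := by
  intro x hx y hy hxy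
  have := mul_left_cancel₀ hc (Real.exp_injective hxy)
  exact (sq_eq_sq₀ (le_of_lt hx) (le_of_lt hy)).1 this

/-- With `y = exp (c r²)` the Rayleigh tail `exp (-r²/2)` becomes `y^{-1/(2c)}`, the tail of the
Pareto law. -/
theorem map_exp_pareto (hW : IsIsonormal W P) {h : Fin 2 → H} (hh : Orthonormal ℝ h) {c : ℝ}
    (hc : 0 < c) : P.map (fun ω => Real.exp (c * ∑ k, W (h k) ω ^ 2)) =
      paretoMeasure 1 (1 / (2 * c)) := by
  rw [map_sum_sq_two hW hh (k := fun s => Real.exp (c * s)) (by fun_prop)]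
  have hb : Set.BijOn (fun r : ℝ => Real.exp (c * r ^ 2)) (Set.Ioi 0) (Set.Ioi 1) := by
    refine ⟨fun x (hx : 0 < x) => Real.one_lt_exp_iff.2 (by positivity),
      injOn_exp_const_mul_sq hc.ne', fun y (hy : 1 < y) => ?_⟩
    have hl : 0 < Real.log y / c := div_pos (Real.log_pos hy) hc
    refine ⟨√(Real.log y / c), Real.sqrt_pos.2 hl, ?_⟩
    simp only
    rw [Real.sq_sqrt hl.le, mul_div_cancel₀ _ hc.ne', Real.exp_log (by linarith)]
  rw [map_withDensity_of_bijOn measurableSet_Ioi (by fun_prop)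
    (fun r _ => hasDerivAt_exp_const_mul_sq c r) hb (g := paretoPDF 1 (1 / (2 * c)))
    ?_, paretoMeasure]
  · refine withDensity_restrict_eq measurableSet_Ioi ?_
    filter_upwards [Measure.ae_ne volume (1 : ℝ)] with x hx hx'
    exact paretoPDF_of_lt (lt_of_le_of_ne (not_lt.1 hx') hx)
  · intro r (hr : 0 < r)
    rw [paretoPDF_of_le (hb.mapsTo hr).le, rayleighPDF, ← ENNReal.ofReal_mul (abs_nonneg _),
      abs_of_pos (by positivity)]
    congr 1
    rw [Real.one_rpow, ← Real.exp_mul]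
    have : Real.exp (-r ^ 2 / 2) = Real.exp (c * r ^ 2) *
        Real.exp (c * r ^ 2 * -(1 / (2 * c) + 1)) := by
      rw [← Real.exp_add]; congr 1; field_simp; ring
    rw [this]
    field_simp

theorem beta_one_right {α : ℝ} (hα : 0 < α) : ProbabilityTheory.beta α 1 = 1 / α := by
  rw [ProbabilityTheory.beta, Real.Gamma_one, Real.Gamma_add_one hα.ne', mul_one]
  have := (Real.Gamma_pos_of_pos hα).ne'
  field_simp

/-- For `c < 0` the same substitution decreases from `1` to `0`, and `y^{-1/(2c)}` is now the
distribution function on `(0, 1)`. -/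
theorem map_exp_beta (hW : IsIsonormal W P) {h : Fin 2 → H} (hh : Orthonormal ℝ h) {c : ℝ}
    (hc : c < 0) : P.map (fun ω => Real.exp (c * ∑ k, W (h k) ω ^ 2)) =
      betaMeasure (-1 / (2 * c)) 1 := by
  rw [map_sum_sq_two hW hh (k := fun s => Real.exp (c * s)) (by fun_prop)]
  have hb : Set.BijOn (fun r : ℝ => Real.exp (c * r ^ 2)) (Set.Ioi 0) (Set.Ioo 0 1) := by
    refine ⟨fun x (hx : 0 < x) => ⟨Real.exp_pos _, Real.exp_lt_one_iff.2
      (mul_neg_of_neg_of_pos hc (by positivity))⟩,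
      injOn_exp_const_mul_sq hc.ne, fun y hy => ?_⟩
    have hl : 0 < Real.log y / c := div_pos_of_neg_of_neg (Real.log_neg hy.1 hy.2) hc
    refine ⟨√(Real.log y / c), Real.sqrt_pos.2 hl, ?_⟩
    simp only
    rw [Real.sq_sqrt hl.le, mul_div_cancel₀ _ hc.ne, Real.exp_log hy.1]
  rw [map_withDensity_of_bijOn measurableSet_Ioi (by fun_prop)
    (fun r _ => hasDerivAt_exp_const_mul_sq c r) hb (g := betaPDF (-1 / (2 * c)) 1)
    ?_, betaMeasure]
  · refine withDensity_restrict_eq measurableSet_Ioo (Eventually.of_forall fun x hx => ?_)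
    rw [betaPDF_eq, if_neg (by exact hx), ENNReal.ofReal_zero]
  · intro r (hr : 0 < r)
    have hα : 0 < -1 / (2 * c) := div_pos_of_neg_of_neg (by norm_num) (by linarith)
    rw [betaPDF_of_pos_lt_one (hb.mapsTo hr).1 (hb.mapsTo hr).2, rayleighPDF,
      ← ENNReal.ofReal_mul (abs_nonneg _), beta_one_right hα, abs_of_neg (mul_neg_of_neg_of_pos
        (mul_neg_of_neg_of_pos (by linarith) hr) (Real.exp_pos _))]
    congr 1
    rw [sub_self, Real.rpow_zero, mul_one, one_div_one_div, ← Real.exp_mul]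
    have : Real.exp (-r ^ 2 / 2) = Real.exp (c * r ^ 2) *
        Real.exp (c * r ^ 2 * (-1 / (2 * c) - 1)) := by
      rw [← Real.exp_add]; congr 1; field_simp [hc.ne]; ring
    rw [this]
    field_simp [hc.ne]

theorem betaMeasure_one_one : betaMeasure 1 1 = volume.restrict (Set.Icc (0 : ℝ) 1) := by
  rw [← Measure.restrict_congr_set Ioo_ae_eq_Icc, betaMeasure, ← withDensity_indicator_one measurableSet_Ioo]
  congr 1
  funext x
  by_cases hx : x ∈ Set.Ioo (0 : ℝ) 1
  · rw [betaPDF_of_pos_lt_one hx.1 hx.2, beta_one_right one_pos]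
    simp [hx.1, hx.2]
  · rw [betaPDF_eq, if_neg (by exact hx), ENNReal.ofReal_zero, Set.indicator_of_notMem hx]

end

end Malliavin

theorem mainTheorem6 {Ω : Type*} [MeasurableSpace Ω] (P : Measure Ω) [IsProbabilityMeasure P]
    {H : Type*} [NormedAddCommGroup H] [InnerProductSpace ℝ H] [CompleteSpace H]
    [TopologicalSpace.SeparableSpace H]
    (W : H → Ω → ℝ) (hW : Malliavin.IsIsonormal W P) :
    -- the random variable ⟨D (-L)⁻¹ (F - E[F]), D F⟩ is well defined, measurable with respect to the σ-field of F, and explicit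
    (∀ F R : Ω → ℝ, Malliavin.Family W F R →
      (∃ p : ℝ≥0∞, 1 < p ∧ p ≠ ∞ ∧ MemLp F p P) ∧
      ∀ p : ℝ≥0∞, 1 < p → p ≠ ∞ → MemLp F p P →
        (∃ Γ : Ω → ℝ, Malliavin.IsMalliavinBracket W P p F Γ) ∧
        ∀ Γ : Ω → ℝ, Malliavin.IsMalliavinBracket W P p F Γ →
          AEStronglyMeasurable[MeasurableSpace.comap F (borel ℝ)] Γ P ∧ Γ =ᵐ[P] R) ∧
    -- the laws that occur
    (∀ (c : ℝ) (h : H), ‖h‖ = 1 →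
      P.map (fun ω => c * W h ω) = gaussianReal 0 (Real.toNNReal (c ^ 2))) ∧
    (∀ (c : ℝ) (h : H), 0 < c → ‖h‖ = 1 →
      P.map (fun ω => c * (W h ω ^ 2 - 1)) =
        (gammaMeasure (1 / 2) (1 / (2 * c))).map (fun x => x - c)) ∧
    (∀ (c : ℝ) (h : H), ‖h‖ = 1 →
      P.map (fun ω => Real.exp (c * W h ω)) =
        (gaussianReal 0 (Real.toNNReal (c ^ 2))).map Real.exp) ∧
    (∀ h : Fin 2 → H, Orthonormal ℝ h →
      P.map (fun ω => Real.exp (-(1 / 2) * ∑ k, W (h k) ω ^ 2)) =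
        volume.restrict (Set.Icc (0 : ℝ) 1)) ∧
    (∀ (c : ℝ) (h : Fin 2 → H), 0 < c → c < 1 / 2 → Orthonormal ℝ h →
      P.map (fun ω => Real.exp (c * ∑ k, W (h k) ω ^ 2)) = paretoMeasure 1 (1 / (2 * c))) ∧
    (∀ (c : ℝ) (h : Fin 2 → H), c < 0 → Orthonormal ℝ h →
      P.map (fun ω => Real.exp (c * ∑ k, W (h k) ω ^ 2)) = betaMeasure (-1 / (2 * c)) 1) := by
  refine ⟨fun F R h => ⟨h.exists_memLp hW, fun p hp1 hp hF => h.bracket_formula hW hp1 hp hF⟩,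
    fun c h hh => Malliavin.map_const_mul hW hh c, fun c h hc hh => Malliavin.map_square hW hh hc,
    fun c h hh => Malliavin.map_exp hW hh c, fun h hh => ?_,
    fun c h hc _ hh => Malliavin.map_exp_pareto hW hh hc,
    fun c h hc hh => Malliavin.map_exp_beta hW hh hc⟩
  -- At `c = -1/2` the first beta parameter `-1/(2c)` equals `1`, and the beta law with parameters
  -- `1, 1` is uniform.
  rw [Malliavin.map_exp_beta hW hh (by norm_num), ← Malliavin.betaMeasure_one_one]
  norm_num
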